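/- Let $n\ge 0$ and let $\Bbbk$ be a field whose characteristic does not divide $2(n+1)$. Put $[2]=t+t^{-1}$. Call $i,j\in\{1,\dots,n\}$ adjacent if $|i-j|=1$ and distant if $|i-j|\ge 2$. **The category $\mathcal{TLC}_1$.** Objects are finite sequences $\underline{i}$ of elements (colors) of $\{1,\dots,n\}$. $\mathrm{HOM}(\underline i,\underline j)$ is the $\Bbbk$-span of isotopy classes of diagrams in the strip $\mathbb R\times[0,1]$ with bottom boundary $\underline i$ and top boundary $\underline j$; a diagram consists, for each color $i$, of a planar graph $\Gamma_i$ with only univalent vertices (dots) and trivalent vertices, whose edges may end on the boundary, such that $\Gamma_i\cap\Gamma_{i+1}=\emptyset$ and the $\Gamma_i$ are pairwise disjoint on the boundary; graphs of distant colors may cross, and may be moved through each other by isotopy. The degree of a diagram is the number of dots minus the number of trivalent vertices. A double dot of color $i$ (an edge joining two dots) is denoted $f_i$, and a broken line of color $i$ is the vertical line with its middle removed, leaving two dots. The following local relations are imposed: 1. for one color, the two trivalent trees with four boundary edges (the $H$ and the $I$ shape) are equal; 2. a trivalent vertex with a dot on one leg equals a line; 3. an empty needle (a trivalent vertex two of whose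 legs are joined to a loop with empty interior) is $0$; 4. ($f_i$ left of an $i$-line) $+$ ($f_i$ right of it) $=2\cdot$(broken $i$-line); 5. for $i,j$ adjacent, ($f_j$ left of an $i$-line) $=$ ($f_i+f_j$ right of it) $-$ (broken $i$-line); 6. for $i,j$ adjacent and boundary points colored cyclically $i,j,i,j$: (the two $j$-points joined by a line, the two $i$-points ending in dots) $=-$(the two $i$-points joined by a line, the two $j$-points ending in dots). Composition is vertical concatenation. The relations are homogeneous, so the spaces $\mathrm{HOM}(\underline i,\underline j)$ are graded; the graded dimension of $\bigoplus_m V_m$ is $\sum_m \dim_\Bbbk (V_m)\,t^m$. **The algebra and its pairings.** $\mathcal{TL}$ is the $\mathbb Z[t,t^{-1}]$-algebra with generators $u_1,\dots,u_n$ and relations $u_i^2=[2]u_i$; $u_iu_j=u_ju_i$ for distant $i,j$; $u_iu_ju_i=u_i$ for adjacent $i,j$. For $\underline i=i_1\cdots i_d$ put $u_{\underline i}=u_{i_1}\cdots u_{i_d}$. A pairing on $\mathcal{TL}$ is a $\mathbb Z$-bilinear map $(\,,)\colon\mathcal{TL}\times\mathcal{TL}\to\mathbb Z[[t,t^{-1}]]$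 with $(t^ax,y)=t^{-a}(x,y)$, $(x,t^ay)=t^a(x,y)$, $(x,u_iy)=(u_ix,y)$ and $(x,yu_i)=(xu_i,y)$ for all $x,y,i$ and all $a\in\mathbb Z$. **Lemma.** There is exactly one pairing $\psi_0$ on $\mathcal{TL}$ such that $$(1,1)=\frac{t^n[2]^n-t^2}{1-t^2},\qquad (1,u_{\underline i})=\frac{t^n[2]^{n-d}}{1-t^2}\quad\text{for every increasing }\underline i\text{ of length } d\ge 1$$ (expanded in powers of $t$), and it is the pairing given by graded dimensions of Hom spaces in $\mathcal{TLC}_1$: for all sequences $\underline i,\underline j$, every homogeneous component of $\mathrm{HOM}(\underline i,\underline j)$ is finite-dimensional and the graded dimension of $\mathrm{HOM}(\underline i,\underline j)$ is $(u_{\underline i},u_{\underline j})_{\psi_0}$. Moreover, let $R=\Bbbk[f_1,\dots,f_n]$ with $\deg f_i=2$, acting on $\mathrm{HOM}(\emptyset,\underline i)$ by placing double dots in the outer region. For increasing $\underline i$ of length $d\ge 0$, let $\phi_{\underline i}\colon\emptyset\to\underline i$ be the diagram with one boundary dot at each boundary point. Then $p\mapsto p\,\phi_{\underline i}$ is surjective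 from $R$ onto $\mathrm{HOM}(\emptyset,\underline i)$ and its kernel is an ideal $I_{\underline i}$, so that $R/I_{\underline i}\cong\mathrm{HOM}(\emptyset,\underline i)$ as vector spaces, the degree $2r$ part of $R/I_{\underline i}$ corresponding to the degree $2r+d$ part of $\mathrm{HOM}(\emptyset,\underline i)$. -/

import Mathlib

/-! ### Diagrams

Colours are the elements of `Fin n` (the vertices of the Dynkin diagram `A_n`), objects are words
in the colours.  A planar diagram in a strip is written as a vertical stack of layers, each of
which contains exactly one elementary piece; diagrams are read from bottom (source) to top
(target).  Planar isotopy and the graphical relations are imposed afterwards. -/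

namespace TLCat

/-- Objects: finite sequences of colours. -/
abbrev Word (n : ℕ) : Type := List (Fin n)

/-- `|i - j| = 1`. -/
def Adjacent {n : ℕ} (i j : Fin n) : Prop := i.val + 1 = j.val ∨ j.val + 1 = i.val

/-- `|i - j| ≥ 2`. -/
def Distant {n : ℕ} (i j : Fin n) : Prop := i.val + 2 ≤ j.val ∨ j.val + 2 ≤ i.val

/-- The elementary pieces: the two positions of a univalent vertex, the two of a trivalent vertex,
local minima and maxima of an edge, and the crossing of two edges of distant colours. -/
inductive Gen (n : ℕ) : Word n → Word n → Type
  | startDot (i : Fin n) : Gen n [] [i]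
  | endDot (i : Fin n) : Gen n [i] []
  | merge (i : Fin n) : Gen n [i, i] [i]
  | split (i : Fin n) : Gen n [i] [i, i]
  | cup (i : Fin n) : Gen n [] [i, i]
  | cap (i : Fin n) : Gen n [i, i] []
  | cross (i j : Fin n) (h : Distant i j) : Gen n [i, j] [j, i]

/-- `+1` for each dot, `-1` for each trivalent vertex. -/
def Gen.degree {n : ℕ} {a b : Word n} : Gen n a b → ℤ
  | .startDot _ => 1
  | .endDot _ => 1
  | .merge _ => -1
  | .split _ => -1
  | .cup _ => 0
  | .cap _ => 0
  | .cross _ _ _ => 0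

/-- One elementary piece with vertical strands `left` and `right` of it. -/
structure Layer {n : ℕ} (s t : Word n) where
  left : Word n
  right : Word n
  bot : Word n
  top : Word n
  gen : Gen n bot top
  src_eq : s = left ++ bot ++ right
  tgt_eq : t = left ++ top ++ right

/-- Stacks of layers, listed from bottom to top. -/
inductive Diag {n : ℕ} : Word n → Word n → Type
  | nil (w : Word n) : Diag w w
  | cons {s t u : Word n} (L : Layer s t) (D : Diag t u) : Diag s u

/-- Add vertical strands on both sides of a layer. -/
def Layer.whisker {n : ℕ} (l r : Word n) {s t : Word n} (L : Layer s t) :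
    Layer (l ++ s ++ r) (l ++ t ++ r) where
  left := l ++ L.left
  right := L.right ++ r
  bot := L.bot
  top := L.top
  gen := L.gen
  src_eq := by simp [L.src_eq]
  tgt_eq := by simp [L.tgt_eq]

namespace Diag

variable {n : ℕ}

/-- Vertical concatenation: `D.comp E` is `E` on top of `D`. -/
def comp {s t u : Word n} : Diag s t → Diag t u → Diag s u
  | .nil _, E => E
  | .cons L D, E => .cons L (comp D E)

/-- Add vertical strands on both sides of a diagram. -/
def whisker (l r : Word n) {s t : Word n} : Diag s t → Diag (l ++ s ++ r) (l ++ t ++ r)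
  | .nil w => .nil (l ++ w ++ r)
  | .cons L D => .cons (L.whisker l r) (whisker l r D)

/-- The degree of a diagram. -/
def degree {s t : Word n} : Diag s t → ℤ
  | .nil _ => 0
  | .cons L D => L.gen.degree + degree D

/-- The diagram with one layer `l ⊗ g ⊗ r`. -/
def one (l : Word n) {a b : Word n} (g : Gen n a b) (r : Word n) :
    Diag (l ++ a ++ r) (l ++ b ++ r) :=
  .cons ⟨l, r, a, b, g, rfl, rfl⟩ (.nil _)

/-- The same, with source and target given up to associativity of concatenation. -/
def step {s t : Word n} (l : Word n) {a b : Word n} (g : Gen n a b) (r : Word n)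
    (hs : s = l ++ a ++ r) (ht : t = l ++ b ++ r) : Diag s t :=
  .cons ⟨l, r, a, b, g, hs, ht⟩ (.nil _)

/-- Insert a diagram into a larger one: strands `l`, `r` at its sides, `p` below and `q` above. -/
def insert {s t a b : Word n} (l r : Word n) (p : Diag s (l ++ a ++ r)) (q : Diag (l ++ b ++ r) t)
    (D : Diag a b) : Diag s t :=
  p.comp ((D.whisker l r).comp q)

/-- The double dot of colour `i`. -/
def doubleDot (i : Fin n) : Diag ([] : Word n) [] :=
  (one [] (.startDot i) []).comp (one [] (.endDot i) [])

/-- A line of colour `i` broken into an end dot below a start dot. -/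
def brokenLine (i : Fin n) : Diag [i] [i] :=
  (one [] (.endDot i) []).comp (one [] (.startDot i) [])

/-- A double dot of colour `j` to the left of a line of colour `i`. -/
def dotLeft (j i : Fin n) : Diag [i] [i] :=
  (one [] (.startDot j) [i]).comp (one [] (.endDot j) [i])

/-- A double dot of colour `j` to the right of a line of colour `i`. -/
def dotRight (i j : Fin n) : Diag [i] [i] :=
  (one [i] (.startDot j) []).comp (one [i] (.endDot j) [])

end Diag

open Diag

/-- Elementary isotopies.  For distant colours the graphs may be moved through each other, so the
moves between distant colours are isotopies. -/
inductive Isotopy {n : ℕ} : (a b : Word n) → Diag a b → Diag a b → Prop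
  -- two pieces side by side may exchange their heights
  | interchange {a b c d : Word n} (g : Gen n a b) (h : Gen n c d) (m : Word n) :
      Isotopy (a ++ m ++ c) (b ++ m ++ d)
        ((step (t := b ++ m ++ c) [] g (m ++ c) (by simp) (by simp)).comp
          (step (b ++ m) h [] (by simp) (by simp)))
        ((step (t := a ++ m ++ d) (a ++ m) h [] (by simp) (by simp)).comp
          (step [] g (m ++ d) (by simp) (by simp)))
  -- straightening an edge
  | zigzag_left (i : Fin n) :
      Isotopy [i] [i] ((one [i] (.cup i) []).comp (one [] (.cap i) [i])) (.nil [i])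
  | zigzag_right (i : Fin n) :
      Isotopy [i] [i] ((one [] (.cup i) [i]).comp (one [i] (.cap i) [])) (.nil [i])
  -- rotating a dot
  | dot_left (i : Fin n) :
      Isotopy [i] [] ((one [] (.startDot i) [i]).comp (one [] (.cap i) [])) (one [] (.endDot i) [])
  | dot_right (i : Fin n) :
      Isotopy [i] [] ((one [i] (.startDot i) []).comp (one [] (.cap i) [])) (one [] (.endDot i) [])
  -- rotating a trivalent vertex
  | trivalent_left (i : Fin n) :
      Isotopy [i] [i, i] ((one [] (.cup i) [i]).comp (one [i] (.merge i) []))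
        (one [] (.split i) [])
  | trivalent_right (i : Fin n) :
      Isotopy [i] [i, i] ((one [i] (.cup i) []).comp (one [] (.merge i) [i]))
        (one [] (.split i) [])
  -- rotating a crossing
  | cross_rotate (i j : Fin n) (h : Distant i j) (h' : Distant j i) :
      Isotopy [j, i] [i, j]
        ((one [] (.cup i) [j, i]).comp ((one [i] (.cross i j h) [i]).comp (one [i, j] (.cap i) [])))
        (one [] (.cross j i h') [])
  -- pulling apart two edges of distant colours
  | cross_cross (i j : Fin n) (h : Distant i j) (h' : Distant j i) :
      Isotopy [i, j] [i, j] ((one [] (.cross i j h) []).comp (one [] (.cross j i h') []))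
        (.nil [i, j])
  -- moving a dot through an edge of distant colour
  | cross_dot (i j : Fin n) (h : Distant i j) :
      Isotopy [j] [j, i] ((one [] (.startDot i) [j]).comp (one [] (.cross i j h) []))
        (one [j] (.startDot i) [])
  -- moving a trivalent vertex through an edge of distant colour
  | cross_trivalent (i j : Fin n) (h : Distant i j) :
      Isotopy [i, i, j] [j, i] ((one [] (.merge i) [j]).comp (one [] (.cross i j h) []))
        ((one [i] (.cross i j h) []).comp ((one [] (.cross i j h) [i]).comp
          (one [j] (.merge i) [])))
  -- moving a crossing through an edge, all three colours mutually distant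
  | cross_cross_cross (i j l : Fin n) (hij : Distant i j) (hil : Distant i l) (hjl : Distant j l) :
      Isotopy [i, j, l] [l, j, i]
        ((one [] (.cross i j hij) [l]).comp ((one [j] (.cross i l hil) []).comp
          (one [] (.cross j l hjl) [i])))
        ((one [i] (.cross j l hjl) []).comp ((one [] (.cross i l hil) [j]).comp
          (one [l] (.cross i j hij) [])))

/-- A diagram as a formal linear combination. -/
noncomputable def pic (k : Type*) [Field k] {n : ℕ} {a b : Word n} (D : Diag a b) :
    Diag a b →₀ k :=
  Finsupp.single D 1

/-- The local graphical relations: each listed combination is set to zero. -/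
inductive GraphRel (k : Type*) [Field k] {n : ℕ} : (a b : Word n) → (Diag a b →₀ k) → Prop
  -- `I = H` for two trivalent vertices of one colour
  | assoc (i : Fin n) :
      GraphRel k [i, i] [i, i]
        (pic k (a := [i, i]) (b := [i, i]) ((one [] (.merge i) []).comp (one [] (.split i) []))
          - pic k (a := [i, i]) (b := [i, i]) ((one [] (.split i) [i]).comp (one [i] (.merge i) [])))
  -- a trivalent vertex with a dot is a line
  | unit (i : Fin n) :
      GraphRel k [i] [i]
        (pic k (a := [i]) (b := [i]) ((one [] (.startDot i) [i]).comp (one [] (.merge i) []))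
          - pic k (.nil [i]))
  -- an empty needle is zero
  | needle (i : Fin n) :
      GraphRel k [i] [] (pic k ((one [] (.split i) []).comp (one [] (.cap i) [])))
  -- forcing a double dot through a line of the same colour
  | dot_same (i : Fin n) :
      GraphRel k [i] [i]
        (pic k (dotLeft i i) + pic k (dotRight i i) - (2 : k) • pic k (brokenLine i))
  -- forcing a double dot through a line of an adjacent colour
  | dot_near (i j : Fin n) (h : Adjacent i j) :
      GraphRel k [i] [i]
        (pic k (dotLeft j i)
          - (pic k (dotRight i j) + pic k (dotRight i i) - pic k (brokenLine i)))
  -- for adjacent colours: a `j`-line between two `i`-dots is minus an `i`-line between two `j`-dots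
  | switch (i j : Fin n) (h : Adjacent i j) :
      GraphRel k [j] [i, j, i]
        (pic k (a := [j]) (b := [i, j, i])
            ((one [] (.startDot i) [j]).comp (one [i, j] (.startDot i) []))
          + pic k (a := [j]) (b := [i, j, i])
            ((one [] (.endDot j) []).comp ((one [] (.cup i) []).comp
              (one [i] (.startDot j) [i]))))

/-- The span of all elementary isotopies and graphical relations, inserted into all larger
diagrams. -/
noncomputable def relations (k : Type*) [Field k] {n : ℕ} (s t : Word n) :
    Submodule k (Diag s t →₀ k) :=
  Submodule.span k
    ({x | ∃ (a b l r : Word n) (p : Diag s (l ++ a ++ r)) (q : Diag (l ++ b ++ r) t)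
        (D E : Diag a b), Isotopy a b D E ∧
          x = pic k (Diag.insert l r p q D) - pic k (Diag.insert l r p q E)} ∪
     {x | ∃ (a b l r : Word n) (p : Diag s (l ++ a ++ r)) (q : Diag (l ++ b ++ r) t)
        (y : Diag a b →₀ k), GraphRel k a b y ∧
          x = Finsupp.mapDomain (Diag.insert l r p q) y})

/-- The space `HOM(s, t)` of morphisms of all degrees. -/
abbrev HOM (k : Type*) [Field k] {n : ℕ} (s t : Word n) : Type _ :=
  (Diag s t →₀ k) ⧸ relations k s t

/-- The morphism represented by a diagram. -/
noncomputable def cls (k : Type*) [Field k] {n : ℕ} {s t : Word n} (D : Diag s t) : HOM k s t :=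
  (relations k s t).mkQ (pic k D)

/-- The morphisms of degree `m`. -/
noncomputable def homDeg (k : Type*) [Field k] {n : ℕ} (s t : Word n) (m : ℤ) :
    Submodule k (HOM k s t) :=
  Submodule.span k {x | ∃ D : Diag s t, D.degree = m ∧ x = cls k D}

/-- The morphism `φ_w : ∅ → w`, one boundary dot for each letter. -/
def phi {n : ℕ} : (w : Word n) → Diag [] w
  | [] => .nil []
  | i :: w => (phi w).comp (one [] (.startDot i) w)

/-- The closed diagram consisting of `e i` double dots of each colour `i`. -/
def doubleDots {n : ℕ} (e : Fin n →₀ ℕ) : Diag ([] : Word n) [] :=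
  (List.finRange n).foldr (fun i D => (fun E => (doubleDot i).comp E)^[e i] D) (.nil [])

/-- The map `R = k[f_1, …, f_n] → HOM(∅, w)`, `p ↦ p · φ_w`, where `f_i` acts by a double dot of
colour `i`. -/
noncomputable def polyMap (k : Type*) [Field k] {n : ℕ} (w : Word n) :
    MvPolynomial (Fin n) k →ₗ[k] HOM k [] w :=
  (MvPolynomial.basisMonomials (Fin n) k).constr k
    (fun e => cls k ((doubleDots e).comp (phi w)))

/-! ### The Temperley-Lieb algebra and its pairings -/

open scoped LaurentPolynomial

/-- The Temperley-Lieb relations over `ℤ[t, t⁻¹]`. -/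
inductive TLRel (n : ℕ) :
    FreeAlgebra ℤ[T;T⁻¹] (Fin n) → FreeAlgebra ℤ[T;T⁻¹] (Fin n) → Prop
  | sq (i : Fin n) :
      TLRel n (FreeAlgebra.ι _ i * FreeAlgebra.ι _ i)
        ((LaurentPolynomial.T 1 + LaurentPolynomial.T (-1) : ℤ[T;T⁻¹]) • FreeAlgebra.ι _ i)
  | comm (i j : Fin n) (h : Distant i j) :
      TLRel n (FreeAlgebra.ι _ i * FreeAlgebra.ι _ j) (FreeAlgebra.ι _ j * FreeAlgebra.ι _ i)
  | braid (i j : Fin n) (h : Adjacent i j) :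
      TLRel n (FreeAlgebra.ι _ i * FreeAlgebra.ι _ j * FreeAlgebra.ι _ i) (FreeAlgebra.ι _ i)

/-- The Temperley-Lieb algebra on `n + 1` strands. -/
abbrev TL (n : ℕ) : Type := RingQuot (TLRel n)

/-- The generator `u_i`. -/
noncomputable def uGen {n : ℕ} (i : Fin n) : TL n :=
  RingQuot.mkAlgHom ℤ[T;T⁻¹] (TLRel n) (FreeAlgebra.ι _ i)

/-- The monomial `u_w`. -/
noncomputable def uWord {n : ℕ} (w : Word n) : TL n := (w.map uGen).prod

/-- The group `ℤ[[t, t⁻¹]]` of two-sided formal series, given by their coefficients. -/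
abbrev TwoSided : Type := ℤ → ℤ

/-- A pairing: `ℤ`-bilinear, semilinear with respect to `t ↦ t⁻¹` in the first variable, with all
`u_i` self-adjoint for left and for right multiplication. -/
structure IsPairing (n : ℕ) (B : TL n →+ TL n →+ TwoSided) : Prop where
  semilinear_left : ∀ (a : ℤ) (x y : TL n) (m : ℤ),
    B ((LaurentPolynomial.T a : ℤ[T;T⁻¹]) • x) y m = B x y (m + a)
  linear_right : ∀ (a : ℤ) (x y : TL n) (m : ℤ),
    B x ((LaurentPolynomial.T a : ℤ[T;T⁻¹]) • y) m = B x y (m - a)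
  adjoint_left : ∀ (i : Fin n) (x y : TL n), B x (uGen i * y) = B (uGen i * x) y
  adjoint_right : ∀ (i : Fin n) (x y : TL n), B x (y * uGen i) = B (x * uGen i) y

/-- `t` as a Laurent series. -/
noncomputable def tt : LaurentSeries ℤ := HahnSeries.single 1 1

/-- The quantum number `[2] = t + t⁻¹`. -/
noncomputable def qTwo : LaurentSeries ℤ := HahnSeries.single 1 1 + HahnSeries.single (-1) 1

/-- `1 / (1 - t²)`, expanded in powers of `t`. -/
noncomputable def geom : LaurentSeries ℤ :=
  HahnSeries.ofPowerSeries ℤ ℤ (PowerSeries.invOfUnit (1 - PowerSeries.X ^ 2) 1)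

theorem geom_mul : (1 - tt ^ 2) * geom = 1 := by
  have h : (1 - tt ^ 2 : LaurentSeries ℤ)
      = HahnSeries.ofPowerSeries ℤ ℤ (1 - PowerSeries.X ^ 2) := by
    simp [tt, HahnSeries.ofPowerSeries_X]
  rw [h, geom, ← map_mul, PowerSeries.mul_invOfUnit _ _ (by simp), map_one]

/-- The pairing `ψ₀`: `(1, 1) = (tⁿ[2]ⁿ - t²) / (1 - t²)` and `(1, u_w) = tⁿ[2]ⁿ⁻ᵈ / (1 - t²)` for
increasing `w` of length `d ≥ 1`. -/
structure IsPsiZero (n : ℕ) (B : TL n →+ TL n →+ TwoSided) : Prop where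
  pairing : IsPairing n B
  one_one : ∀ m : ℤ, B 1 1 m = ((tt ^ n * qTwo ^ n - tt ^ 2) * geom).coeff m
  one_word : ∀ w : Word n, w.Pairwise (· < ·) → w ≠ [] → ∀ m : ℤ,
    B 1 (uWord w) m = (tt ^ n * qTwo ^ (n - w.length) * geom).coeff m

end TLCat

/-! Uniqueness and existence of the pairing both come from one principle on words. A property of
words that is compatible with `ii → i`, `iji → i`, `ij → ji` and with cyclic rotation holds for all
words as soon as it holds for increasing ones (`TLClosed.forall_of_increasing`). Adjointness reduces
a pairing to the values `(1, u_w)`, which have these compatibilities, so the prescribed values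
determine it.

For existence one takes the graded dimensions of `HOM(∅, w)`. In the category `ii ≅ i{1} ⊕ i{-1}`
(this uses that 2 is invertible), `iji ≅ i` for adjacent and `ij ≅ ji` for distant colours. Bending
strands gives rotation invariance and `HOM(v, w) ≅ HOM(∅, v.reverse ++ w)`. So the dimensions define
a pairing (`exists_pairing`), and its values on increasing words remain to be computed.

Generation: for increasing `w`, `HOM(∅, w)` is spanned by polynomial multiples of `phi w`
(`polyMap_surjective`). One eliminates the highest colour `c`. The span `M` of diagrams in which
lines of colour `c` are only started, split or crossed, with a polynomial at the bottom, is closed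
under all pieces of colours at most `c`. End dots are pushed down to a start dot or a splitting, and
the double dots that arise slide to the outer region. A merge is pushed down together with whatever
is enclosed between its two lines, until it meets a dot or the splitting where both lines begin. In
the latter case there is a bubble; by induction on colours its content is a polynomial times a
diagram of colours distant from `c`. The diagram slides out, and the polynomial bubble is evaluated
by the dot-forcing relations.

Upper bound: the relations show that `f_i + 2 f_{i+1} + ⋯ + 2 f_{j-1} + f_j` annihilates `phi [i,
j]` (`yPoly_mem_annIdeal`). For `i ∈ w`, every monomial of degree `r` can therefore be rewritten
through the products of a power of `f_i` with distinct `f_c`, `c ∈ S`, where `S` avoids `w` and has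
at most `r` elements. For the empty word the same works with `i = min S`.

Lower bound: a state sum labels regions by binary sequences `x` and gives `f_i` the value `x_i -
x_{i+1}`. It respects all relations, hence evaluates `p · phi w` at such points (`exists_eval`).
Since the set of non-vanishing `f_i` can be prescribed (`exists_label`), the evaluation matrix of
the reduced monomials is triangular for inclusion. Counting the sets `S` gives partial sums of
binomial coefficients, which are the coefficients of the prescribed series. -/

namespace TLCat

open Diag

/-! ### The category of diagrams -/

namespace Diag

variable {n : ℕ}

/-- Transport of a diagram along equalities of its end points. -/
def cast {s t s' t' : Word n} (hs : s = s') (ht : t = t') (D : Diag s t) : Diag s' t' :=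
  hs ▸ ht ▸ D

@[simp] theorem cast_rfl {s t : Word n} (D : Diag s t) : D.cast rfl rfl = D := rfl

theorem comp_assoc {s t u v : Word n} (D : Diag s t) (E : Diag t u) (F : Diag u v) :
    (D.comp E).comp F = D.comp (E.comp F) := by
  induction D with
  | nil w => rfl
  | cons L D ih => simp [comp, ih]

@[simp] theorem comp_nil {s t : Word n} (D : Diag s t) : D.comp (.nil t) = D := by
  induction D with
  | nil w => rfl
  | cons L D ih => simp [comp, ih]

@[simp] theorem nil_comp {s t : Word n} (D : Diag s t) : (Diag.nil s).comp D = D := rfl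

theorem whisker_comp (l r : Word n) {s t u : Word n} (D : Diag s t) (E : Diag t u) :
    (D.comp E).whisker l r = (D.whisker l r).comp (E.whisker l r) := by
  induction D with
  | nil w => rfl
  | cons L D ih => simp [comp, whisker, ih]

theorem comp_eq_cast_comp {s t t' u : Word n} (h : t = t') (D : Diag s t) (E : Diag t u) :
    D.comp E = (D.cast rfl h).comp (E.cast h rfl) := by
  subst h; rfl

theorem cast_comp {s t u s' u' : Word n} (hs : s = s') (hu : u = u') (D : Diag s t)
    (E : Diag t u) : (D.comp E).cast hs hu = (D.cast hs rfl).comp (E.cast rfl hu) := by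
  subst hs hu; rfl

theorem cast_cast {s t s' t' s'' t'' : Word n} (hs : s = s') (ht : t = t') (hs' : s' = s'')
    (ht' : t' = t'') (D : Diag s t) :
    (D.cast hs ht).cast hs' ht' = D.cast (hs.trans hs') (ht.trans ht') := by
  subst hs ht hs' ht'; rfl

theorem cast_cons {s t u s' t' u' : Word n} (hs : s = s') (ht : t = t') (hu : u = u')
    (L : Layer s t) (D : Diag t u) :
    (Diag.cons L D).cast hs hu =
      .cons ⟨L.left, L.right, L.bot, L.top, L.gen, hs ▸ L.src_eq, ht ▸ L.tgt_eq⟩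
        (D.cast ht hu) := by
  subst hs ht hu; rfl

theorem cast_nil {w w' : Word n} (h h' : w = w') : (Diag.nil w).cast h h' = .nil w' := by
  subst h; rfl

theorem whisker_whisker (l r l' r' : Word n) {s t : Word n} (D : Diag s t)
    (hs : (l ++ l') ++ s ++ (r' ++ r) = l ++ (l' ++ s ++ r') ++ r)
    (ht : (l ++ l') ++ t ++ (r' ++ r) = l ++ (l' ++ t ++ r') ++ r) :
    (D.whisker l' r').whisker l r = (D.whisker (l ++ l') (r' ++ r)).cast hs ht := by
  induction D with
  | nil w => simp only [whisker]; rw [cast_nil]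
  | cons L D ih =>
    rename_i s t u
    have hm : (l ++ l') ++ t ++ (r' ++ r) = l ++ (l' ++ t ++ r') ++ r := by simp
    simp only [whisker]
    rw [cast_cons hs hm ht, ih hm ht]
    congr 1
    simp [Layer.whisker]

theorem insert_comp {s t u a b : Word n} (l r : Word n) (p : Diag s (l ++ a ++ r))
    (q : Diag (l ++ b ++ r) t) (D : Diag a b) (F : Diag t u) :
    (insert l r p q D).comp F = insert l r p (q.comp F) D := by
  simp [insert, comp_assoc]

theorem comp_insert {s t u a b : Word n} (l r : Word n) (p : Diag s (l ++ a ++ r))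
    (q : Diag (l ++ b ++ r) t) (D : Diag a b) (F : Diag u s) :
    F.comp (insert l r p q D) = insert l r (F.comp p) q D := by
  simp [insert, comp_assoc]

theorem whisker_insert {s t a b : Word n} (l' r' l r : Word n) (p : Diag s (l ++ a ++ r))
    (q : Diag (l ++ b ++ r) t) (D : Diag a b) :
    (insert l r p q D).whisker l' r' =
      insert (l' ++ l) (r ++ r') ((p.whisker l' r').cast rfl (by simp))
        ((q.whisker l' r').cast (by simp) rfl) D := by
  have h1 : (l' ++ l) ++ a ++ (r ++ r') = l' ++ (l ++ a ++ r) ++ r' := by simp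
  have h2 : (l' ++ l) ++ b ++ (r ++ r') = l' ++ (l ++ b ++ r) ++ r' := by simp
  simp only [insert, whisker_comp]
  rw [whisker_whisker l' r' l r D h1 h2, comp_eq_cast_comp h1.symm,
    comp_eq_cast_comp (D := (whisker (l' ++ l) (r ++ r') D).cast h1 h2) h2.symm,
    cast_comp, cast_cast, cast_cast, cast_rfl, cast_rfl]

@[simp] theorem degree_comp {s t u : Word n} (D : Diag s t) (E : Diag t u) :
    (D.comp E).degree = D.degree + E.degree := by
  induction D with
  | nil w => simp [comp, degree]
  | cons L D ih => simp [comp, degree, ih, add_assoc]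

@[simp] theorem degree_whisker (l r : Word n) {s t : Word n} (D : Diag s t) :
    (D.whisker l r).degree = D.degree := by
  induction D with
  | nil w => rfl
  | cons L D ih => simp [whisker, degree, ih, Layer.whisker]

@[simp] theorem degree_cast {s t s' t' : Word n} (hs : s = s') (ht : t = t') (D : Diag s t) :
    (D.cast hs ht).degree = D.degree := by
  subst hs ht; rfl

end Diag

/-! ### Composition and whiskering of morphisms. -/

section Hom

variable {k : Type*} [Field k] {n : ℕ}

theorem cls_eq_of_isotopy {s t a b : Word n} (l r : Word n) (p : Diag s (l ++ a ++ r))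
    (q : Diag (l ++ b ++ r) t) {D E : Diag a b} (h : Isotopy a b D E) :
    cls k (Diag.insert l r p q D) = cls k (Diag.insert l r p q E) := by
  rw [cls, cls, ← sub_eq_zero, ← map_sub, Submodule.mkQ_apply, Submodule.Quotient.mk_eq_zero]
  exact Submodule.subset_span (Or.inl ⟨a, b, l, r, p, q, D, E, h, rfl⟩)

theorem mkQ_eq_zero_of_graphRel {s t a b : Word n} (l r : Word n) (p : Diag s (l ++ a ++ r))
    (q : Diag (l ++ b ++ r) t) {y : Diag a b →₀ k} (h : GraphRel k a b y) :
    (relations k s t).mkQ (Finsupp.mapDomain (Diag.insert l r p q) y) = 0 := by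
  rw [Submodule.mkQ_apply, Submodule.Quotient.mk_eq_zero]
  exact Submodule.subset_span (Or.inr ⟨a, b, l, r, p, q, y, h, rfl⟩)

/-- Compositions, whiskering, degree projections and state-sum values all descend to `HOM` through
this criterion: only generating moves in context have to be checked. -/
theorem relations_le_ker {s t : Word n} {M : Type*} [AddCommGroup M] [Module k M]
    (φ : (Diag s t →₀ k) →ₗ[k] M)
    (hi : ∀ (a b l r : Word n) (p : Diag s (l ++ a ++ r)) (q : Diag (l ++ b ++ r) t)
      (D E : Diag a b), Isotopy a b D E →
      φ (pic k (Diag.insert l r p q D)) = φ (pic k (Diag.insert l r p q E)))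
    (hg : ∀ (a b l r : Word n) (p : Diag s (l ++ a ++ r)) (q : Diag (l ++ b ++ r) t)
      (y : Diag a b →₀ k), GraphRel k a b y →
      φ (Finsupp.mapDomain (Diag.insert l r p q) y) = 0) :
    relations k s t ≤ LinearMap.ker φ := by
  refine Submodule.span_le.2 ?_
  rintro x (⟨a, b, l, r, p, q, D, E, h, rfl⟩ | ⟨a, b, l, r, p, q, y, h, rfl⟩)
  · simp [hi a b l r p q D E h]
  · simpa using hg a b l r p q y h

theorem hom_induction {s t : Word n} {P : HOM k s t → Prop} (x : HOM k s t)
    (h0 : P 0) (hadd : ∀ x y, P x → P y → P (x + y)) (hcls : ∀ (c : k) D, P (c • cls k D)) :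
    P x := by
  obtain ⟨y, rfl⟩ := Submodule.mkQ_surjective _ x
  induction y using Finsupp.induction_linear with
  | zero => simpa using h0
  | add f g hf hg => rw [map_add]; exact hadd _ _ hf hg
  | single D c =>
    have : Finsupp.single D c = c • pic k D := by simp [pic]
    rw [this, map_smul]; exact hcls c D

theorem hom_ext {s t : Word n} {M : Type*} [AddCommGroup M] [Module k M]
    {φ φ' : HOM k s t →ₗ[k] M} (h : ∀ D, φ (cls k D) = φ' (cls k D)) : φ = φ' := by
  ext x
  refine hom_induction (P := fun x => φ x = φ' x) (Submodule.Quotient.mk _) (by simp) ?_ ?_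
  · intro x y hx hy; simp [hx, hy]
  · intro c D; simp [h]

theorem span_cls (s t : Word n) : Submodule.span k (Set.range (cls k (s := s) (t := t))) = ⊤ := by
  rw [eq_top_iff]
  intro x _
  refine hom_induction (P := fun x => x ∈ _) x (zero_mem _) (fun _ _ => add_mem) ?_
  intro c D
  exact Submodule.smul_mem _ _ (Submodule.subset_span ⟨D, rfl⟩)

/-- Precomposition with a diagram. -/
noncomputable def preComp {s t : Word n} (D : Diag s t) (u : Word n) :
    HOM k t u →ₗ[k] HOM k s u :=
  (relations k t u).liftQ ((relations k s u).mkQ ∘ₗ Finsupp.lmapDomain k k (Diag.comp D)) (by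
    refine relations_le_ker _ ?_ ?_
    · intro a b l r p q F F' h
      have := cls_eq_of_isotopy (k := k) l r (D.comp p) q h
      simpa [pic, cls, comp_insert] using this
    · intro a b l r p q y h
      have := mkQ_eq_zero_of_graphRel l r (D.comp p) q h
      simp only [LinearMap.comp_apply, Finsupp.lmapDomain_apply, ← Finsupp.mapDomain_comp]
      rw [← this]; congr 2; funext F; simp [comp_insert])

@[simp] theorem preComp_cls {s t u : Word n} (D : Diag s t) (F : Diag t u) :
    preComp D u (cls k F) = cls k (D.comp F) := by
  simp [preComp, cls, pic]

/-- Vertical concatenation of morphisms, bottom morphism first. -/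
noncomputable def hcomp {s t u : Word n} : HOM k s t →ₗ[k] HOM k t u →ₗ[k] HOM k s u :=
  (relations k s t).liftQ (Finsupp.lift _ k _ fun D => preComp D u) (by
    refine relations_le_ker _ ?_ ?_
    · intro a b l r p q D E h
      refine hom_ext fun F => ?_
      have := cls_eq_of_isotopy (k := k) l r p (q.comp F) h
      simpa [pic, insert_comp] using this
    · intro a b l r p q y h
      refine hom_ext fun F => ?_
      have := mkQ_eq_zero_of_graphRel l r p (q.comp F) h
      rw [LinearMap.zero_apply, ← this]
      clear this h
      induction y using Finsupp.induction_linear with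
      | zero => simp
      | add f g hf hg => simp only [Finsupp.mapDomain_add, map_add, LinearMap.add_apply, hf, hg]
      | single D c =>
        simp only [Finsupp.mapDomain_single, Finsupp.lift_apply]
        have : Finsupp.single (Diag.insert l r p (q.comp F) D) c
          = c • pic k (Diag.insert l r p (q.comp F) D) := by simp [pic]
        rw [this, map_smul]
        have h2 := preComp_cls (k := k) (Diag.insert l r p q D) F
        rw [insert_comp] at h2
        simp only [zero_smul, Finsupp.sum_single_index, LinearMap.smul_apply]
        rw [h2, cls])

@[simp] theorem hcomp_cls {s t u : Word n} (D : Diag s t) (F : Diag t u) :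
    hcomp (cls k D) (cls k F) = cls k (D.comp F) := by
  have : hcomp (cls k D) = preComp (k := k) D u := by simp [hcomp, cls, pic]
  rw [this, preComp_cls]

theorem hcomp_assoc {s t u v : Word n} (x : HOM k s t) (y : HOM k t u) (z : HOM k u v) :
    hcomp (hcomp x y) z = hcomp x (hcomp y z) := by
  induction x using hom_induction with
  | h0 => simp
  | hadd x x' hx hx' => simp [hx, hx']
  | hcls c D =>
  induction y using hom_induction with
  | h0 => simp
  | hadd x x' hx hx' => simp_all
  | hcls c' D' =>
  induction z using hom_induction with
  | h0 => simp
  | hadd x x' hx hx' => simp only [map_add, hx, hx']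
  | hcls c'' D'' => simp [Diag.comp_assoc]

@[simp] theorem nil_hcomp {s t : Word n} (x : HOM k s t) : hcomp (cls k (.nil s)) x = x := by
  induction x using hom_induction with
  | h0 => simp
  | hadd x x' hx hx' => simp [hx, hx']
  | hcls c D => simp

/-- Vertical strands on both sides of a morphism. -/
noncomputable def hwhisker (l r : Word n) {s t : Word n} :
    HOM k s t →ₗ[k] HOM k (l ++ s ++ r) (l ++ t ++ r) :=
  (relations k s t).liftQ
    ((relations k _ _).mkQ ∘ₗ Finsupp.lmapDomain k k (Diag.whisker l r)) (by
    refine relations_le_ker _ ?_ ?_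
    · intro a b l' r' p q F F' h
      have := cls_eq_of_isotopy (k := k) (l ++ l') (r' ++ r) ((p.whisker l r).cast rfl (by simp))
        ((q.whisker l r).cast (by simp) rfl) h
      simpa [pic, cls, whisker_insert] using this
    · intro a b l' r' p q y h
      have := mkQ_eq_zero_of_graphRel (l ++ l') (r' ++ r) ((p.whisker l r).cast rfl (by simp))
        ((q.whisker l r).cast (by simp) rfl) h
      simp only [LinearMap.comp_apply, Finsupp.lmapDomain_apply, ← Finsupp.mapDomain_comp]
      rw [← this]; congr 2; funext F; simp [whisker_insert])

@[simp] theorem hwhisker_cls (l r : Word n) {s t : Word n} (D : Diag s t) :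
    hwhisker l r (cls k D) = cls k (D.whisker l r) := by
  simp [hwhisker, cls, pic]

/-! ### Morphisms as operators -/

/-- The product of all morphism spaces. -/
def AllHom (k : Type*) [Field k] (n : ℕ) : Type _ := ∀ u w : Word n, HOM k u w

noncomputable instance : AddCommGroup (AllHom k n) :=
  inferInstanceAs (AddCommGroup (∀ u w : Word n, HOM k u w))

noncomputable instance : Module k (AllHom k n) :=
  inferInstanceAs (Module k (∀ u w : Word n, HOM k u w))

/-- All morphisms act by postcomposition on the product of all morphism spaces, so that the end
points of a morphism can be forgotten. -/
abbrev Alg (k : Type*) [Field k] (n : ℕ) : Type _ := Module.End k (AllHom k n)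

/-- The operator of postcomposition with a morphism. -/
noncomputable def emb {s t : Word n} : HOM k s t →ₗ[k] Alg k n where
  toFun x :=
    { toFun := fun F u => Pi.single t (hcomp (F u s) x)
      map_add' := fun F F' => funext fun u =>
        map_add (LinearMap.single k (fun w => HOM k u w) t ∘ₗ hcomp.flip x)
          ((F : ∀ u w : Word n, HOM k u w) u s) ((F' : ∀ u w : Word n, HOM k u w) u s)
      map_smul' := fun c F => funext fun u =>
        map_smul (LinearMap.single k (fun w => HOM k u w) t ∘ₗ hcomp.flip x) c
          ((F : ∀ u w : Word n, HOM k u w) u s) }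
  map_add' x y := LinearMap.ext fun F => funext fun u =>
    map_add (LinearMap.single k (fun w => HOM k u w) t ∘ₗ
      hcomp ((F : ∀ u w : Word n, HOM k u w) u s)) x y
  map_smul' c x := LinearMap.ext fun F => funext fun u =>
    map_smul (LinearMap.single k (fun w => HOM k u w) t ∘ₗ
      hcomp ((F : ∀ u w : Word n, HOM k u w) u s)) c x

theorem emb_apply {s t : Word n} (x : HOM k s t) (F : AllHom k n) (u : Word n) :
    emb x F u = Pi.single t (hcomp (F u s) x) := rfl

/-- Composition becomes multiplication read from right to left, so the rightmost factor is the
lowest piece. Words survive only as indices of `G`, `T` and `E`, and diagrammatic arguments become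
rewriting in one associative algebra, without casts. -/
theorem emb_mul {s t u : Word n} (x : HOM k s t) (y : HOM k t u) :
    emb y * emb x = emb (hcomp x y) := by
  refine LinearMap.ext fun F => funext fun v => ?_
  rw [Module.End.mul_apply, emb_apply, emb_apply]
  congr 1
  rw [← hcomp_assoc]
  congr 2
  exact Pi.single_eq_same t _

/-- Testing on the family that is the identity of `s` recovers the morphism, so identities of
operators are identities of morphisms. -/
theorem emb_injective {s t : Word n} : Function.Injective (emb (k := k) (s := s) (t := t)) := by
  intro x y h
  let F₀ : AllHom k n := fun u => if hu : u = s then hu ▸ Pi.single s (cls k (.nil s)) else 0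
  have h0 : (F₀ : ∀ u w : Word n, HOM k u w) s s = cls k (.nil s) := by simp [F₀]
  have := congrFun (congrFun (LinearMap.congr_fun h F₀) s) t
  rw [emb_apply, emb_apply, Pi.single_eq_same, Pi.single_eq_same] at this
  erw [h0] at this
  simpa using this

theorem emb_inj {s t : Word n} {x y : HOM k s t} : emb x = emb y ↔ x = y :=
  emb_injective.eq_iff

/-- The operator of a diagram. -/
noncomputable def op (k : Type*) [Field k] {s t : Word n} (D : Diag s t) : Alg k n :=
  emb (cls k D)

/-- The identity of a word. -/
noncomputable def E (k : Type*) [Field k] (w : Word n) : Alg k n := op k (.nil w)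

/-- A single elementary piece with strands on both sides. -/
noncomputable def G (k : Type*) [Field k] (l : Word n) {a b : Word n} (g : Gen n a b)
    (r : Word n) : Alg k n := op k (one l g r)

/-- A diagram with strands on both sides. -/
noncomputable def T (k : Type*) [Field k] (l : Word n) {s t : Word n} (D : Diag s t)
    (r : Word n) : Alg k n := op k (D.whisker l r)

theorem op_comp {s t u : Word n} (D : Diag s t) (F : Diag t u) :
    op k (D.comp F) = op k F * op k D := by
  simp [op, emb_mul]

@[simp] theorem op_cast {s t s' t' : Word n} (hs : s = s') (ht : t = t') (D : Diag s t) :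
    op k (D.cast hs ht) = op k D := by
  subst hs ht; rfl

@[simp] theorem op_nil (w : Word n) : op k (.nil w) = E k w := rfl

theorem op_cons {s t u : Word n} (L : Layer s t) (D : Diag t u) :
    op k (.cons L D) = op k D * G k L.left L.gen L.right := by
  obtain ⟨l, r, a, b, g, rfl, rfl⟩ := L
  exact op_comp (one l g r) D

theorem op_mul_E {s t : Word n} (D : Diag s t) : op k D * E k s = op k D := by
  rw [E, ← op_comp]; rfl

theorem E_mul_op {s t : Word n} (D : Diag s t) : E k t * op k D = op k D := by
  rw [E, ← op_comp, comp_nil]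

theorem G_mul_E {w l a b r : Word n} {g : Gen n a b} (h : w = l ++ a ++ r) :
    G k l g r * E k w = G k l g r := by
  subst h; exact op_mul_E _

theorem E_mul_G {w l a b r : Word n} {g : Gen n a b} (h : w = l ++ b ++ r) :
    E k w * G k l g r = G k l g r := by
  subst h; exact E_mul_op _

theorem E_mul_G_mul {w l a b r : Word n} {g : Gen n a b} (h : w = l ++ b ++ r) (X : Alg k n) :
    E k w * (G k l g r * X) = G k l g r * X := by
  rw [← mul_assoc, E_mul_G h]

theorem T_mul_E {w l a b r : Word n} {D : Diag a b} (h : w = l ++ a ++ r) :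
    T k l D r * E k w = T k l D r := by
  subst h; exact op_mul_E _

theorem E_mul_T {w l a b r : Word n} {D : Diag a b} (h : w = l ++ b ++ r) :
    E k w * T k l D r = T k l D r := by
  subst h; exact E_mul_op _

theorem E_mul_T_mul {w l a b r : Word n} {D : Diag a b} (h : w = l ++ b ++ r) (X : Alg k n) :
    E k w * (T k l D r * X) = T k l D r * X := by
  rw [← mul_assoc, E_mul_T h]

@[simp] theorem E_mul_E (w : Word n) : E k w * E k w = E k w := op_mul_E _

theorem T_nil (l w r : Word n) : T k l (.nil w) r = E k (l ++ w ++ r) := rfl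

theorem T_cons (l r : Word n) {s t u : Word n} (L : Layer s t) (D : Diag t u) :
    T k l (.cons L D) r = T k l D r * G k (l ++ L.left) L.gen (L.right ++ r) :=
  op_cons _ _

theorem T_comp (l r : Word n) {s t u : Word n} (D : Diag s t) (F : Diag t u) :
    T k l (D.comp F) r = T k l F r * T k l D r := by
  rw [T, whisker_comp, op_comp]; rfl

theorem T_one (l r l' r' : Word n) {a b : Word n} (g : Gen n a b) :
    T k l (one l' g r') r = G k (l ++ l') g (r' ++ r) := by
  rw [one, T_cons, T_nil, E_mul_G (by simp)]

theorem T_step (l r l' r' : Word n) {s t a b : Word n} (g : Gen n a b) (hs : s = l' ++ a ++ r')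
    (ht : t = l' ++ b ++ r') :
    T k l (step l' g r' hs ht) r = G k (l ++ l') g (r' ++ r) := by
  rw [step, T_cons, T_nil, E_mul_G (by simp [ht])]

theorem T_whisker (l r l' r' : Word n) {s t : Word n} (D : Diag s t) :
    T k l (D.whisker l' r') r = T k (l ++ l') D (r' ++ r) := by
  rw [T, whisker_whisker _ _ _ _ _ (by simp) (by simp), op_cast]; rfl

@[simp] theorem T_cast (l r : Word n) {s t s' t' : Word n} (hs : s = s') (ht : t = t')
    (D : Diag s t) : T k l (D.cast hs ht) r = T k l D r := by
  subst hs ht; rfl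

theorem op_eq_T {s t : Word n} (D : Diag s t) : op k D = T k [] D [] := by
  induction D with
  | nil w => rw [T_nil]; simp
  | cons L D ih => rw [op_cons, T_cons, ih]; simp

theorem T_emb (l r : Word n) {s t : Word n} (D : Diag s t) :
    T k l D r = emb (hwhisker l r (cls k D)) := by
  simp [T, op]

/-- This turns each constructor of `Isotopy` into a rewriting rule for products of `G`, with
arbitrary strands on both sides; `Tlin_eq_zero` does the same for `GraphRel`. -/
theorem T_eq_of_isotopy (l r : Word n) {a b : Word n} {D F : Diag a b} (h : Isotopy a b D F) :
    T k l D r = T k l F r := by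
  have := cls_eq_of_isotopy (k := k) l r (.nil _) (.nil _) h
  simp only [Diag.insert, comp_nil, nil_comp] at this
  rw [T, T, op, op, this]

/-- Extension of `T` to linear combinations of diagrams. -/
noncomputable def Tlin (k : Type*) [Field k] (l r : Word n) {s t : Word n} :
    (Diag s t →₀ k) →ₗ[k] Alg k n :=
  emb ∘ₗ hwhisker l r ∘ₗ (relations k s t).mkQ

theorem Tlin_pic (l r : Word n) {s t : Word n} (D : Diag s t) :
    Tlin k l r (pic k D) = T k l D r := by
  rw [T_emb]; rfl

theorem Tlin_eq_zero (l r : Word n) {a b : Word n} {y : Diag a b →₀ k} (h : GraphRel k a b y) :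
    Tlin k l r y = 0 := by
  have := mkQ_eq_zero_of_graphRel l r (.nil _) (.nil _) h
  have hw : Diag.insert l r (.nil (l ++ a ++ r)) (.nil (l ++ b ++ r)) = Diag.whisker l r := by
    funext D; simp [Diag.insert]
  rw [hw] at this
  have h2 : hwhisker l r ((relations k a b).mkQ y) = 0 := by
    rw [← this]; simp [hwhisker]
  simp only [Tlin, LinearMap.comp_apply, h2, map_zero]

end Hom

end TLCat

/-! ### Derived local relations. -/

namespace TLCat

open Diag

section Calculus

variable {k : Type*} [Field k] {n : ℕ}

/-! ### Interchange -/

/-- All words are associated to the right, the normal form under `List.append_assoc`, so that the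
rule can be matched inside longer products. -/
theorem G_comm (l m r : Word n) {a b c d : Word n} (g : Gen n a b) (h : Gen n c d) :
    G k (l ++ (b ++ m)) h r * G k l g (m ++ (c ++ r)) =
      G k l g (m ++ (d ++ r)) * G k (l ++ (a ++ m)) h r := by
  have := T_eq_of_isotopy (k := k) l r (Isotopy.interchange g h m)
  simpa only [T_comp, T_step, List.append_assoc, List.nil_append, List.append_nil] using this

theorem G_comm_T (l m r : Word n) {a b c d : Word n} (g : Gen n a b) (D : Diag c d) :
    T k (l ++ (b ++ m)) D r * G k l g (m ++ (c ++ r)) =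
      G k l g (m ++ (d ++ r)) * T k (l ++ (a ++ m)) D r := by
  induction D with
  | nil w =>
    rw [T_nil, T_nil, E_mul_G (by simp), G_mul_E (by simp)]
  | cons L D ih =>
    obtain ⟨l', r', x, y, h, rfl, rfl⟩ := L
    rw [T_cons, T_cons, mul_assoc, ← mul_assoc (G k l g _), ← ih]
    have := G_comm (k := k) l (m ++ l') (r' ++ r) g h
    simp only [List.append_assoc] at this ⊢
    rw [this, mul_assoc]

/-- Diagrams side by side may exchange their heights. -/
theorem T_comm (l m r : Word n) {a b c d : Word n} (D : Diag a b) (D' : Diag c d) :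
    T k (l ++ (b ++ m)) D' r * T k l D (m ++ (c ++ r)) =
      T k l D (m ++ (d ++ r)) * T k (l ++ (a ++ m)) D' r := by
  induction D with
  | nil w =>
    rw [T_nil, T_nil, E_mul_T (by simp), T_mul_E (by simp)]
  | cons L D ih =>
    obtain ⟨l', r', x, y, h, rfl, rfl⟩ := L
    rw [T_cons, T_cons, ← mul_assoc, ih, mul_assoc, mul_assoc]
    have := G_comm_T (k := k) (l ++ l') (r' ++ m) r h D'
    simp only [List.append_assoc] at this ⊢
    rw [this]

theorem T_comm_G (l m r : Word n) {a b c d : Word n} (D : Diag a b) (h : Gen n c d) :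
    G k (l ++ (b ++ m)) h r * T k l D (m ++ (c ++ r)) =
      T k l D (m ++ (d ++ r)) * G k (l ++ (a ++ m)) h r := by
  have := T_comm (k := k) l m r D (one [] h [])
  simpa [T_one] using this

/-! ### One colour -/

variable (l r : Word n) (i j : Fin n)

theorem zigzag_left : G k l (.cap i) (i :: r) * G k (l ++ [i]) (.cup i) r = E k (l ++ i :: r) := by
  have := T_eq_of_isotopy (k := k) l r (Isotopy.zigzag_left i)
  simpa [T_comp, T_one, T_nil] using this

theorem zigzag_right : G k (l ++ [i]) (.cap i) r * G k l (.cup i) (i :: r) = E k (l ++ i :: r) := by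
  have := T_eq_of_isotopy (k := k) l r (Isotopy.zigzag_right i)
  simpa [T_comp, T_one, T_nil] using this

theorem cap_dot_left : G k l (.cap i) r * G k l (.startDot i) (i :: r) = G k l (.endDot i) r := by
  have := T_eq_of_isotopy (k := k) l r (Isotopy.dot_left i)
  simpa [T_comp, T_one, T_nil] using this

theorem cap_dot_right : G k l (.cap i) r * G k (l ++ [i]) (.startDot i) r
    = G k l (.endDot i) r := by
  have := T_eq_of_isotopy (k := k) l r (Isotopy.dot_right i)
  simpa [T_comp, T_one, T_nil] using this

theorem merge_cup_left : G k (l ++ [i]) (.merge i) r * G k l (.cup i) (i :: r)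
    = G k l (.split i) r := by
  have := T_eq_of_isotopy (k := k) l r (Isotopy.trivalent_left i)
  simpa [T_comp, T_one, T_nil] using this

theorem merge_cup_right : G k l (.merge i) (i :: r) * G k (l ++ [i]) (.cup i) r
    = G k l (.split i) r := by
  have := T_eq_of_isotopy (k := k) l r (Isotopy.trivalent_right i)
  simpa [T_comp, T_one, T_nil] using this

/-- `I = H`. -/
theorem split_merge : G k l (.split i) r * G k l (.merge i) r
    = G k (l ++ [i]) (.merge i) r * G k l (.split i) (i :: r) := by
  have := Tlin_eq_zero l r (GraphRel.assoc (k := k) i)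
  rw [map_sub, Tlin_pic, Tlin_pic, sub_eq_zero] at this
  simpa [T_comp, T_one, T_nil] using this

theorem merge_dot_left : G k l (.merge i) r * G k l (.startDot i) (i :: r) = E k (l ++ i :: r) := by
  have := Tlin_eq_zero l r (GraphRel.unit (k := k) i)
  rw [map_sub, Tlin_pic, Tlin_pic, sub_eq_zero] at this
  simpa [T_comp, T_one, T_nil] using this

theorem cap_split : G k l (.cap i) r * G k l (.split i) r = 0 := by
  have := Tlin_eq_zero l r (GraphRel.needle (k := k) i)
  rw [Tlin_pic] at this
  simpa [T_comp, T_one, T_nil] using this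

/-- The splitting is a merge with one leg bent by a cup. The start dot moves past the cup and
cancels the merge. -/
theorem split_dot : G k l (.split i) r * G k l (.startDot i) r = G k l (.cup i) r := by
  have e := G_comm (k := k) l [] r (.startDot i) (.cup i)
  simp only [List.append_nil, List.nil_append, List.cons_append] at e
  rw [← merge_cup_right, mul_assoc, e, ← mul_assoc, merge_dot_left, E_mul_G (by simp)]

theorem endDot_cup_left : G k l (.endDot i) (i :: r) * G k l (.cup i) r
    = G k l (.startDot i) r := by
  have e := G_comm (k := k) l [] r (.startDot i) (.cup i)
  simp only [List.append_nil, List.nil_append, List.cons_append] at e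
  rw [← cap_dot_left, mul_assoc, ← e, ← mul_assoc, zigzag_left, E_mul_G (by simp)]

theorem endDot_cup_right : G k (l ++ [i]) (.endDot i) r * G k l (.cup i) r
    = G k l (.startDot i) r := by
  have e := G_comm (k := k) l [] r (.cup i) (.startDot i)
  simp only [List.append_nil, List.nil_append, List.cons_append] at e
  have e' := zigzag_right (k := k) l r i
  rw [← cap_dot_right, mul_assoc, List.append_assoc, List.cons_append, List.nil_append, e,
    ← mul_assoc, zigzag_right, E_mul_G (by simp)]

theorem cap_split_right : G k l (.cap i) (i :: r) * G k (l ++ [i]) (.split i) r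
    = G k l (.merge i) r := by
  have e := G_comm (k := k) l [] r (.cap i) (.merge i)
  simp only [List.append_nil, List.nil_append, List.cons_append] at e
  rw [← merge_cup_left, List.append_assoc, List.cons_append, List.nil_append, ← mul_assoc,
    ← e, mul_assoc, zigzag_left, G_mul_E (by simp)]

theorem cap_split_left : G k (l ++ [i]) (.cap i) r * G k l (.split i) (i :: r)
    = G k l (.merge i) r := by
  have e := G_comm (k := k) l [] r (.merge i) (.cap i)
  simp only [List.append_nil, List.nil_append, List.cons_append] at e
  have e' := zigzag_right (k := k) (l ++ [i]) r i
  simp only [List.append_assoc, List.nil_append, List.cons_append] at e'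
  rw [← merge_cup_right, ← mul_assoc, e, mul_assoc, e', G_mul_E (by simp)]

theorem merge_dot_right : G k l (.merge i) r * G k (l ++ [i]) (.startDot i) r
    = E k (l ++ i :: r) := by
  rw [← cap_split_right, mul_assoc, split_dot, zigzag_left]

theorem endDot_split_left : G k l (.endDot i) (i :: r) * G k l (.split i) r = E k (l ++ i :: r) := by
  have e := G_comm (k := k) l [] r (.endDot i) (.merge i)
  simp only [List.append_nil, List.nil_append, List.cons_append] at e
  rw [← merge_cup_left, ← mul_assoc, ← e, mul_assoc, endDot_cup_left, merge_dot_left]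

theorem endDot_split_right : G k (l ++ [i]) (.endDot i) r * G k l (.split i) r
    = E k (l ++ i :: r) := by
  have e := G_comm (k := k) l [] r (.merge i) (.endDot i)
  simp only [List.append_nil, List.nil_append, List.cons_append] at e
  have e' := endDot_cup_right (k := k) (l ++ [i]) r i
  simp only [List.append_assoc, List.nil_append, List.cons_append] at e'
  rw [← merge_cup_right, ← mul_assoc, e, mul_assoc, e', merge_dot_right]

theorem endDot_merge : G k l (.endDot i) r * G k l (.merge i) r = G k l (.cap i) r := by
  have e := G_comm (k := k) l [] r (.cap i) (.endDot i)
  simp only [List.append_nil, List.nil_append, List.cons_append] at e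
  have e' := endDot_split_right (k := k) (l ++ [i]) r i
  simp only [List.append_assoc, List.nil_append, List.cons_append] at e'
  rw [← cap_split_right, ← mul_assoc, e, mul_assoc, e', G_mul_E (by simp)]

/-- Writing the lower splitting as a merge on a cup puts a splitting directly on a merge, where `I =
H` applies; the cup then turns the new merge back into a splitting. -/
theorem split_split : G k l (.split i) (i :: r) * G k l (.split i) r
    = G k (l ++ [i]) (.split i) r * G k l (.split i) r := by
  have e := G_comm (k := k) l [] r (.split i) (.cup i)
  simp only [List.append_nil, List.nil_append, List.cons_append] at e
  have e' := merge_cup_right (k := k) (l ++ [i]) r i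
  simp only [List.append_assoc, List.nil_append, List.cons_append] at e'
  conv_lhs => rw [← merge_cup_right (k := k) l r, ← mul_assoc, split_merge, mul_assoc, ← e,
    ← mul_assoc, e']

/-- An empty bubble is zero: after bending a leg and applying coassociativity it contains a capped
splitting, that is, a needle. -/
theorem merge_split : G k l (.merge i) r * G k l (.split i) r = 0 := by
  rw [← cap_split_left, mul_assoc, split_split, ← mul_assoc, cap_split, zero_mul]

theorem split_merge' : G k l (.split i) r * G k l (.merge i) r
    = G k l (.merge i) (i :: r) * G k (l ++ [i]) (.split i) r := by
  have e := G_comm (k := k) l [] r (.merge i) (.merge i)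
  simp only [List.append_nil, List.nil_append, List.cons_append] at e
  have e' := merge_cup_left (k := k) (l ++ [i]) r i
  simp only [List.append_assoc, List.nil_append, List.cons_append] at e'
  rw [split_merge, ← merge_cup_right (k := k) l (i :: r), ← e', ← mul_assoc, ← mul_assoc, e]

/-! ### Crossings of distant colours -/

variable {i j}

theorem Distant.symm (h : Distant i j) : Distant j i := Or.symm h

variable (h : Distant i j) (h' : Distant j i)

theorem cross_rotate :
    G k (l ++ [i, j]) (.cap i) r * (G k (l ++ [i]) (.cross i j h) (i :: r) *
      G k l (.cup i) (j :: i :: r)) = G k l (.cross j i h') r := by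
  have := T_eq_of_isotopy (k := k) l r (Isotopy.cross_rotate i j h h')
  simpa [T_comp, T_one, T_nil, mul_assoc] using this

theorem cross_cross : G k l (.cross j i h') r * G k l (.cross i j h) r = E k (l ++ i :: j :: r) := by
  have := T_eq_of_isotopy (k := k) l r (Isotopy.cross_cross i j h h')
  simpa [T_comp, T_one, T_nil] using this

theorem cross_dot_left : G k l (.cross i j h) r * G k l (.startDot i) (j :: r)
    = G k (l ++ [j]) (.startDot i) r := by
  have := T_eq_of_isotopy (k := k) l r (Isotopy.cross_dot i j h)
  simpa [T_comp, T_one, T_nil] using this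

theorem cross_merge_left : G k l (.cross i j h) r * G k l (.merge i) (j :: r) =
    G k (l ++ [j]) (.merge i) r * (G k l (.cross i j h) (i :: r) *
      G k (l ++ [i]) (.cross i j h) r) := by
  have := T_eq_of_isotopy (k := k) l r (Isotopy.cross_trivalent i j h)
  simpa [T_comp, T_one, T_nil, mul_assoc] using this

theorem cross_cross_cross {c : Fin n} (hic : Distant i c) (hjc : Distant j c) :
    G k l (.cross j c hjc) (i :: r) * (G k (l ++ [j]) (.cross i c hic) r *
      G k l (.cross i j h) (c :: r)) =
    G k (l ++ [c]) (.cross i j h) r * (G k l (.cross i c hic) (j :: r) *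
      G k (l ++ [i]) (.cross j c hjc) r) := by
  have := T_eq_of_isotopy (k := k) l r (Isotopy.cross_cross_cross i j c h hic hjc)
  simpa [T_comp, T_one, T_nil, mul_assoc] using this

theorem cross_dot_right : G k l (.cross i j h) r * G k (l ++ [i]) (.startDot j) r
    = G k l (.startDot j) (i :: r) := by
  rw [← cross_dot_left (k := k) l r h.symm, ← mul_assoc, cross_cross, E_mul_G (by simp)]

/-- One crossing is written as the rotation of the other; the cup of that rotation meets the cap in
a zigzag. This is how caps pass through lines of distant colours. -/
theorem cap_cross_right : G k l (.cap i) (j :: r) * G k (l ++ [i]) (.cross j i h') r =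
    G k (l ++ [j]) (.cap i) r * G k l (.cross i j h) (i :: r) := by
  have e1 := G_comm (k := k) l [j] r (.cap i) (.cap i)
  have e2 := G_comm (k := k) l [] (i :: r) (.cap i) (.cross i j h)
  have e3 := cross_rotate (k := k) (l ++ [i]) r h h'
  simp only [List.append_nil, List.nil_append, List.cons_append, List.append_assoc] at e1 e2 e3
  rw [← e3, ← mul_assoc, ← e1, mul_assoc, ← mul_assoc (G k l (.cap i) _), ← e2, mul_assoc,
    zigzag_left, G_mul_E (by simp)]

theorem cross_cup_right : G k l (.cross j i h') (i :: r) * G k (l ++ [j]) (.cup i) r =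
    G k (l ++ [i]) (.cross i j h) r * G k l (.cup i) (j :: r) := by
  have e1 := G_comm (k := k) l [j] r (.cup i) (.cup i)
  have e2 := G_comm (k := k) (l ++ [i]) [] r (.cross i j h) (.cup i)
  have e3 := zigzag_left (k := k) (l ++ [i, j]) r i
  simp only [List.append_nil, List.nil_append, List.cons_append, List.append_assoc] at e1 e2 e3
  rw [← cross_rotate (k := k) l (i :: r) h h', mul_assoc, mul_assoc, ← e1,
    ← mul_assoc (G k (l ++ [i]) (.cross i j h) _), ← e2, ← mul_assoc, ← mul_assoc, e3,
    E_mul_G (by simp)]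

theorem cap_through : G k l (.cap j) (i :: r) * (G k (l ++ [j]) (.cross i j h) r *
    G k l (.cross i j h) (j :: r)) = G k (l ++ [i]) (.cap j) r := by
  rw [← mul_assoc, cap_cross_right l r h.symm h, mul_assoc, cross_cross, G_mul_E (by simp)]

theorem cup_through : G k l (.cross i j h) (i :: r) * (G k (l ++ [i]) (.cross i j h) r *
    G k l (.cup i) (j :: r)) = G k (l ++ [j]) (.cup i) r := by
  rw [← cross_cup_right l r h h.symm, ← mul_assoc, cross_cross, E_mul_G (by simp)]

theorem cup_through' : G k (l ++ [j]) (.cross i j h) r * (G k l (.cross i j h) (j :: r) *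
    G k (l ++ [i]) (.cup j) r) = G k l (.cup j) (i :: r) := by
  rw [cross_cup_right l r h.symm h, ← mul_assoc, cross_cross, E_mul_G (by simp)]

theorem endDot_cross_right : G k (l ++ [j]) (.endDot i) r * G k l (.cross i j h) r
    = G k l (.endDot i) (j :: r) := by
  have e1 := G_comm (k := k) l [] r (.cross i j h) (.startDot i)
  have e2 := cap_dot_right (k := k) (l ++ [j]) r i
  have e3 := cross_dot_right (k := k) (l ++ [i]) r h.symm
  simp only [List.append_nil, List.nil_append, List.cons_append, List.append_assoc] at e1 e2 e3
  rw [← e2, mul_assoc, e1, ← mul_assoc, ← cap_cross_right l r h h.symm, mul_assoc, e3,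
    cap_dot_right]

theorem endDot_cross_left : G k l (.endDot j) (i :: r) * G k l (.cross i j h) r
    = G k (l ++ [i]) (.endDot j) r := by
  rw [← endDot_cross_right (k := k) l r h.symm, mul_assoc, cross_cross, G_mul_E (by simp)]

/-- Only one side of the move is among the isotopies. The other side follows by composing with
crossings above and below, since they are invertible. -/
theorem cross_merge_right : G k l (.cross i j h) r * G k (l ++ [i]) (.merge j) r =
    G k l (.merge j) (i :: r) * (G k (l ++ [j]) (.cross i j h) r *
      G k l (.cross i j h) (j :: r)) := by
  have e1 := cross_merge_left (k := k) l r h.symm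
  have e2 := cross_cross (k := k) (l ++ [j]) r h h.symm
  have e3 := cross_cross (k := k) l r h.symm h
  simp only [List.nil_append, List.cons_append, List.append_assoc] at e2
  have e4 : G k l (.cross i j h) r * (G k l (.cross j i h.symm) r * G k l (.merge j) (i :: r)) *
      (G k (l ++ [j]) (.cross i j h) r * G k l (.cross i j h) (j :: r)) =
      G k l (.cross i j h) r * (G k (l ++ [i]) (.merge j) r) := by
    rw [e1]
    simp only [mul_assoc]
    rw [← mul_assoc (G k (l ++ [j]) (.cross j i _) _), e2, E_mul_G (by simp), cross_cross,
      G_mul_E (by simp)]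
  rw [← e4, ← mul_assoc (G k l (.cross i j h) r), e3, E_mul_G (by simp)]

theorem cross_split_left : G k l (.cross i j h) (i :: r) * (G k (l ++ [i]) (.cross i j h) r *
    G k l (.split i) (j :: r)) = G k (l ++ [j]) (.split i) r * G k l (.cross i j h) r := by
  have e1 := merge_cup_left (k := k) (l ++ [j]) r i
  have e2 := cup_through (k := k) l (i :: r) h
  have e3 := G_comm (k := k) l [] r (.cup i) (.cross i j h)
  have e4 := cross_merge_left (k := k) (l ++ [i]) r h
  have e5 := G_comm (k := k) l [] r (.cross i j h) (.merge i)
  simp only [List.append_nil, List.nil_append, List.cons_append, List.append_assoc] at e1 e3 e4 e5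
  rw [← e1, ← e2]
  simp only [mul_assoc]
  rw [← e3, ← mul_assoc (G k (l ++ [j, i]) _ _), e5, mul_assoc,
    ← mul_assoc (G k (l ++ [i]) (.cross i j h) _), ← mul_assoc (G k (l ++ [i, j]) _ _), ← e4,
    mul_assoc, merge_cup_left]

theorem cross_split_right : G k (l ++ [j]) (.cross i j h) r * (G k l (.cross i j h) (j :: r) *
    G k (l ++ [i]) (.split j) r) = G k l (.split j) (i :: r) * G k l (.cross i j h) r := by
  have e1 := cross_split_left (k := k) l r h.symm
  have e2 : G k (l ++ [j]) (.cross i j h) r * (G k l (.cross i j h) (j :: r) *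
    (G k (l ++ [i]) (.split j) r * G k l (.cross j i h.symm) r)) = G k l (.split j) (i :: r) := by
    have e3 := cross_cross (k := k) (l ++ [j]) r h.symm h
    simp only [List.nil_append, List.cons_append, List.append_assoc] at e3
    rw [← e1, ← mul_assoc (G k l (.cross i j h) _), cross_cross, E_mul_G_mul (by simp),
      ← mul_assoc, e3, E_mul_G (by simp)]
  rw [← e2]; simp only [mul_assoc]
  rw [cross_cross, G_mul_E (by simp)]

/-! ### Relations between lines and double dots -/

/-- The double dot of colour `i` in the region between `l` and `r`. -/
noncomputable def F (k : Type*) [Field k] (l : Word n) (i : Fin n) (r : Word n) : Alg k n :=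
  G k l (.endDot i) r * G k l (.startDot i) r

/-- The broken line of colour `i`. -/
noncomputable def Br (k : Type*) [Field k] (l : Word n) (i : Fin n) (r : Word n) : Alg k n :=
  G k l (.startDot i) r * G k l (.endDot i) r

theorem F_same (i : Fin n) : F k l i (i :: r) + F k (l ++ [i]) i r = (2 : k) • Br k l i r := by
  have := Tlin_eq_zero l r (GraphRel.dot_same (k := k) i)
  rw [map_sub, map_add, map_smul, Tlin_pic, Tlin_pic, Tlin_pic, sub_eq_zero] at this
  simpa [T_comp, T_one, T_nil, dotLeft, dotRight, brokenLine, F, Br] using this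

theorem F_near {i j : Fin n} (h : Adjacent i j) : F k l j (i :: r) =
    F k (l ++ [i]) j r + F k (l ++ [i]) i r - Br k l i r := by
  have := Tlin_eq_zero l r (GraphRel.dot_near (k := k) i j h)
  rw [map_sub, map_sub, map_add, Tlin_pic, Tlin_pic, Tlin_pic, Tlin_pic, sub_eq_zero] at this
  simpa [T_comp, T_one, T_nil, dotLeft, dotRight, brokenLine, F, Br] using this

theorem F_far (h : Distant i j) : F k l j (i :: r) = F k (l ++ [i]) j r := by
  rw [F, F, ← cross_dot_right l r h, ← mul_assoc, endDot_cross_left]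

theorem switch {i j : Fin n} (h : Adjacent i j) :
    G k (l ++ [i, j]) (.startDot i) r * G k l (.startDot i) (j :: r) =
      - (G k (l ++ [i]) (.startDot j) (i :: r) * (G k l (.cup i) r * G k l (.endDot j) r)) := by
  have := Tlin_eq_zero l r (GraphRel.switch (k := k) i j h)
  rw [map_add, Tlin_pic, Tlin_pic] at this
  rw [eq_neg_iff_add_eq_zero]
  simpa [T_comp, T_one, T_nil, mul_assoc] using this

end Calculus

end TLCat

namespace TLCat

open Diag

section Polynomials

variable {k : Type*} [Field k] {n : ℕ}

/-! ### Polynomials in double dots -/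

/-- Identities proved for whole diagrams may be used in every region of a larger one. -/
theorem T_congr (l r : Word n) {s t : Word n} {D D' : Diag s t} (h : op k D = op k D') :
    T k l D r = T k l D' r := by
  have : cls k D = cls k D' := emb_injective h
  rw [T_emb, T_emb, this]

theorem T_doubleDot (l r : Word n) (i : Fin n) : T k l (doubleDot i) r = F k l i r := by
  simp [doubleDot, T_comp, T_one, F]

theorem op_doubleDot (i : Fin n) : op k (doubleDot i) = F k [] i [] := by
  rw [op_eq_T, T_doubleDot]

theorem F_comm_G (l m r : Word n) (i : Fin n) {a b : Word n} (g : Gen n a b) :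
    G k (l ++ m) g r * F k l i (m ++ (a ++ r)) = F k l i (m ++ (b ++ r)) * G k (l ++ m) g r := by
  have := T_comm_G (k := k) l m r (doubleDot i) g
  simpa only [List.nil_append, T_doubleDot] using this

theorem G_comm_F (l m r : Word n) (i : Fin n) {a b : Word n} (g : Gen n a b) :
    F k (l ++ (b ++ m)) i r * G k l g (m ++ r) = G k l g (m ++ r) * F k (l ++ (a ++ m)) i r := by
  have := G_comm_T (k := k) l m r g (doubleDot i)
  simpa only [List.nil_append, T_doubleDot] using this

theorem op_iterate_doubleDot (i : Fin n) (m : ℕ) (D : Diag ([] : Word n) []) :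
    op k ((fun X => (doubleDot i).comp X)^[m] D) = op k D * F k [] i [] ^ m := by
  induction m with
  | zero => simp
  | succ m ih =>
    rw [Function.iterate_succ_apply', op_comp, ih, op_doubleDot, pow_succ, mul_assoc]

/-- The part of `doubleDots e` with colours in a list. -/
def dotsOn (L : List (Fin n)) (e : Fin n →₀ ℕ) : Diag ([] : Word n) [] :=
  L.foldr (fun i D => (fun X => (doubleDot i).comp X)^[e i] D) (.nil [])

theorem op_dotsOn_cons (i : Fin n) (L : List (Fin n)) (e : Fin n →₀ ℕ) :
    op k (dotsOn (i :: L) e) = op k (dotsOn L e) * F k [] i [] ^ e i :=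
  op_iterate_doubleDot i (e i) (dotsOn L e)

theorem op_dotsOn_comm (L : List (Fin n)) (e : Fin n →₀ ℕ) (j : Fin n) :
    op k (dotsOn L e) * F k [] j [] = F k [] j [] * op k (dotsOn L e) := by
  have := T_comm (k := k) [] [] [] (dotsOn L e) (doubleDot j)
  simpa [T_doubleDot, ← op_eq_T] using this.symm

theorem dotsOn_congr (L : List (Fin n)) (e e' : Fin n →₀ ℕ) (h : ∀ i ∈ L, e i = e' i) :
    dotsOn L e = dotsOn L e' := by
  induction L with
  | nil => rfl
  | cons i L ih =>
    have h1 := ih fun x hx => h x (List.mem_cons_of_mem _ hx)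
    have h2 := h i (by simp)
    simp only [dotsOn, List.foldr_cons] at h1 ⊢
    rw [h1, h2]

/-- Closed diagrams commute by interchange, so the order in which `dotsOn` stacks the colours is
immaterial and exponents add as in a polynomial ring. -/
theorem op_dotsOn_add (L : List (Fin n)) (hL : L.Nodup) (e : Fin n →₀ ℕ) (j : Fin n)
    (hj : j ∈ L) :
    op k (dotsOn L (e + Finsupp.single j 1)) = F k [] j [] * op k (dotsOn L e) := by
  induction L with
  | nil => simp at hj
  | cons i L ih =>
    rw [op_dotsOn_cons, op_dotsOn_cons]
    by_cases hij : i = j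
    · subst hij
      have hi : i ∉ L := (List.nodup_cons.1 hL).1
      rw [dotsOn_congr L (e + Finsupp.single i 1) e fun x hx => by
          have : i ≠ x := fun h => hi (h ▸ hx)
          simp [this.symm],
        Finsupp.add_apply, Finsupp.single_eq_same, pow_succ', ← mul_assoc, op_dotsOn_comm,
        mul_assoc]
    · have hj' : j ∈ L := by simpa [Ne.symm hij] using hj
      rw [ih (List.nodup_cons.1 hL).2 hj']
      simp [hij, mul_assoc]

theorem op_doubleDots_add (e : Fin n →₀ ℕ) (j : Fin n) :
    op k (doubleDots (e + Finsupp.single j 1)) = F k [] j [] * op k (doubleDots e) :=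
  op_dotsOn_add _ (List.nodup_finRange n) e j (List.mem_finRange j)

theorem op_doubleDots_comm (e : Fin n →₀ ℕ) (j : Fin n) :
    op k (doubleDots e) * F k [] j [] = F k [] j [] * op k (doubleDots e) :=
  op_dotsOn_comm _ e j

theorem op_doubleDots_zero : op k (doubleDots (0 : Fin n →₀ ℕ)) = E k [] := by
  have : ∀ L : List (Fin n), dotsOn L 0 = .nil [] := by
    intro L
    induction L with
    | nil => rfl
    | cons i L ih => simp only [dotsOn, List.foldr_cons] at ih ⊢; simp
  have h := this (List.finRange n)
  rw [doubleDots]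
  rw [dotsOn] at h
  rw [h, op_nil]

theorem T_doubleDots_add (l r : Word n) (e : Fin n →₀ ℕ) (j : Fin n) :
    T k l (doubleDots (e + Finsupp.single j 1)) r = F k l j r * T k l (doubleDots e) r := by
  have : op k (doubleDots (e + Finsupp.single j 1))
      = op k ((doubleDots e).comp (doubleDot j)) := by
    rw [op_doubleDots_add, op_comp, op_doubleDot]
  rw [T_congr l r this, T_comp, T_doubleDot]

theorem T_doubleDots_zero (l r : Word n) : T k l (doubleDots (0 : Fin n →₀ ℕ)) r = E k (l ++ r) := by
  have : op k (doubleDots (0 : Fin n →₀ ℕ)) = op k (Diag.nil []) := op_doubleDots_zero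
  rw [T_congr l r this, T_nil]; simp

/-- The entries of the Cartan matrix. -/
def cartan (k : Type*) [Field k] (i j : Fin n) : k :=
  if i = j then 2 else if i.val + 1 = j.val ∨ j.val + 1 = i.val then -1 else 0

/-- Sliding a double dot through a line. -/
theorem F_slide (l r : Word n) (i j : Fin n) :
    F k (l ++ [i]) j r = F k l j (i :: r) - cartan k i j • (F k l i (i :: r) - Br k l i r) := by
  have same := F_same (k := k) l r i
  have same' : F k (l ++ [i]) i r = (2 : k) • Br k l i r - F k l i (i :: r) :=
    eq_sub_of_add_eq' same
  -- In all three cases a double dot `f_j` crossing an `i`-line becomes `f_j - a_{ij} f_i`, its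
  -- image under the simple reflection, up to a multiple of the broken line.
  unfold cartan
  split_ifs with h1 h2
  · subst h1
    rw [same', smul_sub, two_smul, two_smul]; abel
  · rw [F_near l r (show Adjacent i j from h2), same', two_smul, neg_smul, one_smul]; abel
  · have : Distant i j := by
      have : i.val ≠ j.val := fun h => h1 (Fin.ext h)
      unfold Distant; omega
    rw [F_far l r this]; simp

end Polynomials

end TLCat

/-! ### Eliminating the highest colour: end dots and bubbles. -/

namespace TLCat

open Diag

section Creation

variable {k : Type*} [Field k] {n : ℕ}

/-! ### Diagrams with bounded colours -/

/-- All colours are less than `m`. -/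
def Gen.Below (m : ℕ) {a b : Word n} : Gen n a b → Prop
  | .startDot i => i.val < m
  | .endDot i => i.val < m
  | .merge i => i.val < m
  | .split i => i.val < m
  | .cup i => i.val < m
  | .cap i => i.val < m
  | .cross i j _ => i.val < m ∧ j.val < m

/-- All pieces have colours less than `m`. -/
def Diag.Below (m : ℕ) {s t : Word n} : Diag s t → Prop
  | .nil _ => True
  | .cons L D => L.gen.Below m ∧ Diag.Below m D

theorem Diag.Below.comp {m : ℕ} {s t u : Word n} {D : Diag s t} {D' : Diag t u} (h : D.Below m)
    (h' : D'.Below m) : (D.comp D').Below m := by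
  induction D with
  | nil w => exact h'
  | cons L D ih => exact ⟨h.1, ih h.2 h'⟩

theorem Diag.Below.whisker {m : ℕ} {s t : Word n} {D : Diag s t} (h : D.Below m) (l r : Word n) :
    (D.whisker l r).Below m := by
  induction D with
  | nil w => trivial
  | cons L D ih => exact ⟨h.1, ih h.2⟩

theorem Diag.Below.cast {m : ℕ} {s t s' t' : Word n} {D : Diag s t} (h : D.Below m) (hs : s = s')
    (ht : t = t') : (D.cast hs ht).Below m := by
  subst hs ht; exact h

theorem Gen.Below.lt_of_mem_top {m : ℕ} {a b : Word n} {g : Gen n a b} (h : g.Below m) :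
    ∀ i ∈ b, i.val < m := by
  cases g <;> simp_all [Gen.Below]

theorem Gen.Below.lt_of_mem_bot {m : ℕ} {a b : Word n} {g : Gen n a b} (h : g.Below m) :
    ∀ i ∈ a, i.val < m := by
  cases g <;> simp_all [Gen.Below]

/-- This locates a letter `c` of the top word relative to the last piece, whose output is `b`: to
its right, to its left, or inside its output. The inductions on creation diagrams branch on these
cases. -/
theorem append_append_eq_append_cons {α : Type*} {l' b r' l r : List α} {c : α}
    (h : l' ++ (b ++ r') = l ++ c :: r) :
    (∃ u, l = l' ++ (b ++ u) ∧ r' = u ++ c :: r) ∨ (∃ u, l' = l ++ c :: u ∧ r = u ++ (b ++ r')) ∨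
      (∃ b₁ b₂, b = b₁ ++ c :: b₂ ∧ l = l' ++ b₁ ∧ r = b₂ ++ r') := by
  rcases List.append_eq_append_iff.1 h with ⟨u, h1, h2⟩ | ⟨u, h1, h2⟩
  · rcases List.append_eq_append_iff.1 h2 with ⟨v, h3, h4⟩ | ⟨v, h3, h4⟩
    · exact Or.inl ⟨v, by simp [h1, h3], h4⟩
    · cases v with
      | nil => exact Or.inl ⟨[], by simp [h1, h3], by simpa using h4.symm⟩
      | cons x v =>
        simp only [List.cons_append, List.cons.injEq] at h4
        obtain ⟨rfl, h5⟩ := h4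
        exact Or.inr (Or.inr ⟨u, v, h3, h1, h5⟩)
  · cases u with
    | nil =>
      simp only [List.nil_append] at h2
      cases b with
      | nil => exact Or.inl ⟨[], by simp [h1], by simpa using h2.symm⟩
      | cons x b =>
        simp only [List.cons_append, List.cons.injEq] at h2
        obtain ⟨rfl, h2⟩ := h2
        exact Or.inr (Or.inr ⟨[], b, rfl, by simp [h1], h2⟩)
    | cons x u =>
      simp only [List.cons_append, List.cons.injEq] at h2
      obtain ⟨rfl, h2⟩ := h2
      exact Or.inr (Or.inl ⟨u, h1, h2⟩)

/-! ### Diagrams that only create lines of the highest colour -/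

/-- Pieces of colours at most `c` such that the pieces of colour `c` are start dots, splittings and
crossings. -/
def Gen.Creates (c : Fin n) {a b : Word n} : Gen n a b → Prop
  | .startDot i => i ≤ c
  | .endDot i => i < c
  | .merge i => i < c
  | .split i => i ≤ c
  | .cup i => i < c
  | .cap i => i < c
  | .cross i j _ => i ≤ c ∧ j ≤ c

theorem Gen.Below.creates {c : Fin n} {a b : Word n} {g : Gen n a b} (h : g.Below c.val) :
    g.Creates c := by
  cases g <;> simp only [Gen.Below, Gen.Creates, Fin.lt_def, Fin.le_def] at h ⊢ <;> omega

/-- A creating piece that involves `c` also has `c` in its output. -/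
theorem Gen.Creates.below {c : Fin n} {a b : Word n} {g : Gen n a b} (h : g.Creates c)
    (hb : c ∉ b) : g.Below c.val := by
  cases g <;>
    simp only [Gen.Below, Gen.Creates, Fin.lt_def, Fin.le_def, Fin.ext_iff, List.mem_cons,
      List.not_mem_nil, or_false] at h hb ⊢ <;> omega

theorem Gen.Creates.le_of_mem_top {c : Fin n} {a b : Word n} {g : Gen n a b} (h : g.Creates c) :
    ∀ i ∈ b, i ≤ c := by
  cases g <;> simp_all [Gen.Creates, le_of_lt]

/-- Operators of diagrams with empty bottom boundary which create lines of colour `c` only. -/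
inductive Cre (k : Type*) [Field k] (c : Fin n) : Word n → Alg k n → Prop
  | base (e : Fin n →₀ ℕ) : Cre k c [] (op k (doubleDots e))
  | step {X : Alg k n} (l r : Word n) {a b : Word n} (g : Gen n a b) (hg : g.Creates c)
      (hX : Cre k c (l ++ (a ++ r)) X) : Cre k c (l ++ (b ++ r)) (G k l g r * X)

/-- The span of `Cre`. -/
noncomputable def M (k : Type*) [Field k] (c : Fin n) (w : Word n) : Submodule k (Alg k n) :=
  Submodule.span k {X | Cre k c w X}

variable {c : Fin n}

theorem Cre.mem {w : Word n} {X : Alg k n} (h : Cre k c w X) : X ∈ M k c w :=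
  Submodule.subset_span h

theorem Cre.E_mul {w : Word n} {X : Alg k n} (h : Cre k c w X) : E k w * X = X := by
  cases h with
  | base e => exact E_mul_op _
  | step l r g hg hX => rw [← mul_assoc, E_mul_G (by simp)]

theorem Cre.le {w : Word n} {X : Alg k n} (h : Cre k c w X) : ∀ i ∈ w, i ≤ c := by
  induction h with
  | base e => simp
  | step l r g hg hX ih =>
    intro i hi
    simp only [List.mem_append] at hi ih
    rcases hi with hi | hi | hi
    · exact ih i (Or.inl hi)
    · exact hg.le_of_mem_top i hi
    · exact ih i (Or.inr (Or.inr hi))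

/-- To map `M` into `M` by an operator it suffices to look at `Cre`. -/
theorem M_induction {w w' : Word n} {Y : Alg k n} (h : ∀ X, Cre k c w X → Y * X ∈ M k c w')
    {X : Alg k n} (hX : X ∈ M k c w) : Y * X ∈ M k c w' := by
  induction hX using Submodule.span_induction with
  | mem x hx => exact h x hx
  | zero => simp
  | add x y _ _ hx hy => rw [mul_add]; exact add_mem hx hy
  | smul a x _ hx => rw [mul_smul_comm]; exact Submodule.smul_mem _ _ hx

theorem E_mul_mem {w : Word n} {X : Alg k n} (hX : X ∈ M k c w) : E k w * X = X := by
  induction hX using Submodule.span_induction with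
  | mem x hx => exact hx.E_mul
  | zero => simp
  | add x y _ _ hx hy => rw [mul_add, hx, hy]
  | smul a x _ hx => rw [mul_smul_comm, hx]

theorem M_step {w w' l r a b : Word n} {g : Gen n a b} (hg : g.Creates c) {X : Alg k n}
    (hX : X ∈ M k c w) (hw : w = l ++ (a ++ r)) (hw' : w' = l ++ (b ++ r)) :
    G k l g r * X ∈ M k c w' := by
  subst hw hw'
  exact M_induction (fun X hX => (Cre.step l r g hg hX).mem) hX

theorem M_T {w w' l r a b : Word n} {D : Diag a b} (hD : D.Below c.val) {X : Alg k n}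
    (hX : X ∈ M k c w) (hw : w = l ++ (a ++ r)) (hw' : w' = l ++ (b ++ r)) :
    T k l D r * X ∈ M k c w' := by
  induction D generalizing w X with
  | nil v => 
    subst hw hw'
    rw [T_nil, List.append_assoc, E_mul_mem hX]; exact hX
  | cons L D ih =>
    obtain ⟨l', r', x, y, g, rfl, rfl⟩ := L
    rw [T_cons, mul_assoc]
    exact ih hD.2 (M_step hD.1.creates hX (by simp [hw]) rfl) (by simp) hw'

theorem Cre.F_comm {w : Word n} {X : Alg k n} (h : Cre k c w X) (j : Fin n) :
    F k [] j w * X = X * F k [] j [] := by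
  induction h with
  | base e => exact (op_doubleDots_comm e j).symm
  | step l r g hg hX ih =>
    have := F_comm_G (k := k) [] l r j g
    simp only [List.nil_append] at this
    rw [← mul_assoc, ← this, mul_assoc, ih, mul_assoc]

theorem Cre.mul_F {w : Word n} {X : Alg k n} (h : Cre k c w X) (j : Fin n) :
    Cre k c w (X * F k [] j []) := by
  induction h with
  | base e =>
    rw [op_doubleDots_comm, ← op_doubleDots_add]
    exact .base _
  | step l r g hg hX ih =>
    rw [mul_assoc]
    exact .step l r g hg ih

/-- Double dots may be placed into all regions, once lines of colour `c` may be ended. -/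
theorem Cre.F_mul_mem {w : Word n} {X : Alg k n} (h : Cre k c w X)
    (hE : ∀ l r, w = l ++ c :: r → G k l (.endDot c) r * X ∈ M k c (l ++ r)) :
    ∀ (l r : Word n) (j : Fin n), w = l ++ r → F k l j r * X ∈ M k c w := by
  intro l
  -- The double dot slides left, one strand at a time, to the outer region, from where it joins the
  -- polynomial at the bottom. Each slide may cost a broken line, that is, an end dot followed by a
  -- start dot; for colour `c` this is what `hE` provides.
  induction l using List.reverseRecOn with
  | nil =>
    intro r j hw
    simp only [List.nil_append] at hw
    subst hw
    rw [h.F_comm]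
    exact (h.mul_F j).mem
  | append_singleton l i ih =>
    intro r j hw
    rw [List.append_assoc, List.singleton_append] at hw
    rw [F_slide, sub_mul, smul_mul_assoc, sub_mul]
    refine sub_mem (ih _ j hw) (Submodule.smul_mem _ _ (sub_mem (ih _ i hw) ?_))
    rw [Br, mul_assoc]
    have hi : i ≤ c := h.le i (by simp [hw])
    refine M_step (g := .startDot i) hi (w := l ++ r) ?_ (by simp) (by simp [hw])
    rcases hi.lt_or_eq with hi | rfl
    · exact M_step (g := .endDot i) hi h.mem (by simp [hw]) (by simp)
    · exact hE l r hw

/-- Lines of colour `c` may be ended. -/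
theorem Cre.endDot_mem {w : Word n} {X : Alg k n} (h : Cre k c w X) :
    ∀ l r, w = l ++ c :: r → G k l (.endDot c) r * X ∈ M k c (l ++ r) := by
  induction h with
  | base e => intro l r h; simp at h
  | step l' r' g hg hX ih =>
    rename_i X a b
    intro l r hw
    rcases append_append_eq_append_cons hw with ⟨u, rfl, rfl⟩ | ⟨u, rfl, rfl⟩ | ⟨b₁, b₂, rfl, rfl, rfl⟩
    · have e := G_comm (k := k) l' u r g (.endDot c)
      simp only [List.singleton_append, List.nil_append] at e
      rw [← mul_assoc, e, mul_assoc]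
      exact M_step hg (ih (l' ++ (a ++ u)) r (by simp)) (by simp) (by simp)
    · have e := G_comm (k := k) l u r' (.endDot c) g
      simp only [List.singleton_append, List.nil_append] at e
      rw [← mul_assoc, ← e, mul_assoc]
      exact M_step hg (ih l (u ++ (a ++ r')) (by simp)) (by simp) (by simp)
    · generalize hb : b₁ ++ c :: b₂ = b at g hX
      cases g with
      | startDot i =>
        obtain ⟨rfl, rfl, rfl⟩ : b₁ = [] ∧ c = i ∧ b₂ = [] := by
          rcases b₁ with _ | ⟨x, b₁⟩ <;> simp_all
        -- An end dot on a fresh start dot is a double dot in a region of the shorter diagram.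
        -- Placing it there needs end dots on that shorter diagram only, which is the induction
        -- hypothesis.
        have := hX.F_mul_mem ih l' r' c (by simp)
        simpa [F, mul_assoc] using this
      | endDot i => simp at hb
      | merge i =>
        have : c = i := by rcases b₁ with _ | ⟨x, b₁⟩ <;> simp_all
        exact absurd hg (by simp [Gen.Creates, this])
      | split i =>
        have : (b₁ = [] ∧ c = i ∧ b₂ = [i]) ∨ (b₁ = [i] ∧ c = i ∧ b₂ = []) := by
          rcases b₁ with _ | ⟨x, _ | ⟨y, b₁⟩⟩ <;> simp_all
        rcases this with ⟨rfl, rfl, rfl⟩ | ⟨rfl, rfl, rfl⟩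
        · simp only [List.append_nil, List.singleton_append]
          have := hX.E_mul
          simp only [List.singleton_append] at this
          rw [← mul_assoc, endDot_split_left, this]
          simpa using hX.mem
        · simp only [List.nil_append]
          rw [← mul_assoc, endDot_split_right]
          have := hX.E_mul
          simp only [List.singleton_append] at this
          rw [this]
          simpa using hX.mem
      | cup i =>
        have : c = i := by rcases b₁ with _ | ⟨x, _ | ⟨y, b₁⟩⟩ <;> simp_all
        exact absurd hg (by simp [Gen.Creates, this])
      | cap i => simp at hb
      | cross i j hij =>
        have : (b₁ = [] ∧ c = j ∧ b₂ = [i]) ∨ (b₁ = [j] ∧ c = i ∧ b₂ = []) := by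
          rcases b₁ with _ | ⟨x, _ | ⟨y, b₁⟩⟩ <;> simp_all
        rcases this with ⟨rfl, rfl, rfl⟩ | ⟨rfl, rfl, rfl⟩
        · simp only [List.append_nil, List.singleton_append]
          rw [← mul_assoc, endDot_cross_left]
          simpa using ih (l' ++ [i]) r' (by simp)
        · simp only [List.nil_append]
          rw [← mul_assoc, endDot_cross_right]
          simpa using ih l' (j :: r') (by simp)

theorem M_endDot {w w' l r : Word n} {X : Alg k n} (hX : X ∈ M k c w) (hw : w = l ++ c :: r)
    (hw' : w' = l ++ r) : G k l (.endDot c) r * X ∈ M k c w' := by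
  subst hw'
  exact M_induction (fun X hX => hX.endDot_mem l r hw) hX

theorem M_F {w l r : Word n} {X : Alg k n} (hX : X ∈ M k c w) (j : Fin n) (hw : w = l ++ r) :
    F k l j r * X ∈ M k c w :=
  M_induction (fun _ hX => hX.F_mul_mem hX.endDot_mem l r j hw) hX

theorem exponent_induction {P : (Fin n →₀ ℕ) → Prop} (e : Fin n →₀ ℕ) (zero : P 0)
    (succ : ∀ e j, P e → P (e + Finsupp.single j 1)) : P e := by
  suffices h : ∀ f, P f → P (f + e) by simpa using h 0 zero
  induction e using Finsupp.induction_linear with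
  | zero => simp
  | add f g hf hg => intro f' h; rw [← add_assoc]; exact hg _ (hf _ h)
  | single j m =>
    intro f hf
    induction m with
    | zero => simpa using hf
    | succ m ih => rw [Finsupp.single_add, ← add_assoc]; exact succ _ _ ih

theorem M_doubleDots {w l r : Word n} {X : Alg k n} (hX : X ∈ M k c w) (e : Fin n →₀ ℕ)
    (hw : w = l ++ r) : T k l (doubleDots e) r * X ∈ M k c w := by
  induction e using exponent_induction with
  | zero => rw [T_doubleDots_zero, ← hw, E_mul_mem hX]; exact hX
  | succ e j ih => rw [T_doubleDots_add, mul_assoc]; exact M_F ih j hw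

/-- A bubble of colour `c` with a polynomial inside. -/
theorem M_bubble {w l r : Word n} {X : Alg k n} (hX : X ∈ M k c w) (e : Fin n →₀ ℕ)
    (hw : w = l ++ c :: r) :
    G k l (.merge c) r * (T k (l ++ [c]) (doubleDots e) (c :: r) * (G k l (.split c) r * X))
      ∈ M k c w := by
  induction e using exponent_induction with
  | zero =>
    rw [T_doubleDots_zero, List.append_assoc, List.singleton_append, E_mul_G_mul (by simp),
      ← mul_assoc, merge_split, zero_mul]
    exact zero_mem _
  | succ e j ih =>
    have e1 : ∀ j, G k l (.merge c) r * F k l j (c :: c :: r)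
        = F k l j (c :: r) * G k l (.merge c) r := fun j => by
      simpa using F_comm_G (k := k) l [] r j (.merge c)
    have e2 := G_comm_T (k := k) l [] (c :: r) (.endDot c) (doubleDots e)
    simp only [List.append_nil, List.nil_append] at e2
    have e3 := M_doubleDots hX e hw
    -- Sliding `f_j` out through the left wall leaves this broken-line term. It opens the bubble:
    -- its dots cancel the merge and the splitting, and the polynomial remains beside an intact
    -- line.
    have e4 : G k l (.merge c) r * (Br k l c (c :: r) *
        (T k (l ++ [c]) (doubleDots e) (c :: r) * (G k l (.split c) r * X)))
        = T k l (doubleDots e) (c :: r) * X := by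
      rw [Br, mul_assoc (G k l (.startDot c) _), ← mul_assoc (G k l (.merge c) _), merge_dot_left,
        ← mul_assoc (G k l (.endDot c) _), ← e2, mul_assoc, ← mul_assoc (G k l (.endDot c) _),
        endDot_split_left, ← hw, E_mul_mem hX, E_mul_mem e3]
    rw [T_doubleDots_add, F_slide, mul_assoc, sub_mul, smul_mul_assoc, sub_mul, mul_sub,
      mul_smul_comm, mul_sub, e4, ← mul_assoc, ← mul_assoc (G k l (.merge c) r), e1, e1,
      mul_assoc, mul_assoc]
    exact sub_mem (M_F ih j hw) (Submodule.smul_mem _ _ (sub_mem (M_F ih c hw) e3))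

end Creation

end TLCat

namespace TLCat

open Diag

section Through

variable {k : Type*} [Field k] {n : ℕ} {c : Fin n}

/-! ### Moving a line through lines of distant colours -/

/-- All letters are distant from `c`. -/
def Far (c : Fin n) (y : Word n) : Prop := ∀ j ∈ y, Distant c j

theorem Far.append {y y' : Word n} (h : Far c y) (h' : Far c y') : Far c (y ++ y') := by
  intro j hj
  rcases List.mem_append.1 hj with hj | hj
  exacts [h j hj, h' j hj]

theorem Far.left {y y' : Word n} (h : Far c (y ++ y')) : Far c y :=
  fun j hj => h j (List.mem_append_left _ hj)

theorem Far.right {y y' : Word n} (h : Far c (y ++ y')) : Far c y' :=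
  fun j hj => h j (List.mem_append_right _ hj)

theorem Far.head {j : Fin n} {y : Word n} (h : Far c (j :: y)) : Distant c j := h j (by simp)

theorem Far.tail {j : Fin n} {y : Word n} (h : Far c (j :: y)) : Far c y :=
  fun i hi => h i (List.mem_cons_of_mem _ hi)

/-- A line of colour `c` crossing the lines `y` from left to right. -/
def overRight (c : Fin n) : (y : Word n) → Far c y → Diag (c :: y) (y ++ [c])
  | [], _ => .nil [c]
  | j :: y, h => .cons ⟨[], y, [c, j], [j, c], .cross c j h.head, rfl, rfl⟩
      (((overRight c y h.tail).whisker [j] []).cast (by simp) (by simp))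

/-- A line of colour `c` crossing the lines `y` from right to left. -/
def overLeft (c : Fin n) : (y : Word n) → Far c y → Diag (y ++ [c]) (c :: y)
  | [], _ => .nil [c]
  | j :: y, h => (((overLeft c y h.tail).whisker [j] []).cast (t' := [j] ++ c :: y)
      (by simp) (by simp)).comp (step [] (.cross j c h.head.symm) y rfl rfl)

theorem T_overRight_nil (l r : Word n) (h : Far c []) :
    T k l (overRight c [] h) r = E k (l ++ c :: r) := by
  simp [overRight, T_nil]

theorem T_overRight_cons (l r : Word n) {j : Fin n} {y : Word n} (h : Far c (j :: y)) :
    T k l (overRight c (j :: y) h) r =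
      T k (l ++ [j]) (overRight c y h.tail) r * G k l (.cross c j h.head) (y ++ r) := by
  simp [overRight, T_cons, T_whisker]

theorem T_overLeft_nil (l r : Word n) (h : Far c []) :
    T k l (overLeft c [] h) r = E k (l ++ c :: r) := by
  simp [overLeft, T_nil]

theorem T_overLeft_cons (l r : Word n) {j : Fin n} {y : Word n} (h : Far c (j :: y)) :
    T k l (overLeft c (j :: y) h) r =
      G k l (.cross j c h.head.symm) (y ++ r) * T k (l ++ [j]) (overLeft c y h.tail) r := by
  simp [overLeft, T_comp, T_whisker, T_step]

theorem T_overRight_append (l r : Word n) {y y' : Word n} (h : Far c (y ++ y')) :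
    T k l (overRight c (y ++ y') h) r =
      T k (l ++ y) (overRight c y' h.right) r * T k l (overRight c y h.left) (y' ++ r) := by
  induction y generalizing l with
  | nil =>
    rw [T_overRight_nil, T_mul_E (by simp)]; simp
  | cons j y ih =>
    have e := T_overRight_cons (k := k) (y := y ++ y') l r h
    rw [ih] at e
    refine Eq.trans e ?_
    rw [T_overRight_cons]
    simp [mul_assoc]

theorem overLeft_overRight (l r : Word n) {y : Word n} (h : Far c y) :
    T k l (overLeft c y h) r * T k l (overRight c y h) r = E k (l ++ c :: (y ++ r)) := by
  induction y generalizing l with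
  | nil => rw [T_overRight_nil, T_overLeft_nil]; simp
  | cons j y ih =>
    rw [T_overRight_cons, T_overLeft_cons, mul_assoc, ← mul_assoc (T k _ _ _), ih,
      E_mul_G (by simp), cross_cross]; simp

theorem overRight_dot (l r : Word n) {y : Word n} (h : Far c y) :
    T k l (overRight c y h) r * G k l (.startDot c) (y ++ r) = G k (l ++ y) (.startDot c) r := by
  induction y generalizing l with
  | nil => rw [T_overRight_nil, E_mul_G (by simp)]; simp
  | cons j y ih =>
    rw [T_overRight_cons, mul_assoc, List.cons_append, cross_dot_left, ih]; simp

theorem overRight_split (l r : Word n) {y : Word n} (h : Far c y) :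
    T k l (overRight c y h) (c :: r) * (T k (l ++ [c]) (overRight c y h) r *
      G k l (.split c) (y ++ r)) = G k (l ++ y) (.split c) r * T k l (overRight c y h) r := by
  induction y generalizing l with
  | nil =>
    simp only [T_overRight_nil, List.append_nil, List.nil_append]
    rw [E_mul_G (w := l ++ [c] ++ c :: r) (by simp), E_mul_G (by simp), G_mul_E (by simp)]
  | cons j y ih =>
    have e1 := G_comm_T (k := k) l [] r (.cross c j h.head) (overRight c y h.tail)
    have e2 := ih (l ++ [j]) h.tail
    have e3 := cross_split_left (k := k) l (y ++ r) h.head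
    simp only [List.cons_append, List.nil_append, List.append_assoc] at e1 e2 e3
    simp only [T_overRight_cons, List.cons_append, List.append_assoc, List.nil_append, mul_assoc]
    rw [← mul_assoc (G k l (.cross c j h.head) (y ++ c :: r)), ← e1, mul_assoc, e3, ← mul_assoc,
      ← mul_assoc, mul_assoc (T k _ _ _), e2, mul_assoc]

theorem T_overRight_one (l r : Word n) {i : Fin n} (h : Far c [i]) :
    T k l (overRight c [i] h) r = G k l (.cross c i h.head) r := by
  rw [T_overRight_cons, T_overRight_nil, E_mul_G (by simp)]; simp

theorem T_overRight_two (l r : Word n) {i j : Fin n} (h : Far c [i, j]) :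
    T k l (overRight c [i, j] h) r =
      G k (l ++ [i]) (.cross c j h.tail.head) r * G k l (.cross c i h.head) (j :: r) := by
  rw [T_overRight_cons, T_overRight_one]; simp

/-- A piece of colours distant from `c` moves through a line of colour `c`. -/
theorem overRight_gen (l r : Word n) {a b : Word n} (g : Gen n a b) (ha : Far c a)
    (hb : Far c b) :
    T k l (overRight c b hb) r * G k (l ++ [c]) g r =
      G k l g (c :: r) * T k l (overRight c a ha) r := by
  cases g with
  | startDot i =>
    rw [T_overRight_one, T_overRight_nil, G_mul_E (by simp), cross_dot_right]
  | endDot i =>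
    rw [T_overRight_one, T_overRight_nil, E_mul_G (by simp), endDot_cross_left]
  | merge i =>
    rw [T_overRight_one, T_overRight_two, cross_merge_right]
  | split i =>
    rw [T_overRight_one, T_overRight_two, ← cross_split_right, mul_assoc]
  | cup i =>
    rw [T_overRight_nil, T_overRight_two, G_mul_E (by simp), mul_assoc, cup_through']
  | cap i =>
    rw [T_overRight_nil, T_overRight_two, E_mul_G (by simp), cap_through]
  | cross i j hij =>
    rw [T_overRight_two, T_overRight_two, mul_assoc, cross_cross_cross]

/-- A diagram of colours distant from `c` moves through a line of colour `c`. -/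
theorem overRight_T {m : ℕ} (hm : m + 1 ≤ c.val) (l r : Word n) {a b : Word n} (D : Diag a b)
    (hD : D.Below m) (ha : Far c a) (hb : Far c b) :
    T k l (overRight c b hb) r * T k (l ++ [c]) D r =
      T k l D (c :: r) * T k l (overRight c a ha) r := by
  induction D with
  | nil w => rw [T_nil, T_nil, T_mul_E (by simp), E_mul_T (by simp)]
  | cons L D ih =>
    obtain ⟨l', r', x, y, g, rfl, rfl⟩ := L
    have hy : Far c y := fun j hj => by
      have := hD.1.lt_of_mem_top j hj
      unfold Distant; omega
    have hl : Far c l' := ha.left.left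
    have hx : Far c x := ha.left.right
    have hr : Far c r' := ha.right
    rw [T_cons, T_cons, ← mul_assoc, ih hD.2 ((hl.append hy).append hr) hb, mul_assoc, mul_assoc]
    congr 1
    simp only [T_overRight_append]
    have e1 := T_comm_G (k := k) l [] (r' ++ r) (overRight c l' hl) g
    have e2 := overRight_gen (k := k) (l ++ l') (r' ++ r) g hx hy
    have e3 := G_comm_T (k := k) (l ++ l') [] r g (overRight c r' hr)
    simp only [List.append_assoc, List.nil_append, List.append_nil, List.cons_append]
      at e1 e2 e3 ⊢
    rw [mul_assoc, mul_assoc, ← e1, ← mul_assoc (T k (l ++ l') _ _), e2, ← mul_assoc, ← mul_assoc,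
      e3]
    simp only [mul_assoc]

end Through

end TLCat

namespace TLCat

open Diag

section MergeOver

variable {k : Type*} [Field k] {n : ℕ} {c : Fin n}

/-! ### Merging two lines over a diagram -/

/-- Two lines of colour `c` merge, and the diagram `z` between them leaves to the left. -/
def mergeOver {x y : Word n} (z : Diag x y) (h : Far c y) : Diag (c :: (x ++ [c])) (y ++ [c]) :=
  ((z.whisker [c] [c]).cast (t' := c :: y ++ [c]) (by simp) (by simp)).comp
    (((overRight c y h).whisker [] [c]).comp (step y (.merge c) [] (by simp) (by simp)))

/-- An additional strand on the left. -/
def consStrand (j : Fin n) {x y : Word n} (z : Diag x y) : Diag (j :: x) (j :: y) :=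
  (z.whisker [j] []).cast (by simp) (by simp)

/-- An additional strand on the right. -/
def snocStrand (j : Fin n) {x y : Word n} (z : Diag x y) : Diag (x ++ [j]) (y ++ [j]) :=
  (z.whisker [] [j]).cast (by simp) (by simp)

/-- Bending the first strand of the source to the target. -/
def bendLeft {j : Fin n} {x y : Word n} (z : Diag (j :: x) y) : Diag x (j :: y) :=
  (step (t := j :: j :: x) [] (.cup j) x rfl rfl).comp (consStrand j z)

/-- Bending the last strand of the source to the target. -/
def bendRight {j : Fin n} {x y : Word n} (z : Diag (x ++ [j]) y) : Diag x (y ++ [j]) :=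
  (step (t := x ++ [j] ++ [j]) x (.cup j) [] (by simp) (by simp)).comp (snocStrand j z)

variable (l r : Word n) {x y : Word n} {j : Fin n}

theorem T_mergeOver (z : Diag x y) (h : Far c y) :
    T k l (mergeOver z h) r = G k (l ++ y) (.merge c) r *
      (T k l (overRight c y h) (c :: r) * T k (l ++ [c]) z (c :: r)) := by
  simp [mergeOver, T_comp, T_whisker, T_step, mul_assoc]

theorem T_consStrand (z : Diag x y) : T k l (consStrand j z) r = T k (l ++ [j]) z r := by
  simp [consStrand, T_whisker]

theorem T_snocStrand (z : Diag x y) : T k l (snocStrand j z) r = T k l z (j :: r) := by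
  simp [snocStrand, T_whisker]

theorem T_bendLeft (z : Diag (j :: x) y) :
    T k l (bendLeft z) r = T k (l ++ [j]) z r * G k l (.cup j) (x ++ r) := by
  simp [bendLeft, T_comp, T_step, T_consStrand]

theorem T_bendRight (z : Diag (x ++ [j]) y) :
    T k l (bendRight z) r = T k l z (j :: r) * G k (l ++ x) (.cup j) r := by
  simp [bendRight, T_comp, T_step, T_snocStrand]

/-- This and the following lemmas push `mergeOver` below the piece that produced one of its two
lines. A dotted line cancels the merge; splittings and crossings leave a `mergeOver` with a shorter
diagram beneath it. -/
theorem mergeOver_dot_first (z : Diag x y) (h : Far c y) :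
    T k l (mergeOver z h) r * G k l (.startDot c) (x ++ c :: r) = T k l z (c :: r) := by
  have e1 := G_comm_T (k := k) l [] (c :: r) (.startDot c) z
  simp only [List.nil_append, List.append_nil] at e1
  rw [T_mergeOver, mul_assoc, mul_assoc, e1, ← mul_assoc (T k l _ _), overRight_dot, ← mul_assoc,
    merge_dot_left, E_mul_T (by simp)]

theorem mergeOver_dot_second (z : Diag x y) (h : Far c y) :
    T k l (mergeOver z h) r * G k (l ++ c :: x) (.startDot c) r =
      T k l (overRight c y h) r * T k (l ++ [c]) z r := by
  have e1 := T_comm_G (k := k) (l ++ [c]) [] r z (.startDot c)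
  have e2 := T_comm_G (k := k) l [] r (overRight c y h) (.startDot c)
  have e3 := merge_dot_right (k := k) (l ++ y) r c
  simp only [List.append_assoc, List.nil_append, List.append_nil, List.cons_append] at e1 e2 e3
  rw [T_mergeOver, mul_assoc, mul_assoc, ← e1, ← mul_assoc (T k l _ _), ← e2, mul_assoc,
    ← mul_assoc, e3, E_mul_T_mul (by simp)]

/-- By `I = H` the splitting may come after the merge, to the right of the lines `y`. Its left leg
then has to be carried back over `y`, hence the `overLeft`. -/
theorem mergeOver_split_left (z : Diag x y) (h : Far c y) :
    T k (l ++ [c]) (mergeOver z h) r * G k l (.split c) (x ++ c :: r) =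
      T k l (overLeft c y h) (c :: r) * (G k (l ++ y) (.split c) r * T k l (mergeOver z h) r) := by
  have e1 := G_comm_T (k := k) l [] (c :: r) (.split c) z
  have e2 := T_comm_G (k := k) l [] r (overLeft c y h) (.merge c)
  have e3 := overRight_split (k := k) l (c :: r) h
  have e4 := split_merge (k := k) (l ++ y) r c
  have e5 : T k (l ++ [c]) (overRight c y h) (c :: r) * G k l (.split c) (y ++ c :: r) =
      T k l (overLeft c y h) (c :: c :: r) *
        (G k (l ++ y) (.split c) (c :: r) * T k l (overRight c y h) (c :: r)) := by
    rw [← e3, ← mul_assoc, overLeft_overRight, E_mul_T_mul (by simp)]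
  simp only [List.append_assoc, List.nil_append, List.append_nil, List.cons_append] at e1 e2 e4
  rw [T_mergeOver, T_mergeOver]
  simp only [List.append_assoc, List.cons_append, List.nil_append, mul_assoc]
  rw [e1, ← mul_assoc (T k (l ++ [c]) _ _), e5, ← mul_assoc, ← mul_assoc, e2,
    ← mul_assoc (G k (l ++ y) (.split c) r), e4]
  simp only [mul_assoc]

theorem mergeOver_split_right (z : Diag x y) (h : Far c y) :
    T k l (mergeOver z h) (c :: r) * G k (l ++ c :: x) (.split c) r =
      G k (l ++ y) (.split c) r * T k l (mergeOver z h) r := by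
  have e1 := T_comm_G (k := k) (l ++ [c]) [] r z (.split c)
  have e2 := T_comm_G (k := k) l [] r (overRight c y h) (.split c)
  have e3 := split_merge' (k := k) (l ++ y) r c
  simp only [List.append_assoc, List.nil_append, List.append_nil, List.cons_append] at e1 e2 e3
  rw [T_mergeOver, T_mergeOver, mul_assoc, mul_assoc, ← e1, ← mul_assoc (T k l _ _), ← e2,
    mul_assoc, ← mul_assoc, ← e3, mul_assoc]

theorem mergeOver_cross_first (z : Diag x y) (h : Far c y) (hj : Far c (j :: y)) :
    T k (l ++ [j]) (mergeOver z h) r * G k l (.cross c j hj.head) (x ++ c :: r) =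
      T k l (mergeOver (consStrand j z) hj) r := by
  have e1 := G_comm_T (k := k) l [] (c :: r) (.cross c j hj.head) z
  simp only [List.nil_append, List.append_nil] at e1
  rw [T_mergeOver, T_mergeOver, T_consStrand, T_overRight_cons]
  simp only [List.append_assoc, List.cons_append, List.nil_append, mul_assoc]
  rw [e1]

/-- The strand `j` reaches the enclosed diagram from outside. Bending it makes it an output of the
enclosed diagram instead, to be joined by a cap with the outer part of the strand. -/
theorem mergeOver_cross_first' (z : Diag (j :: x) y) (h : Far c y) (hj : Far c (j :: y)) :
    T k l (mergeOver z h) r * G k l (.cross j c hj.head.symm) (x ++ c :: r) =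
      G k l (.cap j) (y ++ c :: r) * T k (l ++ [j]) (mergeOver (bendLeft z) hj) r := by
  have e1 := G_comm (k := k) l y r (.cap j) (.merge c)
  have e2 := G_comm_T (k := k) l [] (c :: r) (.cap j) (overRight c y h)
  have e4 := G_comm_T (k := k) l [c] (c :: r) (.cap j) z
  have e5 := G_comm_T (k := k) (l ++ [j]) [] (c :: r) (.cross c j hj.head) z
  have e6 := cap_cross_right (k := k) l (j :: (x ++ c :: r)) hj.head.symm hj.head
  have e7 := G_comm (k := k) l [] (x ++ c :: r) (.cross j c hj.head.symm) (.cup j)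
  have e8 := zigzag_left (k := k) (l ++ [c]) (x ++ c :: r) j
  simp only [List.append_assoc, List.nil_append, List.append_nil, List.cons_append]
    at e1 e2 e4 e5 e6 e7 e8
  rw [T_mergeOver, T_mergeOver, T_bendLeft, T_overRight_cons]
  simp only [List.append_assoc, List.cons_append, List.nil_append, mul_assoc]
  rw [← mul_assoc (G k l (.cap j) _), ← e1, mul_assoc, ← mul_assoc (G k l (.cap j) _), ← e2,
    mul_assoc, ← mul_assoc (G k (l ++ [j]) (.cross c j _) _), ← e5, mul_assoc,
    ← mul_assoc (G k l (.cap j) _), ← e4, mul_assoc, ← mul_assoc (G k l (.cap j) _), e6, mul_assoc,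
    ← e7, ← mul_assoc (G k (l ++ [c]) (.cap j) _), e8, E_mul_G (by simp)]

/-- Here the strand `j` comes from the right, while outputs leave to the left of the merged line;
one crossing is therefore needed before the cap joins the two parts. -/
theorem mergeOver_cross_second (z : Diag (x ++ [j]) y) (h : Far c y) (hj : Distant c j)
    (hy : Far c (y ++ [j])) :
    T k l (mergeOver z h) r * G k (l ++ c :: x) (.cross c j hj) r =
      G k (l ++ y) (.cap j) (c :: r) * (G k (l ++ (y ++ [j])) (.cross c j hj) r *
        T k l (mergeOver (bendRight z) hy) (j :: r)) := by
  have e1 := cross_merge_left (k := k) (l ++ (y ++ [j])) r hj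
  have e2 := G_comm (k := k) (l ++ y) [] r (.cross c j hj) (.cross c j hj)
  have e3 := G_comm (k := k) (l ++ y) [] r (.cap j) (.merge c)
  have e4 := cap_through (k := k) (l ++ y) (c :: r) hj
  have e5 := T_comm_G (k := k) l [] (c :: r) (overRight c y h) (.cap j)
  have e6 := T_comm_G (k := k) l [j] r (overRight c y h) (.cross c j hj)
  have e7 := T_comm_G (k := k) (l ++ [c]) [j] r z (.cross c j hj)
  have e8 := T_comm_G (k := k) (l ++ [c]) [] (c :: r) z (.cap j)
  have e9 := G_comm (k := k) (l ++ ([c] ++ x)) [] r (.cup j) (.cross c j hj)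
  have e10 := zigzag_right (k := k) (l ++ c :: x) (c :: r) j
  simp only [List.append_assoc, List.nil_append, List.append_nil, List.cons_append]
    at e1 e2 e3 e4 e5 e6 e7 e8 e9 e10
  rw [T_mergeOver, T_mergeOver, T_bendRight, T_overRight_append, T_overRight_one]
  simp only [List.append_assoc, List.cons_append, List.nil_append, mul_assoc]
  rw [← mul_assoc (G k (l ++ (y ++ [j])) (.cross c j hj) r), e1]
  simp only [mul_assoc]
  rw [← mul_assoc (G k (l ++ y) (.cap j) _), ← e3, mul_assoc,
    ← mul_assoc (G k (l ++ (y ++ [j, c])) _ _), e2, mul_assoc,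
    ← mul_assoc (G k (l ++ (y ++ [j])) _ _), ← mul_assoc (G k (l ++ y) (.cap j) _), e4,
    ← mul_assoc (G k (l ++ (y ++ [c, j])) _ _), e6, mul_assoc,
    ← mul_assoc (G k (l ++ (y ++ [c])) _ _), e5, mul_assoc,
    ← mul_assoc (G k (l ++ c :: (y ++ [j])) _ _), e7, mul_assoc,
    ← mul_assoc (G k (l ++ c :: y) _ _), e8, mul_assoc, e9,
    ← mul_assoc (G k (l ++ c :: (x ++ [j])) _ _), e10, E_mul_G (by simp)]

theorem mergeOver_cross_second' (z : Diag x y) (h : Far c y) (hj : Distant j c)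
    (hy : Far c (y ++ [j])) :
    T k l (mergeOver z h) (j :: r) * G k (l ++ c :: x) (.cross j c hj) r =
      G k (l ++ y) (.cross j c hj) r * T k l (mergeOver (snocStrand j z) hy) r := by
  have e1 := T_comm_G (k := k) (l ++ [c]) [] r z (.cross j c hj)
  have e2 := T_comm_G (k := k) l [] r (overRight c y h) (.cross j c hj)
  have e3 := cross_merge_right (k := k) (l ++ y) r hj
  have e4 := cross_cross (k := k) (l ++ y) (c :: r) hj.symm hj
  simp only [List.append_assoc, List.nil_append, List.append_nil, List.cons_append] at e1 e2 e3 e4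
  rw [T_mergeOver, T_mergeOver, T_snocStrand, T_overRight_append, T_overRight_one]
  simp only [List.cons_append, List.nil_append, mul_assoc]
  rw [← e1, ← mul_assoc (T k l _ _), ← e2, ← mul_assoc (G k (l ++ y) (.cross j c hj) _), e3]
  simp only [mul_assoc]
  rw [← mul_assoc (G k (l ++ y) (.cross j c hj) _), e4, E_mul_T_mul (by simp)]

end MergeOver

end TLCat

/-! ### Eliminating the highest colour: merges. -/

namespace TLCat

open Diag

section Spanning

variable {k : Type*} [Field k] {n : ℕ} {c : Fin n}

theorem Diag.Below.lt_of_mem {m : ℕ} {s t : Word n} {D : Diag s t} (hD : D.Below m)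
    (hs : ∀ i ∈ s, i.val < m) : ∀ i ∈ t, i.val < m := by
  induction D with
  | nil w => exact hs
  | cons L D ih =>
    refine ih hD.2 ?_
    obtain ⟨l', r', x, y, g, rfl, rfl⟩ := L
    intro i hi
    simp only [List.mem_append] at hi hs
    rcases hi with (hi | hi) | hi
    · exact hs i (Or.inl (Or.inl hi))
    · exact hD.1.lt_of_mem_top i hi
    · exact hs i (Or.inr hi)

theorem Gen.Below.mono {m m' : ℕ} (h : m ≤ m') {a b : Word n} {g : Gen n a b} (hg : g.Below m) :
    g.Below m' := by
  cases g <;> simp only [Gen.Below] at hg ⊢ <;> omega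

theorem Diag.Below.mono {m m' : ℕ} (h : m ≤ m') {s t : Word n} {D : Diag s t} (hD : D.Below m) :
    D.Below m' := by
  induction D with
  | nil w => trivial
  | cons L D ih => exact ⟨hD.1.mono h, ih hD.2⟩

theorem Diag.Below.snocStrand {m : ℕ} {x y : Word n} {z : Diag x y} (hz : z.Below m) (j : Fin n) :
    (snocStrand j z).Below m :=
  (hz.whisker [] [j]).cast _ _

theorem Diag.Below.consStrand {m : ℕ} {x y : Word n} {z : Diag x y} (hz : z.Below m) (j : Fin n) :
    (consStrand j z).Below m :=
  (hz.whisker [j] []).cast _ _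

theorem M_overRight {w w' l r y : Word n} (h : Far c y) (hy : ∀ i ∈ y, i.val < c.val) {X : Alg k n}
    (hX : X ∈ M k c w) (hw : w = l ++ c :: (y ++ r)) (hw' : w' = l ++ (y ++ c :: r)) :
    T k l (overRight c y h) r * X ∈ M k c w' := by
  induction y generalizing l w X with
  | nil =>
    subst hw hw'
    rw [T_overRight_nil]
    simp only [List.nil_append] at hX ⊢
    rw [E_mul_mem hX]; exact hX
  | cons j y ih =>
    rw [T_overRight_cons, mul_assoc]
    have hj : j.val < c.val := hy j (by simp)
    refine ih h.tail (fun i hi => hy i (List.mem_cons_of_mem _ hi)) (w := l ++ j :: c :: (y ++ r))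
      (M_step (g := .cross c j h.head) ⟨le_rfl, le_of_lt hj⟩ hX ?_ ?_) ?_ ?_
    all_goals simp [hw, hw']

theorem M_overLeft {w w' l r y : Word n} (h : Far c y) (hy : ∀ i ∈ y, i.val < c.val) {X : Alg k n}
    (hX : X ∈ M k c w) (hw : w = l ++ (y ++ c :: r)) (hw' : w' = l ++ c :: (y ++ r)) :
    T k l (overLeft c y h) r * X ∈ M k c w' := by
  induction y generalizing l w' X with
  | nil =>
    subst hw hw'
    rw [T_overLeft_nil]
    simp only [List.nil_append] at hX ⊢
    rw [E_mul_mem hX]; exact hX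
  | cons j y ih =>
    rw [T_overLeft_cons, mul_assoc]
    have hj : j.val < c.val := hy j (by simp)
    refine M_step (g := .cross j c h.head.symm) ⟨le_of_lt hj, le_rfl⟩
      (ih h.tail (fun i hi => hy i (List.mem_cons_of_mem _ hi)) (w' := l ++ j :: c :: (y ++ r))
        hX ?_ ?_) ?_ ?_
    all_goals simp [hw, hw']

/-- The span of all diagrams with colours less than `m`, together with double dots of all colours
in the outer region. -/
noncomputable def Sp (k : Type*) [Field k] (m : ℕ) (w : Word n) : Submodule k (HOM k [] w) :=
  Submodule.span k {x | ∃ (e : Fin n →₀ ℕ) (D : Diag [] w), D.Below m ∧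
    x = cls k ((doubleDots e).comp D)}

/-- A bubble of colour `c` around a diagram of lower colours. -/
theorem M_bubble_over {w w' l r y : Word n} {X : Alg k n} (hX : X ∈ M k c w)
    (hw : w = l ++ c :: r) (hw' : w' = l ++ (y ++ c :: r)) (z : Diag [] y) (h : Far c y)
    (hz : cls k z ∈ Sp k (c.val - 1) y) :
    T k l (mergeOver z h) r * (G k l (.split c) r * X) ∈ M k c w' := by
  rw [T_mergeOver, T_emb (l ++ [c])]
  generalize cls k z = ζ at hz
  induction hz using Submodule.span_induction with
  | zero => simp
  | add x y _ _ hx hy => simp only [map_add, mul_add, add_mul]; exact add_mem hx hy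
  | smul a x _ hx =>
    simp only [map_smul, mul_smul_comm, smul_mul_assoc]; exact Submodule.smul_mem _ _ hx
  | mem x hx =>
    obtain ⟨e, D, hD, rfl⟩ := hx
    rw [← T_emb, T_comp]
    -- For `c = 0` the truncated difference `c - 1` is `0` as well. No piece has a colour below `0`,
    -- so the enclosed diagram is a polynomial only.
    by_cases hc : c.val = 0
    · cases D with
      | nil =>
        have e1 := E_mul_mem hX
        have := M_bubble hX e hw
        rw [T_nil, T_overRight_nil]
        simp only [List.append_assoc, List.append_nil, List.nil_append, List.cons_append,
          mul_assoc] at hw' ⊢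
        rw [E_mul_T_mul (by simp), E_mul_T_mul (by simp), hw', ← hw]
        exact this
      | cons L D =>
        have := hD.1
        rw [hc] at this
        exfalso
        revert this
        obtain ⟨l', r', a, b, g, h1, h2⟩ := L
        cases g <;> simp [Gen.Below]
    -- Colours below `c - 1` are distant from `c`: the diagram slides out of the bubble and only the
    -- polynomial stays inside.
    · have e1 := overRight_T (k := k) (m := c.val - 1) (by omega) l (c :: r) D hD
        (fun j hj => by simp at hj) h
      have e2 := T_comm_G (k := k) l [] r D (.merge c)
      have e3 := T_overRight_nil (k := k) (c := c) l (c :: r) (fun j hj => by simp at hj)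
      simp only [List.nil_append, List.append_nil, List.cons_append] at e2
      simp only [mul_assoc]
      rw [← mul_assoc (T k l _ _), e1, e3, mul_assoc, E_mul_T_mul (by simp), ← mul_assoc, e2,
        mul_assoc]
      exact M_T (hD.mono (by omega)) (M_bubble hX e hw) (by simp [hw]) (by simp [hw'])

/-- Two lines of colour `c` may be merged over a diagram of lower colours. -/
theorem Cre.mergeOver_mem (hlow : ∀ (y : Word n) (z : Diag [] y), z.Below c.val → Far c y →
      cls k z ∈ Sp k (c.val - 1) y) {w : Word n} {X : Alg k n} (h : Cre k c w X) :
    ∀ (l x r : Word n), w = l ++ c :: (x ++ c :: r) → c ∉ x → ∀ (y : Word n) (z : Diag x y)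
      (_ : z.Below c.val) (hy : Far c y), T k l (mergeOver z hy) r * X ∈ M k c (l ++ (y ++ c :: r)) := by
  induction h with
  | base e => intro l x r h; simp at h
  | step l' r' g hg hX ih =>
    rename_i X a b
    intro l x r hw hx y z hz hy
    have hx' : ∀ i ∈ x, i.val < c.val := by
      intro i hi
      have := (Cre.step l' r' g hg hX).le i (by rw [hw]; simp [hi])
      exact lt_of_le_of_ne this fun h => hx ((Fin.ext h : i = c) ▸ hi)
    have hy' : ∀ i ∈ y, i.val < c.val := hz.lt_of_mem hx'
    -- The last piece lies left of the first line, right of it, or creates it. The second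
    -- possibility is divided again by its position relative to the second line. Pieces outside the
    -- two lines commute with the merge.
    rcases append_append_eq_append_cons hw with ⟨u, rfl, rfl⟩ | ⟨u, rfl, hu⟩ | ⟨b₁, b₂, rfl, rfl, hb2⟩
    · have e := G_comm_T (k := k) l' u r g (mergeOver z hy)
      simp only [List.append_assoc, List.cons_append, List.nil_append] at e
      rw [← mul_assoc, e, mul_assoc]
      exact M_step hg (ih (l' ++ (a ++ u)) x r (by simp) hx y z hz hy) (by simp) (by simp)
    · rcases append_append_eq_append_cons hu.symm with
        ⟨v, rfl, rfl⟩ | ⟨v, rfl, rfl⟩ | ⟨b₁, b₂, rfl, hxu, rfl⟩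
      -- A piece between the two lines does not involve `c` and is absorbed into the enclosed
      -- diagram. This is why the induction runs over all `z` and not just over plain merges.
      · have hg' : g.Below c.val := hg.below (fun h => hx (by simp [h]))
        have hD : ((Diag.step (t := u ++ (b ++ v)) u g v (s := u ++ (a ++ v))
          (by simp) (by simp)).comp z).Below c.val := Diag.Below.comp ⟨hg', trivial⟩ hz
        have := ih l (u ++ (a ++ v)) r (by simp) (by
          intro h
          simp only [List.mem_append, not_or] at h hx
          rcases h with h | h | h
          · exact hx.1 h
          · exact absurd (hg'.lt_of_mem_bot _ h) (lt_irrefl _)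
          · exact hx.2.2 h) y _ hD hy
        rw [T_mergeOver, T_comp, T_step] at this
        rw [T_mergeOver]
        simpa [mul_assoc] using this
      · have e := T_comm_G (k := k) l v r' (mergeOver z hy) g
        simp only [List.append_assoc, List.cons_append, List.nil_append] at e
        rw [← mul_assoc, ← e, mul_assoc]
        exact M_step hg (ih l x (v ++ (a ++ r')) (by simp) hx y z hz hy) (by simp) (by simp)
      · generalize hb : b₁ ++ c :: b₂ = b at g hX
        cases g with
        | startDot i =>
          obtain ⟨rfl, rfl, rfl⟩ : b₁ = [] ∧ c = i ∧ b₂ = [] := by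
            rcases b₁ with _ | ⟨x, b₁⟩ <;> simp_all
          obtain rfl : u = x := by simpa using hxu.symm
          have e := mergeOver_dot_second (k := k) l r' z hy
          simp only [List.nil_append] at hX ⊢
          rw [← mul_assoc, e, mul_assoc]
          exact M_overRight hy hy' (M_T hz hX.mem (by simp) rfl) (by simp) rfl
        | endDot i => simp at hb
        | merge i =>
          have : c = i := by rcases b₁ with _ | ⟨x, b₁⟩ <;> simp_all
          exact absurd hg (by simp [Gen.Creates, this])
        | split i =>
          have : (b₁ = [] ∧ c = i ∧ b₂ = [i]) ∨ (b₁ = [i] ∧ c = i ∧ b₂ = []) := by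
            rcases b₁ with _ | ⟨x, _ | ⟨y, b₁⟩⟩ <;> simp_all
          rcases this with ⟨rfl, rfl, rfl⟩ | ⟨rfl, rfl, rfl⟩
          · obtain rfl : u = x := by simpa using hxu.symm
            have e := mergeOver_split_right (k := k) l r' z hy
            simp only [List.singleton_append] at hX ⊢
            rw [← mul_assoc, e, mul_assoc]
            exact M_step hg (ih l u r' (by simp) hx y z hz hy) (by simp) (by simp)
          · exact absurd (by simp [hxu]) hx
        | cup i =>
          have : c = i := by rcases b₁ with _ | ⟨x, _ | ⟨y, b₁⟩⟩ <;> simp_all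
          exact absurd hg (by simp [Gen.Creates, this])
        | cap i => simp at hb
        | cross i j hij =>
          have : (b₁ = [] ∧ c = j ∧ b₂ = [i]) ∨ (b₁ = [j] ∧ c = i ∧ b₂ = []) := by
            rcases b₁ with _ | ⟨x, _ | ⟨y, b₁⟩⟩ <;> simp_all
          rcases this with ⟨rfl, rfl, rfl⟩ | ⟨rfl, rfl, rfl⟩
          · obtain rfl : u = x := by simpa using hxu.symm
            have hy2 : Far c (y ++ [i]) := hy.append (by simpa [Far] using hij.symm)
            have e := mergeOver_cross_second' (k := k) l r' z hy hij hy2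
            have hic : c ≠ i := by rintro rfl; unfold Distant at hij; omega
            have := ih l (u ++ [i]) r' (by simp) (by simp [hx, hic]) _ (snocStrand i z)
              (hz.snocStrand i) hy2
            simp only [List.singleton_append] at hX ⊢
            rw [← mul_assoc, e, mul_assoc]
            exact M_step hg this (by simp) (by simp)
          · subst hxu
            have hy2 : Far c (y ++ [j]) := hy.append (by simpa [Far] using hij)
            have e := mergeOver_cross_second (k := k) l r' z hy hij hy2
            have hj : j.val < c.val := hx' j (by simp)
            have := ih l u (j :: r') (by simp) (fun h => hx (by simp [h])) _ (bendRight z)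
              (Diag.Below.comp ⟨hj, trivial⟩ (hz.snocStrand j)) hy2
            simp only [List.nil_append] at hX ⊢
            rw [← mul_assoc, e, mul_assoc, mul_assoc]
            exact M_step (g := .cap j) hj
              (M_step (w' := l ++ (y ++ j :: j :: c :: r')) hg this (by simp) (by simp))
              (by simp) (by simp)
    · generalize hb : b₁ ++ c :: b₂ = b at g hX
      cases g with
      | startDot i =>
        obtain ⟨rfl, rfl, rfl⟩ : b₁ = [] ∧ c = i ∧ b₂ = [] := by
          rcases b₁ with _ | ⟨x, b₁⟩ <;> simp_all
        obtain rfl : r' = x ++ c :: r := by simpa using hb2.symm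
        have e := mergeOver_dot_first (k := k) l' r z hy
        simp only [List.append_nil, List.nil_append] at hX ⊢
        rw [← mul_assoc, e]
        exact M_T hz hX.mem rfl rfl
      | endDot i => simp at hb
      | merge i =>
        have : c = i := by rcases b₁ with _ | ⟨x, b₁⟩ <;> simp_all
        exact absurd hg (by simp [Gen.Creates, this])
      | split i =>
        have : (b₁ = [] ∧ c = i ∧ b₂ = [i]) ∨ (b₁ = [i] ∧ c = i ∧ b₂ = []) := by
          rcases b₁ with _ | ⟨x, _ | ⟨y, b₁⟩⟩ <;> simp_all
        rcases this with ⟨rfl, rfl, rfl⟩ | ⟨rfl, rfl, rfl⟩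
        · obtain ⟨rfl, rfl⟩ : x = [] ∧ r = r' := by
            rcases x with _ | ⟨a, x⟩ <;> simp_all
          -- Both lines come from this splitting, so `z` starts from the empty word inside a bubble;
          -- only here is `hlow` needed.
          have := M_bubble_over (l := l') (r := r) hX.mem (by simp) rfl z hy (hlow y z hz hy)
          simpa using this
        · obtain rfl : r' = x ++ c :: r := by simpa using hb2.symm
          have e := mergeOver_split_left (k := k) l' r z hy
          simp only [List.singleton_append] at hX
          rw [← mul_assoc, e, mul_assoc, mul_assoc]
          refine M_overLeft (r := c :: r) hy hy' (w := l' ++ (y ++ c :: c :: r)) (M_step hg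
            (ih l' x r (by simp) hx y z hz hy) (by simp) (by simp)) rfl (by simp)
      | cup i =>
        have : c = i := by rcases b₁ with _ | ⟨x, _ | ⟨y, b₁⟩⟩ <;> simp_all
        exact absurd hg (by simp [Gen.Creates, this])
      | cap i => simp at hb
      | cross i j hij =>
        have : (b₁ = [] ∧ c = j ∧ b₂ = [i]) ∨ (b₁ = [j] ∧ c = i ∧ b₂ = []) := by
          rcases b₁ with _ | ⟨x, _ | ⟨y, b₁⟩⟩ <;> simp_all
        rcases this with ⟨rfl, rfl, rfl⟩ | ⟨rfl, rfl, rfl⟩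
        · have hic : c ≠ i := by rintro rfl; unfold Distant at hij; omega
          obtain ⟨x', rfl, rfl⟩ : ∃ x', x = i :: x' ∧ r' = x' ++ c :: r := by
            rcases x with _ | ⟨a, x⟩ <;> simp_all
          have hi : i.val < c.val := hx' i (by simp)
          have hy2 : Far c (i :: y) := Far.append (y := [i]) (by simpa [Far] using hij.symm) hy
          have e := mergeOver_cross_first' (k := k) l' r z hy hy2
          have := ih (l' ++ [i]) x' r (by simp) (fun h => hx (by simp [h])) _ (bendLeft z)
            (Diag.Below.comp ⟨hi, trivial⟩ (hz.consStrand i)) hy2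
          simp only [List.append_nil] at hX ⊢
          rw [← mul_assoc, e, mul_assoc]
          exact M_step (g := .cap i) hi this (by simp) (by simp)
        · obtain rfl : r' = x ++ c :: r := by simpa using hb2.symm
          have hjc : c ≠ j := by rintro rfl; unfold Distant at hij; omega
          have hy2 : Far c (j :: y) := Far.append (y := [j]) (by simpa [Far] using hij) hy
          have e := mergeOver_cross_first (k := k) l' r z hy hy2
          have := ih l' (j :: x) r (by simp) (by simp [hx, hjc]) _ (consStrand j z)
            (hz.consStrand j) hy2
          rw [← mul_assoc, e]
          simpa using this

end Spanning

end TLCat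

/-! ### Generation of `HOM(∅, w)` by `phi w` for increasing words. -/

namespace TLCat

open Diag

section Reduction

variable {k : Type*} [Field k] {n : ℕ} {c : Fin n}

/-- The case of `mergeOver` with nothing between the two lines. -/
theorem M_merge (hlow : ∀ (y : Word n) (z : Diag [] y), z.Below c.val → Far c y →
      cls k z ∈ Sp k (c.val - 1) y) {w w' l r : Word n} {X : Alg k n} (hX : X ∈ M k c w)
    (hw : w = l ++ c :: c :: r) (hw' : w' = l ++ c :: r) :
    G k l (.merge c) r * X ∈ M k c w' := by
  subst hw'
  refine M_induction (fun X hX => ?_) hX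
  have hf : Far c ([] : Word n) := fun j hj => by simp at hj
  have := hX.mergeOver_mem hlow l [] r (by simp [hw]) (by simp) [] (.nil []) trivial hf
  have e := T_mergeOver (k := k) l r (.nil []) hf
  rw [T_overRight_nil, T_nil] at e
  erw [e] at this
  simp only [List.append_assoc, List.append_nil, List.nil_append, List.cons_append] at this
  rwa [E_mul_E, G_mul_E (by simp)] at this

/-- A cup is a splitting on a start dot and a cap is an end dot on a merge, so end dots and merges
of colour `c` are the only pieces outside `Gen.Creates` that need an argument. -/
theorem M_gen (hlow : ∀ (y : Word n) (z : Diag [] y), z.Below c.val → Far c y →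
      cls k z ∈ Sp k (c.val - 1) y) {w w' l r a b : Word n} {g : Gen n a b}
    (hg : g.Below (c.val + 1)) {X : Alg k n} (hX : X ∈ M k c w) (hw : w = l ++ (a ++ r))
    (hw' : w' = l ++ (b ++ r)) : G k l g r * X ∈ M k c w' := by
  by_cases hc : g.Creates c
  · exact M_step hc hX hw hw'
  · have key : ∀ i : Fin n, i.val < c.val + 1 → ¬ i < c → i = c := fun i h1 h2 => by
      rw [Fin.lt_def] at h2; exact Fin.ext (by omega)
    cases g with
    | startDot i => exact absurd (Nat.lt_succ_iff.1 hg) hc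
    | endDot i => obtain rfl := key i hg hc; exact M_endDot hX hw hw'
    | merge i => obtain rfl := key i hg hc; exact M_merge hlow hX hw hw'
    | split i => exact absurd (Nat.lt_succ_iff.1 hg) hc
    | cup i =>
      obtain rfl := key i hg hc
      rw [← split_dot, mul_assoc]
      exact M_step (g := .split i) le_rfl
        (M_step (g := .startDot i) (w' := l ++ i :: r) le_rfl hX hw (by simp)) (by simp) hw'
    | cap i =>
      obtain rfl := key i hg hc
      rw [← endDot_merge, mul_assoc]
      exact M_endDot (w := l ++ i :: r) (M_merge hlow hX hw rfl) rfl hw'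
    | cross i j hij => exact absurd ⟨Nat.lt_succ_iff.1 hg.1, Nat.lt_succ_iff.1 hg.2⟩ hc

theorem M_diag (hlow : ∀ (y : Word n) (z : Diag [] y), z.Below c.val → Far c y →
      cls k z ∈ Sp k (c.val - 1) y) {w w' : Word n} (D : Diag w w')
    (hD : D.Below (c.val + 1)) {X : Alg k n} (hX : X ∈ M k c w) : op k D * X ∈ M k c w' := by
  induction D generalizing X with
  | nil v => rw [op_nil, E_mul_mem hX]; exact hX
  | cons L D ih =>
    obtain ⟨l', r', x, y, g, rfl, rfl⟩ := L
    rw [op_cons, mul_assoc]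
    exact ih hD.2 (M_gen hlow hD.1 hX (by simp) (by simp))

/-- The operators of the elements of `Sp`. -/
noncomputable def SpA (k : Type*) [Field k] (m : ℕ) (w : Word n) : Submodule k (Alg k n) :=
  (Sp k m w).map emb

theorem emb_mem_SpA {m : ℕ} {w : Word n} {x : HOM k [] w} : emb x ∈ SpA k m w ↔ x ∈ Sp k m w := by
  rw [SpA, Submodule.mem_map]
  exact ⟨fun ⟨y, hy, h⟩ => emb_injective h ▸ hy, fun h => ⟨x, h, rfl⟩⟩

theorem op_step {s t l r a b : Word n} (g : Gen n a b) (hs : s = l ++ a ++ r)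
    (ht : t = l ++ b ++ r) : op k (Diag.step l g r hs ht) = G k l g r := by
  rw [op_eq_T, T_step]; simp

theorem SpA_step {m : ℕ} {w w' l r a b : Word n} {g : Gen n a b} (hg : g.Below m) {X : Alg k n}
    (hX : X ∈ SpA k m w) (hw : w = l ++ (a ++ r)) (hw' : w' = l ++ (b ++ r)) :
    G k l g r * X ∈ SpA k m w' := by
  obtain ⟨x, hx, rfl⟩ := hX
  have hG : G k l g r = emb (cls k (Diag.step (s := w) (t := w') l g r (by simp [hw])
      (by simp [hw']))) :=
    (op_step g _ _).symm
  rw [hG, emb_mul, emb_mem_SpA]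
  suffices h : (Sp k m w).map (hcomp.flip (cls k (Diag.step (s := w) (t := w') l g r
      (by simp [hw]) (by simp [hw'])))) ≤ Sp k m w' from h ⟨x, hx, rfl⟩
  rw [Sp, Submodule.map_span_le]
  rintro _ ⟨e, D, hD, rfl⟩
  rw [LinearMap.flip_apply, hcomp_cls, Diag.comp_assoc]
  have hst : (Diag.step (s := w) (t := w') l g r (by simp [hw]) (by simp [hw'])).Below m :=
    ⟨hg, trivial⟩
  exact Submodule.subset_span ⟨e, _, hD.comp hst, rfl⟩

/-- Creation diagrams with at most one line of colour `c` at the top. -/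
theorem Cre.mem_SpA {w : Word n} {X : Alg k n} (h : Cre k c w X) :
    (c ∉ w → X ∈ SpA k c.val w) ∧
    (∀ t₁ t₂, w = t₁ ++ c :: t₂ → c ∉ t₁ → c ∉ t₂ →
      ∃ Y ∈ SpA k c.val (t₁ ++ t₂), X = G k t₁ (.startDot c) t₂ * Y) := by
  induction h with
  | base e =>
    refine ⟨fun _ => ⟨cls k (doubleDots e), Submodule.subset_span ⟨e, .nil [], trivial, ?_⟩, rfl⟩,
      fun t₁ t₂ h => by simp at h⟩
    rw [comp_nil]
  | step l r g hg hX ih =>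
    rename_i X a b
    -- Lines of colour `c` never end in a creation diagram. If none reaches the top, the colour is
    -- absent. If exactly one does, it began with a start dot and was never split, so the dot can be
    -- pulled up to the top through the crossings.
    constructor
    · intro hc
      have hg' : g.Below c.val := hg.below fun h => hc (by simp [h])
      refine SpA_step hg' (ih.1 ?_) rfl rfl
      simp only [List.mem_append, not_or] at hc ⊢
      exact ⟨hc.1, fun h => absurd (hg'.lt_of_mem_bot _ h) (lt_irrefl _), hc.2.2⟩
    · intro t₁ t₂ hw h1 h2
      rcases append_append_eq_append_cons hw with ⟨u, rfl, rfl⟩ | ⟨u, rfl, rfl⟩ | ⟨b₁, b₂, rfl, rfl, rfl⟩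
      · have hg' : g.Below c.val := hg.below fun h => h1 (by simp [h])
        obtain ⟨Y, hY, rfl⟩ := ih.2 (l ++ (a ++ u)) t₂ (by simp) (by
          simp only [List.mem_append, not_or] at h1 ⊢
          exact ⟨h1.1, fun h => absurd (hg'.lt_of_mem_bot _ h) (lt_irrefl _), h1.2.2⟩) h2
        have e := G_comm (k := k) l u t₂ g (.startDot c)
        simp only [List.nil_append, List.cons_append] at e
        refine ⟨G k l g (u ++ t₂) * Y, SpA_step hg' hY (by simp) (by simp), ?_⟩
        rw [← mul_assoc, ← e, mul_assoc]
      · have hg' : g.Below c.val := hg.below fun h => h2 (by simp [h])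
        obtain ⟨Y, hY, rfl⟩ := ih.2 t₁ (u ++ (a ++ r)) (by simp) h1 (by
          simp only [List.mem_append, not_or] at h2 ⊢
          exact ⟨h2.1, fun h => absurd (hg'.lt_of_mem_bot _ h) (lt_irrefl _), h2.2.2⟩)
        have e := G_comm (k := k) t₁ u r (.startDot c) g
        simp only [List.nil_append, List.cons_append] at e
        refine ⟨G k (t₁ ++ u) g r * Y, SpA_step hg' hY (by simp) (by simp), ?_⟩
        rw [← mul_assoc, e, mul_assoc]
      · generalize hb : b₁ ++ c :: b₂ = b at g hX
        cases g with
        | startDot i =>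
          obtain ⟨rfl, rfl, rfl⟩ : b₁ = [] ∧ c = i ∧ b₂ = [] := by
            rcases b₁ with _ | ⟨x, b₁⟩ <;> simp_all
          simp only [List.append_nil, List.nil_append] at h1 h2 ih ⊢
          exact ⟨X, ih.1 (by simp [h1, h2]), rfl⟩
        | endDot i => simp at hb
        | merge i =>
          have : c = i := by rcases b₁ with _ | ⟨x, b₁⟩ <;> simp_all
          exact absurd hg (by simp [Gen.Creates, this])
        | split i =>
          have : (b₁ = [] ∧ c = i ∧ b₂ = [i]) ∨ (b₁ = [i] ∧ c = i ∧ b₂ = []) := by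
            rcases b₁ with _ | ⟨x, _ | ⟨y, b₁⟩⟩ <;> simp_all
          rcases this with ⟨rfl, rfl, rfl⟩ | ⟨rfl, rfl, rfl⟩
          · simp at h2
          · simp at h1
        | cup i =>
          have : c = i := by rcases b₁ with _ | ⟨x, _ | ⟨y, b₁⟩⟩ <;> simp_all
          exact absurd hg (by simp [Gen.Creates, this])
        | cap i => simp at hb
        | cross i j hij =>
          have : (b₁ = [] ∧ c = j ∧ b₂ = [i]) ∨ (b₁ = [j] ∧ c = i ∧ b₂ = []) := by
            rcases b₁ with _ | ⟨x, _ | ⟨y, b₁⟩⟩ <;> simp_all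
          rcases this with ⟨rfl, rfl, rfl⟩ | ⟨rfl, rfl, rfl⟩
          · simp only [List.append_nil, List.singleton_append] at h1 h2 ih ⊢
            obtain ⟨Y, hY, rfl⟩ := ih.2 (l ++ [i]) r (by simp) (by
              simp only [List.mem_append, List.mem_cons, List.not_mem_nil, or_false, not_or] at h2 ⊢
              exact ⟨h1, h2.1⟩) (fun h => h2 (by simp [h]))
            refine ⟨Y, by simpa using hY, ?_⟩
            rw [← mul_assoc, cross_dot_right]
          · simp only [List.nil_append] at h1 h2 ih ⊢
            obtain ⟨Y, hY, rfl⟩ := ih.2 l (j :: r) (by simp) (fun h => h1 (by simp [h])) (by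
              simp only [List.mem_append, List.mem_cons, List.not_mem_nil, or_false, not_or] at h1 ⊢
              exact ⟨h1.2, h2⟩)
            refine ⟨Y, by simpa using hY, ?_⟩
            rw [← mul_assoc, cross_dot_left]

theorem M_le_SpA {w : Word n} (hw : c ∉ w) : M k c w ≤ SpA k c.val w :=
  Submodule.span_le.2 fun _ hX => (Cre.mem_SpA hX).1 hw

theorem exists_of_mem_M {t₁ t₂ : Word n} (h1 : c ∉ t₁) (h2 : c ∉ t₂) {X : Alg k n}
    (hX : X ∈ M k c (t₁ ++ c :: t₂)) :
    ∃ Y ∈ SpA k c.val (t₁ ++ t₂), X = G k t₁ (.startDot c) t₂ * Y := by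
  induction hX using Submodule.span_induction with
  | mem x hx => exact (Cre.mem_SpA hx).2 t₁ t₂ rfl h1 h2
  | zero => exact ⟨0, zero_mem _, by simp⟩
  | add x y _ _ hx hy =>
    obtain ⟨Y, hY, rfl⟩ := hx
    obtain ⟨Y', hY', rfl⟩ := hy
    exact ⟨Y + Y', add_mem hY hY', by rw [mul_add]⟩
  | smul a x _ hx =>
    obtain ⟨Y, hY, rfl⟩ := hx
    exact ⟨a • Y, Submodule.smul_mem _ _ hY, by rw [mul_smul_comm]⟩

theorem cls_mem_Sp {m : ℕ} {w : Word n} {D : Diag [] w} (hD : D.Below m) : cls k D ∈ Sp k m w := by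
  have h0 : cls k (doubleDots (0 : Fin n →₀ ℕ)) = cls k (.nil []) := emb_injective op_doubleDots_zero
  refine Submodule.subset_span ⟨0, D, hD, ?_⟩
  rw [← hcomp_cls, h0, nil_hcomp]

theorem op_mem_M (hlow : ∀ (y : Word n) (z : Diag [] y), z.Below c.val → Far c y →
      cls k z ∈ Sp k (c.val - 1) y) {w : Word n} {D : Diag [] w} (hD : D.Below (c.val + 1))
    (e : Fin n →₀ ℕ) : op k ((doubleDots e).comp D) ∈ M k c w := by
  rw [op_comp]
  exact M_diag hlow D hD (Cre.base e).mem

theorem Diag.below_of_le {m : ℕ} (h : n ≤ m) {s t : Word n} (D : Diag s t) : D.Below m := by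
  induction D with
  | nil => trivial
  | cons L D ih =>
    refine ⟨?_, ih⟩
    obtain ⟨l, r, a, b, g, _, _⟩ := L
    cases g <;> simp only [Gen.Below] <;> omega

/-- The highest colour can be removed from the interior of a diagram. -/
theorem cls_mem_Sp_of_lt (m : ℕ) : ∀ (w : Word n), (∀ i ∈ w, i.val < m) → ∀ D : Diag [] w,
    D.Below (m + 1) → cls k D ∈ Sp k m w := by
  induction m with
  | zero =>
    intro w hw D hD
    obtain rfl : w = [] := by
      rcases w with _ | ⟨i, w⟩
      · rfl
      · exact absurd (hw i (by simp)) (by simp)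
    by_cases hn : 0 < n
    · have := M_le_SpA (by simp) (op_mem_M (k := k) (c := ⟨0, hn⟩)
        (fun y z hz _ => cls_mem_Sp hz) hD 0)
      rw [op_comp, op_doubleDots_zero, op_mul_E] at this
      exact emb_mem_SpA.1 this
    · refine cls_mem_Sp ?_
      exact Diag.below_of_le (by omega) D
  | succ m ih =>
    intro w hw D hD
    -- Now `c = m + 1`. A word that is below `c` and distant from `c` lies below `m`, so the
    -- induction hypothesis supplies the reduction of the diagrams enclosed in bubbles.
    by_cases hn : m + 1 < n
    · have := M_le_SpA (fun h => by simpa using hw _ h) (op_mem_M (k := k) (c := ⟨m + 1, hn⟩)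
        (fun y z hz hy => ih y (fun i hi => by
          have h1 := hy i hi
          have h2 := hz.lt_of_mem (by simp) i hi
          simp only [Distant] at h1 h2
          omega) z hz) hD 0)
      rw [op_comp, op_doubleDots_zero, op_mul_E] at this
      exact emb_mem_SpA.1 this
    · exact cls_mem_Sp (Diag.below_of_le (by omega) D)

/-- The double dots produced by removing colour `m` from a diagram multiply those already present in
the outer region. -/
theorem Sp_succ_le (m : ℕ) (w : Word n) (hw : ∀ i ∈ w, i.val < m) : Sp k (m + 1) w ≤ Sp k m w := by
  refine Submodule.span_le.2 ?_
  rintro _ ⟨e, D, hD, rfl⟩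
  have h := cls_mem_Sp_of_lt (k := k) m w hw D hD
  rw [SetLike.mem_coe, ← hcomp_cls]
  generalize cls k D = ζ at h
  induction h using Submodule.span_induction with
  | zero => simp
  | add x y _ _ hx hy => rw [map_add]; exact add_mem hx hy
  | smul a x _ hx => rw [map_smul]; exact Submodule.smul_mem _ _ hx
  | mem x hx =>
    obtain ⟨e', D', hD', rfl⟩ := hx
    have h1 : cls k ((doubleDots e).comp (doubleDots e')) = cls k (doubleDots (e + e')) := by
      apply emb_injective
      change op k _ = op k _
      rw [op_comp, add_comm e]
      induction e using exponent_induction with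
      | zero => rw [op_doubleDots_zero, op_mul_E, add_zero]
      | succ e j ih =>
        rw [op_doubleDots_add, ← op_doubleDots_comm, ← mul_assoc, ih, ← add_assoc,
          op_doubleDots_add, op_doubleDots_comm]
    rw [hcomp_cls, ← Diag.comp_assoc, ← hcomp_cls, h1, hcomp_cls]
    exact Submodule.subset_span ⟨_, D', hD', rfl⟩

/-- This discharges the assumption `hlow`. The letters of `y` are below `c` and distant from it,
hence below `c - 1`, so the colour `c - 1` is interior and removable. -/
theorem low_reduction (c : Fin n) (y : Word n) (z : Diag [] y) (hz : z.Below c.val)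
    (hy : Far c y) : cls k z ∈ Sp k (c.val - 1) y := by
  rcases Nat.eq_zero_or_pos c.val with h0 | h0
  · rw [h0] at hz ⊢; exact cls_mem_Sp hz
  · refine cls_mem_Sp_of_lt (c.val - 1) y (fun i hi => ?_) z (by rwa [Nat.sub_add_cancel h0])
    have h1 := hy i hi
    have h2 := hz.lt_of_mem (by simp) i hi
    unfold Distant at h1
    omega

theorem op_phi_snoc (w : Word n) (c : Fin n) :
    op k (phi (w ++ [c])) = G k w (.startDot c) [] * op k (phi w) := by
  induction w with
  | nil => exact (op_comp _ _)
  | cons i w ih =>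
    have e := G_comm (k := k) [] w [] (.startDot i) (.startDot c)
    simp only [List.nil_append, List.append_nil, List.cons_append] at e
    simp only [List.cons_append, phi]
    rw [op_comp, op_comp, ih, ← mul_assoc, ← mul_assoc]
    change G k [] (.startDot i) (w ++ [c]) * _ * _ = G k (i :: w) (.startDot c) [] *
      G k [] (.startDot i) w * _
    rw [e]

/-- The morphisms from the empty word to an increasing word are polynomial multiples of `phi`. -/
theorem Sp_increasing (m : ℕ) (w : Word n) (hw : w.Pairwise (· < ·)) (hm : ∀ i ∈ w, i.val < m) :
    Sp k m w ≤ Submodule.span k (Set.range fun e => cls k ((doubleDots e).comp (phi w))) := by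
  induction m generalizing w with
  | zero =>
    obtain rfl : w = [] := by
      rcases w with _ | ⟨i, w⟩
      · rfl
      · exact absurd (hm i (by simp)) (by simp)
    refine Submodule.span_le.2 ?_
    rintro _ ⟨e, D, hD, rfl⟩
    refine Submodule.subset_span ⟨e, ?_⟩
    cases D with
    | nil => rfl
    | cons L D =>
      have := hD.1
      exfalso
      revert this
      obtain ⟨l', r', a, b, g, h1, h2⟩ := L
      cases g <;> simp [Gen.Below]
  | succ m ih =>
    by_cases h : ∀ i ∈ w, i.val < m
    · exact (Sp_succ_le m w h).trans (ih w hw h)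
    · push Not at h
      obtain ⟨c, hc, hcm⟩ := h
      have hcm : c.val = m := le_antisymm (Nat.lt_succ_iff.1 (hm c hc)) hcm
      obtain ⟨w, rfl⟩ : ∃ w', w = w' ++ [c] := by
        obtain ⟨t₁, t₂, rfl⟩ := List.append_of_mem hc
        rcases t₂ with _ | ⟨d, t₂⟩
        · exact ⟨t₁, rfl⟩
        · have h1 : c < d := by
            rw [List.pairwise_append, List.pairwise_cons] at hw
            exact hw.2.1.1 d (by simp)
          have h2 := hm d (by simp)
          rw [Fin.lt_def] at h1
          omega
      rw [List.pairwise_append] at hw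
      have hlt : ∀ i ∈ w, i.val < m := fun i hi => by
        have := hw.2.2 i hi c (by simp)
        rwa [Fin.lt_def, hcm] at this
      have hcw : c ∉ w := fun h => by have := hlt c h; omega
      refine Submodule.span_le.2 ?_
      rintro _ ⟨e, D, hD, rfl⟩
      -- The highest colour is the last letter and occurs once, so its line is a start dot on top of
      -- a diagram of lower colours; `phi` is extended by the same dot.
      have h1 := op_mem_M (low_reduction (k := k) c) (hcm ▸ hD) e
      obtain ⟨Y, hY, h2⟩ := exists_of_mem_M hcw (by simp) h1
      rw [List.append_nil, hcm] at hY
      obtain ⟨y, hy, rfl⟩ := hY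
      have h3 := ih w hw.1 hlt hy
      have h4 : cls k ((doubleDots e).comp D)
          = hcomp y (cls k (Diag.step w (.startDot c) [] (by simp) (by simp))) := by
        apply emb_injective
        rw [← emb_mul]
        refine h2.trans ?_
        congr 1
        exact (op_step _ _ _).symm
      rw [SetLike.mem_coe, h4]
      clear h4 h2 h1 hy
      induction h3 using Submodule.span_induction with
      | zero => simp
      | add x y _ _ hx hy => rw [map_add, LinearMap.add_apply]; exact add_mem hx hy
      | smul a x _ hx => rw [map_smul, LinearMap.smul_apply]; exact Submodule.smul_mem _ _ hx
      | mem x hx =>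
        obtain ⟨e, rfl⟩ := hx
        refine Submodule.subset_span ⟨e, emb_injective ?_⟩
        simp only [hcomp_cls]
        change op k _ = op k _
        rw [Diag.comp_assoc, op_comp, op_comp, op_comp, op_phi_snoc]
        rw [op_step]

theorem polyMap_surjective (w : Word n) (hw : w.Pairwise (· < ·)) :
    Function.Surjective (polyMap k w) := by
  rw [← LinearMap.range_eq_top, eq_top_iff, polyMap, Module.Basis.constr_range, ← span_cls]
  refine Submodule.span_le.2 ?_
  rintro _ ⟨D, rfl⟩
  exact Sp_increasing n w hw (fun i _ => i.2) (cls_mem_Sp (Diag.below_of_le le_rfl D))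

end Reduction

end TLCat

namespace TLCat

open Diag

/-! ### The grading of morphism spaces -/

section Grading

variable {k : Type*} [Field k] {n : ℕ}

@[simp] theorem Diag.degree_one (l : Word n) {a b : Word n} (g : Gen n a b) (r : Word n) :
    (one l g r).degree = g.degree := by
  simp [one, Diag.degree]

@[simp] theorem Diag.degree_step {s t : Word n} (l : Word n) {a b : Word n} (g : Gen n a b)
    (r : Word n) (hs : s = l ++ a ++ r) (ht : t = l ++ b ++ r) :
    (Diag.step l g r hs ht).degree = g.degree := by
  simp [Diag.step, Diag.degree]

@[simp] theorem Diag.degree_nil (w : Word n) : (Diag.nil w).degree = 0 := rfl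

theorem Diag.degree_insert {s t a b : Word n} (l r : Word n) (p : Diag s (l ++ a ++ r))
    (q : Diag (l ++ b ++ r) t) (D : Diag a b) :
    (Diag.insert l r p q D).degree = p.degree + (D.degree + q.degree) := by
  simp [Diag.insert]

theorem Isotopy.degree_eq {a b : Word n} {D D' : Diag a b} (h : Isotopy a b D D') :
    D.degree = D'.degree := by
  cases h <;> simp [Gen.degree, add_comm]

/-- Formal combinations of diagrams of degree `d`. -/
noncomputable def picDeg (k : Type*) [Field k] {n : ℕ} (a b : Word n) (d : ℤ) :
    Submodule k (Diag a b →₀ k) :=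
  Submodule.span k {x | ∃ D : Diag a b, D.degree = d ∧ x = pic k D}

theorem pic_mem {a b : Word n} {d : ℤ} {D : Diag a b} (h : D.degree = d) :
    pic k D ∈ picDeg k a b d :=
  Submodule.subset_span ⟨D, h, rfl⟩

theorem GraphRel.homogeneous {a b : Word n} {y : Diag a b →₀ k} (h : GraphRel k a b y) :
    ∃ d, y ∈ picDeg k a b d := by
  cases h with
  | assoc i =>
    exact ⟨-2, sub_mem (pic_mem (by simp [Gen.degree])) (pic_mem (by simp [Gen.degree]))⟩
  | unit i =>
    exact ⟨0, sub_mem (pic_mem (by simp [Gen.degree])) (pic_mem (by simp))⟩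
  | needle i =>
    exact ⟨-1, pic_mem (by simp [Gen.degree])⟩
  | dot_same i =>
    exact ⟨2, sub_mem (add_mem (pic_mem (by simp [dotLeft, Gen.degree]))
      (pic_mem (by simp [dotRight, Gen.degree])))
      (Submodule.smul_mem _ _ (pic_mem (by simp [brokenLine, Gen.degree])))⟩
  | dot_near i j h =>
    exact ⟨2, sub_mem (pic_mem (by simp [dotLeft, Gen.degree]))
      (sub_mem (add_mem (pic_mem (by simp [dotRight, Gen.degree]))
      (pic_mem (by simp [dotRight, Gen.degree])))
      (pic_mem (by simp [brokenLine, Gen.degree])))⟩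
  | switch i j h =>
    exact ⟨2, add_mem (pic_mem (by simp [Gen.degree])) (pic_mem (by simp [Gen.degree]))⟩

/-- The projection to the component of degree `m`. -/
noncomputable def homProj (k : Type*) [Field k] {n : ℕ} (s t : Word n) (m : ℤ) :
    HOM k s t →ₗ[k] HOM k s t :=
  (relations k s t).liftQ
    (Finsupp.lift _ k _ fun D : Diag s t => if D.degree = m then cls k D else 0) (by
    refine relations_le_ker _ ?_ ?_
    · intro a b l r p q D D' h
      have h1 := cls_eq_of_isotopy (k := k) l r p q h
      have h2 := h.degree_eq
      simp [pic, h1, degree_insert, h2]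
    · intro a b l r p q y h
      obtain ⟨d, hd⟩ := h.homogeneous
      have h0 := mkQ_eq_zero_of_graphRel l r p q h
      have key : (Finsupp.lift _ k _ fun D : Diag s t => if D.degree = m then cls k D else 0)
          (Finsupp.mapDomain (Diag.insert l r p q) y) =
          (if p.degree + (d + q.degree) = m then (1 : k) else 0) •
            (relations k s t).mkQ (Finsupp.mapDomain (Diag.insert l r p q) y) := by
        clear h0 h
        induction hd using Submodule.span_induction with
        | mem x hx =>
          obtain ⟨D, rfl, rfl⟩ := hx
          simp only [pic, Finsupp.mapDomain_single, Finsupp.lift_apply, zero_smul,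
            Finsupp.sum_single_index, one_smul, degree_insert]
          split_ifs
          · rw [one_smul]; rfl
          · rw [zero_smul]
        | zero => simp
        | add x y _ _ hx hy => simp only [Finsupp.mapDomain_add, map_add, hx, hy, smul_add]
        | smul c x _ hx =>
          simp only [Finsupp.mapDomain_smul, map_smul, hx, smul_comm c]
      rw [key, h0, smul_zero])

theorem homProj_cls {s t : Word n} (m : ℤ) (D : Diag s t) :
    homProj k s t m (cls k D) = if D.degree = m then cls k D else 0 := by
  rw [homProj, cls, Submodule.mkQ_apply, Submodule.liftQ_apply]
  simp [pic, cls]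

theorem cls_mem_homDeg {s t : Word n} {m : ℤ} {D : Diag s t} (h : D.degree = m) :
    cls k D ∈ homDeg k s t m :=
  Submodule.subset_span ⟨D, h, rfl⟩

theorem homProj_of_mem {s t : Word n} {m : ℤ} {x : HOM k s t} (hx : x ∈ homDeg k s t m) :
    homProj k s t m x = x := by
  induction hx using Submodule.span_induction with
  | mem x hx => obtain ⟨D, rfl, rfl⟩ := hx; simp [homProj_cls]
  | zero => simp
  | add x y _ _ hx hy => simp [hx, hy]
  | smul c x _ hx => simp [hx]

theorem homProj_of_mem_ne {s t : Word n} {m m' : ℤ} (h : m' ≠ m) {x : HOM k s t}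
    (hx : x ∈ homDeg k s t m') : homProj k s t m x = 0 := by
  induction hx using Submodule.span_induction with
  | mem x hx => obtain ⟨D, rfl, rfl⟩ := hx; simp [homProj_cls, h]
  | zero => simp
  | add x y _ _ hx hy => simp [hx, hy]
  | smul c x _ hx => simp [hx]

/-- The projections `homProj` separate the degrees. They are well defined because isotopies and
relations are homogeneous. -/
theorem isInternal_homDeg (s t : Word n) : DirectSum.IsInternal (homDeg k s t) := by
  rw [DirectSum.isInternal_submodule_iff_iSupIndep_and_iSup_eq_top]
  refine ⟨?_, ?_⟩
  · rw [iSupIndep_def]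
    intro m
    rw [Submodule.disjoint_def]
    intro x hx hx'
    have h0 : (⨆ j, ⨆ (_ : j ≠ m), homDeg k s t j) ≤ LinearMap.ker (homProj k s t m) :=
      iSup₂_le fun j hj y hy => homProj_of_mem_ne hj hy
    rw [← homProj_of_mem hx]
    exact h0 hx'
  · rw [eq_top_iff, ← span_cls, Submodule.span_le]
    rintro _ ⟨D, rfl⟩
    exact Submodule.mem_iSup_of_mem D.degree (cls_mem_homDeg rfl)

/-! ### Homogeneous operators -/

/-- The operators of morphisms of degree `m`. -/
noncomputable def Dg (k : Type*) [Field k] {n : ℕ} (s t : Word n) (m : ℤ) :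
    Submodule k (Alg k n) :=
  (homDeg k s t m).map emb

theorem op_mem_Dg {s t : Word n} {m : ℤ} {D : Diag s t} (h : D.degree = m) :
    op k D ∈ Dg k s t m :=
  Submodule.mem_map_of_mem (cls_mem_homDeg h)

theorem G_mem_Dg {s t l a b r : Word n} {g : Gen n a b} {m : ℤ} (hs : s = l ++ a ++ r)
    (ht : t = l ++ b ++ r) (h : g.degree = m) : G k l g r ∈ Dg k s t m := by
  subst hs ht; exact op_mem_Dg (by simp [h])

theorem Dg_eq_span (s t : Word n) (m : ℤ) :
    Dg k s t m = Submodule.span k {X | ∃ D : Diag s t, D.degree = m ∧ X = op k D} := by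
  rw [Dg, homDeg, Submodule.map_span]
  congr 1
  ext X
  constructor
  · rintro ⟨_, ⟨D, h, rfl⟩, rfl⟩; exact ⟨D, h, rfl⟩
  · rintro ⟨D, h, rfl⟩; exact ⟨_, ⟨D, h, rfl⟩, rfl⟩

theorem mul_mem_Dg {s t u : Word n} {m m' m'' : ℤ} {X Y : Alg k n} (hY : Y ∈ Dg k t u m')
    (hX : X ∈ Dg k s t m) (h : m + m' = m'') : Y * X ∈ Dg k s u m'' := by
  subst h
  rw [Dg_eq_span] at hX hY
  induction hX using Submodule.span_induction with
  | mem X hX =>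
    obtain ⟨D, rfl, rfl⟩ := hX
    induction hY using Submodule.span_induction with
    | mem Y hY =>
      obtain ⟨D', rfl, rfl⟩ := hY
      rw [← op_comp]
      exact op_mem_Dg (by simp)
    | zero => simp
    | add x y _ _ hx hy => rw [add_mul]; exact add_mem hx hy
    | smul c x _ hx => rw [smul_mul_assoc]; exact Submodule.smul_mem _ _ hx
  | zero => simp
  | add x y _ _ hx hy => rw [mul_add]; exact add_mem hx hy
  | smul c x _ hx => rw [mul_smul_comm]; exact Submodule.smul_mem _ _ hx

theorem F_mem_Dg {w l r : Word n} (i : Fin n) (h : w = l ++ r) : F k l i r ∈ Dg k w w 2 :=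
  mul_mem_Dg (G_mem_Dg (t := w) (s := l ++ i :: r) (by simp) (by simp [h]) rfl)
    (G_mem_Dg (by simp [h]) (by simp) rfl) (by simp [Gen.degree])

theorem E_mul_of_mem_Dg {s t : Word n} {m : ℤ} {X : Alg k n} (hX : X ∈ Dg k s t m) :
    E k t * X = X := by
  rw [Dg_eq_span] at hX
  induction hX using Submodule.span_induction with
  | mem X hX => obtain ⟨D, -, rfl⟩ := hX; exact E_mul_op D
  | zero => simp
  | add x y _ _ hx hy => rw [mul_add, hx, hy]
  | smul c x _ hx => rw [mul_smul_comm, hx]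

/-- Left multiplication between homogeneous components. -/
noncomputable def mulDg {t u : Word n} {A : Alg k n} {d : ℤ} (hA : A ∈ Dg k t u d) (s : Word n)
    {m m' : ℤ} (h : m + d = m') : Dg k s t m →ₗ[k] Dg k s u m' :=
  (LinearMap.mulLeft k A).restrict fun _ hX => mul_mem_Dg hA hX h

@[simp] theorem mulDg_coe {t u : Word n} {A : Alg k n} {d : ℤ} (hA : A ∈ Dg k t u d) (s : Word n)
    {m m' : ℤ} (h : m + d = m') (X : Dg k s t m) : (mulDg hA s h X : Alg k n) = A * X := rfl

noncomputable def homDegEquivDg (s t : Word n) (m : ℤ) : homDeg k s t m ≃ₗ[k] Dg k s t m :=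
  Submodule.equivMapOfInjective emb emb_injective _

/-- Isomorphic objects have isomorphic morphism spaces. -/
theorem nonempty_equiv_of_inverse {t u : Word n} {A B : Alg k n} (hA : A ∈ Dg k t u 0)
    (hB : B ∈ Dg k u t 0) (h₁ : B * A = E k t) (h₂ : A * B = E k u) (s : Word n) (m : ℤ) :
    Nonempty (homDeg k s t m ≃ₗ[k] homDeg k s u m) := by
  refine ⟨homDegEquivDg s t m ≪≫ₗ LinearEquiv.ofLinearMap (mulDg hA s (add_zero m))
    (mulDg hB s (add_zero m)) ?_ ?_ ≪≫ₗ (homDegEquivDg s u m).symm⟩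
  · ext X
    simp [← mul_assoc, h₂, E_mul_of_mem_Dg X.2]
  · ext X
    simp [← mul_assoc, h₁, E_mul_of_mem_Dg X.2]

/-- A decomposition of an object gives a decomposition of morphism spaces. -/
theorem nonempty_equiv_prod {t u : Word n} {p₁ p₂ q₁ q₂ : Alg k n}
    (hp₁ : p₁ ∈ Dg k t u 1) (hp₂ : p₂ ∈ Dg k t u (-1)) (hq₁ : q₁ ∈ Dg k u t (-1))
    (hq₂ : q₂ ∈ Dg k u t 1) (h₁₁ : p₁ * q₁ = E k u) (h₂₂ : p₂ * q₂ = E k u)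
    (h₁₂ : p₁ * q₂ = 0) (h₂₁ : p₂ * q₁ = 0) (h : q₁ * p₁ + q₂ * p₂ = E k t)
    (s : Word n) (m : ℤ) :
    Nonempty (homDeg k s t m ≃ₗ[k] homDeg k s u (m + 1) × homDeg k s u (m - 1)) := by
  refine ⟨homDegEquivDg s t m ≪≫ₗ LinearEquiv.ofLinearMap
    ((mulDg hp₁ s (m' := m + 1) rfl).prod (mulDg hp₂ s (m' := m - 1) rfl))
    ((mulDg hq₁ s (m' := m) (by ring)).coprod (mulDg hq₂ s (m' := m) (by ring))) ?_ ?_ ≪≫ₗ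
    ((homDegEquivDg s u _).prodCongr (homDegEquivDg s u _)).symm⟩
  · refine LinearMap.ext fun X => Prod.ext (Subtype.ext ?_) (Subtype.ext ?_)
    · simp [← mul_assoc, h₁₁, h₁₂, E_mul_of_mem_Dg X.1.2]
    · simp [← mul_assoc, h₂₂, h₂₁, E_mul_of_mem_Dg X.2.2]
  · refine LinearMap.ext fun X => Subtype.ext ?_
    have : q₁ * (p₁ * X) + q₂ * (p₂ * X) = (X : Alg k n) := by
      rw [← mul_assoc, ← mul_assoc, ← add_mul, h, E_mul_of_mem_Dg X.2]
    simpa using this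

end Grading

end TLCat

namespace TLCat

open Diag

/-! ### Isomorphisms of objects -/

section Isomorphisms

variable {k : Type*} [Field k] {n : ℕ} (l r : Word n)

/-- Sliding `f_i` to the right out of the bubble leaves an empty bubble, which vanishes, plus twice
a broken line, which opens the bubble into a line. -/
theorem merge_F_split (i : Fin n) : G k l (.merge i) r * (F k (l ++ [i]) i (i :: r) *
    G k l (.split i) r) = (2 : k) • E k (l ++ i :: r) := by
  have e1 := F_same (k := k) (l ++ [i]) r i
  have e2 := G_comm_F (k := k) l [] r i (.merge i)
  have e3 := merge_dot_right (k := k) l r i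
  have e4 := endDot_split_right (k := k) l r i
  simp only [List.append_nil, List.nil_append, List.cons_append, List.append_assoc] at e1 e2
  rw [eq_sub_of_add_eq e1, sub_mul, mul_sub, ← mul_assoc _ (F k _ i r), ← e2, mul_assoc _ _
    (G k l (.split i) r), merge_split, mul_zero, sub_zero, smul_mul_assoc, mul_smul_comm, Br,
    mul_assoc, ← mul_assoc (G k l (.merge i) r), e3, e4, E_mul_E]

/-- Slide one `f_i` out to the right: opening the bubble contributes `2 f_i`, and the bubble with
the remaining `f_i` contributes `-2 f_i`. -/
theorem merge_F_F_split (i : Fin n) : G k l (.merge i) r * (F k (l ++ [i]) i (i :: r) *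
    (F k (l ++ [i]) i (i :: r) * G k l (.split i) r)) = 0 := by
  have e1 := F_same (k := k) (l ++ [i]) r i
  have e2 := G_comm_F (k := k) l [] r i (.merge i)
  have e3 := merge_dot_right (k := k) l r i
  have e4 := endDot_split_right (k := k) l r i
  have e5 := F_comm_G (k := k) (l ++ [i]) [] r i (.endDot i)
  have e6 := merge_F_split (k := k) l r i
  simp only [List.append_nil, List.nil_append, List.cons_append, List.append_assoc] at e1 e2 e5
  conv_lhs => rw [eq_sub_of_add_eq e1, sub_mul, mul_sub, ← mul_assoc _ (F k (l ++ [i, i]) i r),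
    ← e2, mul_assoc (F k (l ++ [i]) i r)]
  rw [← eq_sub_of_add_eq e1, e6, smul_mul_assoc, mul_smul_comm, Br, mul_assoc,
    ← mul_assoc (G k (l ++ [i]) (.endDot i) r), e5, mul_assoc, e4, ← mul_assoc, e3,
    mul_smul_comm, ← smul_sub]
  have hw : F k (l ++ [i]) i r ∈ Dg k (l ++ i :: r) (l ++ i :: r) 2 := F_mem_Dg i (by simp)
  rw [E_mul_of_mem_Dg (mul_mem_Dg hw (op_mem_Dg (D := .nil (l ++ i :: r)) rfl) rfl : F k (l ++ [i]) i r * E k (l ++ i :: r) ∈ _), sub_self, smul_zero]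

/-- After `I = H` the two terms have `f_i` on the two sides of the middle strand. Their sum is twice
the broken strand, whose dots cancel both vertices. -/
theorem split_merge_F_add (i : Fin n) :
    G k l (.split i) r * (G k l (.merge i) r * F k (l ++ [i]) i (i :: r)) +
      F k (l ++ [i]) i (i :: r) * (G k l (.split i) r * G k l (.merge i) r) =
      (2 : k) • E k (l ++ i :: i :: r) := by
  have e0 := split_merge (k := k) l r i
  have e1 := F_same (k := k) (l ++ [i]) (i :: r) i
  have e2 := F_comm_G (k := k) (l ++ [i]) [] r i (.merge i)
  have e3 := merge_dot_left (k := k) (l ++ [i]) r i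
  have e4 := endDot_split_right (k := k) l (i :: r) i
  have e5 := G_comm_F (k := k) l [] (i :: r) i (.split i)
  simp only [List.append_nil, List.nil_append, List.cons_append, List.append_assoc] at e1 e2 e3 e5
  rw [← mul_assoc, e0, mul_assoc, ← e5, ← mul_assoc, ← mul_assoc, ← e2, mul_assoc, mul_assoc,
    ← mul_add, ← add_mul, add_comm (F k (l ++ [i, i]) _ _), e1, smul_mul_assoc, mul_smul_comm, Br,
    mul_assoc, e4, ← mul_assoc, e3, E_mul_E]

/-- As for equal colours, but now the broken line enters with coefficient `-1`. -/
theorem merge_F_split_of_adjacent {i j : Fin n} (h : Adjacent i j) :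
    G k l (.merge i) r * (F k (l ++ [i]) j (i :: r) * G k l (.split i) r) = -E k (l ++ i :: r) := by
  have e1 := F_near (k := k) (l ++ [i]) r h
  have e2 := G_comm_F (k := k) l [] r i (.merge i)
  have e2' := G_comm_F (k := k) l [] r j (.merge i)
  have e3 := merge_dot_right (k := k) l r i
  have e4 := endDot_split_right (k := k) l r i
  simp only [List.append_nil, List.nil_append, List.cons_append, List.append_assoc] at e1 e2 e2'
  rw [e1, sub_mul, mul_sub, add_mul, mul_add, ← mul_assoc _ (F k _ i r), ← e2,
    ← mul_assoc _ (F k _ j r), ← e2', mul_assoc _ _ (G k l (.split i) r), mul_assoc _ _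
    (G k l (.split i) r), merge_split, mul_zero, mul_zero, zero_add, Br,
    mul_assoc, ← mul_assoc (G k l (.merge i) r), e3, e4, E_mul_E, zero_sub]

/-- Place the relation `switch` between two `i`-lines and merge its outer `i`-legs into them. One
side becomes the identity of `iji`, the other factors through `i` by `I = H`. -/
theorem dot_split_merge_endDot {i j : Fin n} (h : Adjacent i j) :
    G k (l ++ [i]) (.startDot j) (i :: r) * (G k l (.split i) r * (G k l (.merge i) r *
      G k (l ++ [i]) (.endDot j) (i :: r))) = -E k (l ++ i :: j :: i :: r) := by
  have e1 := switch (k := k) (l ++ [i]) (i :: r) h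
  have e2 := G_comm (k := k) l [j] (i :: r) (.merge i) (.startDot i)
  have e3 := merge_dot_right (k := k) l (j :: i :: r) i
  have e4 := merge_dot_left (k := k) (l ++ [i, j]) r i
  have e5 := G_comm (k := k) l [] (i :: i :: r) (.merge i) (.startDot j)
  have e6 := G_comm (k := k) (l ++ [i]) [] r (.startDot j) (.merge i)
  have e7 := merge_cup_right (k := k) l (i :: r) i
  have e8 := split_merge (k := k) l r i
  simp only [List.append_nil, List.nil_append, List.cons_append, List.append_assoc]
    at e1 e2 e4 e5 e6
  have e := congrArg (fun X => G k (l ++ [i, j]) (.merge i) r *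
    (G k l (.merge i) (j :: i :: i :: r) * X)) e1
  simp only [mul_neg] at e
  rw [← mul_assoc (G k l (.merge i) _), ← e2, mul_assoc, e3, G_mul_E (by simp), e4,
    ← mul_assoc (G k l (.merge i) _), ← e5, mul_assoc, ← mul_assoc (G k (l ++ [i, j]) _ _),
    e6, mul_assoc, ← mul_assoc (G k l (.merge i) _), e7, ← mul_assoc (G k (l ++ [i]) (.merge i) r),
    ← e8, mul_assoc] at e
  rw [eq_neg_iff_add_eq_zero, ← neg_eq_zero, neg_add, ← e, add_neg_cancel]

/-- `ii ≅ i{1} ⊕ i{-1}`. -/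
theorem nonempty_equiv_double (h2 : (2 : k) ≠ 0) (i : Fin n) (s : Word n) (m : ℤ) :
    Nonempty (homDeg k s (l ++ i :: i :: r) m ≃ₗ[k]
      homDeg k s (l ++ i :: r) (m + 1) × homDeg k s (l ++ i :: r) (m - 1)) := by
  have hM : G k l (.merge i) r ∈ Dg k (l ++ i :: i :: r) (l ++ i :: r) (-1) :=
    G_mem_Dg (by simp) (by simp) rfl
  have hS : G k l (.split i) r ∈ Dg k (l ++ i :: r) (l ++ i :: i :: r) (-1) :=
    G_mem_Dg (by simp) (by simp) rfl
  have hF : F k (l ++ [i]) i (i :: r) ∈ Dg k (l ++ i :: i :: r) (l ++ i :: i :: r) 2 :=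
    F_mem_Dg i (by simp)
  -- A bubble of colour `i` is `0` when empty, `2` with one `f_i` and `0` with `f_i ^ 2` inside.
  -- With the factors `1/2`, the merges and splittings with and without `f_i` are thus dual to each
  -- other.
  refine nonempty_equiv_prod
    (p₁ := (2 : k)⁻¹ • (G k l (.merge i) r * F k (l ++ [i]) i (i :: r)))
    (p₂ := G k l (.merge i) r) (q₁ := G k l (.split i) r)
    (q₂ := (2 : k)⁻¹ • (F k (l ++ [i]) i (i :: r) * G k l (.split i) r))
    (Submodule.smul_mem _ _ (mul_mem_Dg hM hF rfl)) hM hS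
    (Submodule.smul_mem _ _ (mul_mem_Dg hF hS rfl)) ?_ ?_ ?_ ?_ ?_ s m
  · rw [smul_mul_assoc, mul_assoc, merge_F_split, smul_smul, inv_mul_cancel₀ h2, one_smul]
  · rw [mul_smul_comm, merge_F_split, smul_smul, inv_mul_cancel₀ h2, one_smul]
  · rw [smul_mul_assoc, mul_smul_comm, mul_assoc, merge_F_F_split, smul_zero, smul_zero]
  · exact merge_split l r i
  · rw [smul_mul_assoc, mul_smul_comm, ← smul_add, mul_assoc (F k _ _ _), split_merge_F_add,
      smul_smul, inv_mul_cancel₀ h2, one_smul]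

/-- `iji ≅ i` for adjacent colours. -/
theorem nonempty_equiv_sandwich {i j : Fin n} (h : Adjacent i j) (s : Word n) (m : ℤ) :
    Nonempty (homDeg k s (l ++ i :: j :: i :: r) m ≃ₗ[k] homDeg k s (l ++ i :: r) m) := by
  have hM : G k l (.merge i) r ∈ Dg k (l ++ i :: i :: r) (l ++ i :: r) (-1) :=
    G_mem_Dg (by simp) (by simp) rfl
  have hS : G k l (.split i) r ∈ Dg k (l ++ i :: r) (l ++ i :: i :: r) (-1) :=
    G_mem_Dg (by simp) (by simp) rfl
  have hD : G k (l ++ [i]) (.startDot j) (i :: r) ∈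
      Dg k (l ++ i :: i :: r) (l ++ i :: j :: i :: r) 1 :=
    G_mem_Dg (by simp) (by simp) rfl
  have hD' : G k (l ++ [i]) (.endDot j) (i :: r) ∈
      Dg k (l ++ i :: j :: i :: r) (l ++ i :: i :: r) 1 :=
    G_mem_Dg (by simp) (by simp) rfl
  refine nonempty_equiv_of_inverse
    (A := -(G k l (.merge i) r * G k (l ++ [i]) (.endDot j) (i :: r)))
    (B := G k (l ++ [i]) (.startDot j) (i :: r) * G k l (.split i) r)
    (neg_mem (mul_mem_Dg hM hD' rfl)) (mul_mem_Dg hD hS rfl) ?_ ?_ s m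
  · rw [mul_neg, mul_assoc, dot_split_merge_endDot l r h, neg_neg]
  · have := merge_F_split_of_adjacent (k := k) l r h
    rw [F, mul_assoc] at this
    rw [neg_mul, mul_assoc, this, neg_neg]

/-- `ij ≅ ji` for distant colours. -/
theorem nonempty_equiv_swap {i j : Fin n} (h : Distant i j) (s : Word n) (m : ℤ) :
    Nonempty (homDeg k s (l ++ i :: j :: r) m ≃ₗ[k] homDeg k s (l ++ j :: i :: r) m) :=
  nonempty_equiv_of_inverse (A := G k l (.cross i j h) r) (B := G k l (.cross j i h.symm) r)
    (G_mem_Dg (by simp) (by simp) rfl) (G_mem_Dg (by simp) (by simp) rfl)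
    (cross_cross l r h h.symm) (cross_cross l r h.symm h) s m

end Isomorphisms

/-! ### Adjunctions -/

section Adjunctions

variable {k : Type*} [Field k] {n : ℕ}

/-- Transport of morphisms along equalities of their end points. -/
noncomputable def hcast {s t s' t' : Word n} (hs : s = s') (ht : t = t') :
    HOM k s t →ₗ[k] HOM k s' t' := by
  subst hs ht; exact LinearMap.id

@[simp] theorem hcast_cls {s t s' t' : Word n} (hs : s = s') (ht : t = t') (D : Diag s t) :
    hcast hs ht (cls k D) = cls k (D.cast hs ht) := by
  subst hs ht; rfl

variable {j : Fin n} {x y : Word n}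

/-- Bending the first strand of the target to the source. -/
def unbendLeft (z : Diag x (j :: y)) : Diag (j :: x) y :=
  (consStrand j z).comp (Diag.step [] (.cap j) y rfl rfl)

/-- Bending the last strand of the target to the source. -/
def unbendRight (z : Diag x (y ++ [j])) : Diag (x ++ [j]) y :=
  (snocStrand j z).comp (Diag.step y (.cap j) [] (by simp) (by simp))

theorem cls_unbendLeft_bendLeft (z : Diag (j :: x) y) :
    cls k (unbendLeft (bendLeft z)) = cls k z := by
  refine emb_injective ?_
  change op k _ = op k _
  have e1 := G_comm_T (k := k) [] [] [] (.cap j) z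
  have e2 := zigzag_left (k := k) [] x j
  have e3 := T_mul_E (k := k) (w := j :: x) (l := []) (r := []) (D := z) (by simp)
  simp only [List.append_nil, List.nil_append] at e1 e2
  rw [op_eq_T, op_eq_T, unbendLeft, T_comp, T_step, T_consStrand, T_bendLeft]
  simp only [List.append_nil, List.nil_append, List.cons_append]
  rw [← mul_assoc, ← e1, mul_assoc, e2, e3]

theorem cls_bendLeft_unbendLeft (z : Diag x (j :: y)) :
    cls k (bendLeft (unbendLeft z)) = cls k z := by
  refine emb_injective ?_
  change op k _ = op k _
  have e1 := G_comm_T (k := k) [] [] [] (.cup j) z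
  have e2 := zigzag_right (k := k) [] y j
  have e3 := E_mul_T (k := k) (w := j :: y) (l := []) (r := []) (D := z) (by simp)
  simp only [List.append_nil, List.nil_append] at e1 e2
  rw [op_eq_T, op_eq_T, T_bendLeft, unbendLeft, T_comp, T_step, T_consStrand]
  simp only [List.append_nil, List.nil_append, List.cons_append]
  rw [mul_assoc, e1, ← mul_assoc, e2, e3]

theorem cls_unbendRight_bendRight (z : Diag (x ++ [j]) y) :
    cls k (unbendRight (bendRight z)) = cls k z := by
  refine emb_injective ?_
  change op k _ = op k _
  have e1 := T_comm_G (k := k) [] [] [] z (.cap j)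
  have e2 := zigzag_right (k := k) x [] j
  have e3 := T_mul_E (k := k) (w := x ++ [j]) (l := []) (r := []) (D := z) (by simp)
  simp only [List.append_nil, List.nil_append] at e1 e2
  rw [op_eq_T, op_eq_T, unbendRight, T_comp, T_step, T_snocStrand, T_bendRight]
  simp only [List.append_nil, List.nil_append]
  rw [← mul_assoc, e1, mul_assoc, e2, e3]

theorem cls_bendRight_unbendRight (z : Diag x (y ++ [j])) :
    cls k (bendRight (unbendRight z)) = cls k z := by
  refine emb_injective ?_
  change op k _ = op k _
  have e1 := T_comm_G (k := k) [] [] [] z (.cup j)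
  have e2 := zigzag_left (k := k) y [] j
  have e3 := E_mul_T (k := k) (w := y ++ [j]) (l := []) (r := []) (D := z) (by simp)
  simp only [List.append_nil, List.nil_append] at e1 e2
  rw [op_eq_T, op_eq_T, T_bendRight, unbendRight, T_comp, T_step, T_snocStrand]
  simp only [List.nil_append]
  rw [mul_assoc, ← e1, ← mul_assoc, e2, e3]

/-- Linear maps given by mutually inverse operations on diagrams that preserve degrees restrict to
isomorphisms of homogeneous components. -/
theorem nonempty_equiv_of_maps {s t s' t' : Word n} (f : HOM k s t →ₗ[k] HOM k s' t')
    (g : HOM k s' t' →ₗ[k] HOM k s t) (F : Diag s t → Diag s' t') (F' : Diag s' t' → Diag s t)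
    (hf : ∀ D, f (cls k D) = cls k (F D)) (hg : ∀ D, g (cls k D) = cls k (F' D))
    (hF : ∀ D, (F D).degree = D.degree) (hF' : ∀ D, (F' D).degree = D.degree)
    (h₁ : ∀ D, cls k (F' (F D)) = cls k D) (h₂ : ∀ D, cls k (F (F' D)) = cls k D) (m : ℤ) :
    Nonempty (homDeg k s t m ≃ₗ[k] homDeg k s' t' m) := by
  have hgf : g ∘ₗ f = LinearMap.id := hom_ext fun D => by simp [hf, hg, h₁]
  have hfg : f ∘ₗ g = LinearMap.id := hom_ext fun D => by simp [hf, hg, h₂]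
  have hfm : ∀ X ∈ homDeg k s t m, f X ∈ homDeg k s' t' m := by
    have : homDeg k s t m ≤ (homDeg k s' t' m).comap f := by
      refine Submodule.span_le.2 ?_
      rintro _ ⟨D, hD, rfl⟩
      rw [SetLike.mem_coe, Submodule.mem_comap, hf]; exact cls_mem_homDeg (by rw [hF, hD])
    exact this
  have hgm : ∀ X ∈ homDeg k s' t' m, g X ∈ homDeg k s t m := by
    have : homDeg k s' t' m ≤ (homDeg k s t m).comap g := by
      refine Submodule.span_le.2 ?_
      rintro _ ⟨D, hD, rfl⟩
      rw [SetLike.mem_coe, Submodule.mem_comap, hg]; exact cls_mem_homDeg (by rw [hF', hD])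
    exact this
  refine ⟨LinearEquiv.ofLinearMap (f.restrict hfm) (g.restrict hgm) ?_ ?_⟩
  · exact LinearMap.ext fun X => Subtype.ext (LinearMap.congr_fun hfg X)
  · exact LinearMap.ext fun X => Subtype.ext (LinearMap.congr_fun hgf X)

variable (j x y)

theorem nonempty_equiv_bendLeft (m : ℤ) :
    Nonempty (homDeg k (j :: x) y m ≃ₗ[k] homDeg k x (j :: y) m) := by
  refine nonempty_equiv_of_maps (s := j :: x) (t := y) (s' := x) (t' := j :: y)
    (hcomp (cls k (Diag.step (s := x) (t := j :: j :: x) [] (.cup j) x rfl rfl)) ∘ₗ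
      hcast (by simp) (by simp) ∘ₗ hwhisker [j] [])
    (hcomp.flip (cls k (Diag.step (s := j :: j :: y) (t := y) [] (.cap j) y rfl rfl)) ∘ₗ
      hcast (by simp) (by simp) ∘ₗ hwhisker [j] [])
    bendLeft unbendLeft ?_ ?_ ?_ ?_ cls_unbendLeft_bendLeft cls_bendLeft_unbendLeft m
  · intro D
    rw [LinearMap.comp_apply, LinearMap.comp_apply, hwhisker_cls, hcast_cls, hcomp_cls]; rfl
  · intro D
    rw [LinearMap.comp_apply, LinearMap.comp_apply, hwhisker_cls, hcast_cls, LinearMap.flip_apply,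
      hcomp_cls]
    rfl
  · intro D; simp [bendLeft, consStrand, Gen.degree]
  · intro D; simp [unbendLeft, consStrand, Gen.degree]

theorem nonempty_equiv_bendRight (m : ℤ) :
    Nonempty (homDeg k (x ++ [j]) y m ≃ₗ[k] homDeg k x (y ++ [j]) m) := by
  refine nonempty_equiv_of_maps (s := x ++ [j]) (t := y) (s' := x) (t' := y ++ [j])
    (hcomp (cls k (Diag.step (s := x) (t := x ++ [j] ++ [j]) x (.cup j) [] (by simp) (by simp))) ∘ₗ
      hcast (by simp) (by simp) ∘ₗ hwhisker [] [j])
    (hcomp.flip (cls k (Diag.step (s := y ++ [j] ++ [j]) (t := y) y (.cap j) [] (by simp) (by simp))) ∘ₗ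
      hcast (by simp) (by simp) ∘ₗ hwhisker [] [j])
    bendRight unbendRight ?_ ?_ ?_ ?_ cls_unbendRight_bendRight cls_bendRight_unbendRight m
  · intro D
    rw [LinearMap.comp_apply, LinearMap.comp_apply, hwhisker_cls, hcast_cls, hcomp_cls]; rfl
  · intro D
    rw [LinearMap.comp_apply, LinearMap.comp_apply, hwhisker_cls, hcast_cls, LinearMap.flip_apply,
      hcomp_cls]
    rfl
  · intro D; simp [bendRight, snocStrand, Gen.degree]
  · intro D; simp [unbendRight, snocStrand, Gen.degree]

/-- The first strand is bent down on the left, so that the source becomes `[j]`, and then bent up on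
the right. -/
theorem nonempty_equiv_rotate (m : ℤ) :
    Nonempty (homDeg k [] (j :: y) m ≃ₗ[k] homDeg k [] (y ++ [j]) m) := by
  obtain ⟨e⟩ := nonempty_equiv_bendLeft (k := k) j [] y m
  obtain ⟨e'⟩ := nonempty_equiv_bendRight (k := k) j [] y m
  exact ⟨e.symm ≪≫ₗ e'⟩

theorem nonempty_equiv_reverse (m : ℤ) :
    Nonempty (homDeg k x y m ≃ₗ[k] homDeg k [] (x.reverse ++ y) m) := by
  induction x generalizing y with
  | nil => exact ⟨LinearEquiv.refl k _⟩
  | cons j x ih =>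
    obtain ⟨e⟩ := nonempty_equiv_bendLeft (k := k) j x y m
    obtain ⟨e'⟩ := ih (j :: y)
    have : (j :: x).reverse ++ y = x.reverse ++ (j :: y) := by simp
    rw [this]
    exact ⟨e ≪≫ₗ e'⟩

end Adjunctions

end TLCat

namespace TLCat

open Diag

/-! ### The annihilator of `phi w` -/

section Annihilator

variable {k : Type*} [Field k] {n : ℕ}

theorem polyMap_monomial (w : Word n) (e : Fin n →₀ ℕ) :
    polyMap k w (MvPolynomial.monomial e 1) = cls k ((doubleDots e).comp (phi w)) := by
  rw [polyMap, ← Module.Basis.constr_basis (MvPolynomial.basisMonomials (Fin n) k) k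
    (fun e => cls k ((doubleDots e).comp (phi w))) e, MvPolynomial.coe_basisMonomials]

/-- The operator of a polynomial in double dots. -/
noncomputable def polyOp (k : Type*) [Field k] (n : ℕ) :
    MvPolynomial (Fin n) k →ₗ[k] Alg k n := emb ∘ₗ polyMap k []

theorem polyOp_monomial (e : Fin n →₀ ℕ) :
    polyOp k n (MvPolynomial.monomial e 1) = op k (doubleDots e) := by
  rw [polyOp, LinearMap.comp_apply, polyMap_monomial, phi, comp_nil]; rfl

theorem mvPolynomial_hom_ext {M : Type*} [AddCommGroup M] [Module k M]
    {f g : MvPolynomial (Fin n) k →ₗ[k] M}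
    (h : ∀ e, f (MvPolynomial.monomial e 1) = g (MvPolynomial.monomial e 1)) : f = g :=
  (MvPolynomial.basisMonomials (Fin n) k).ext fun e => by
    simpa [MvPolynomial.coe_basisMonomials] using h e

theorem emb_polyMap (w : Word n) (p : MvPolynomial (Fin n) k) :
    emb (polyMap k w p) = op k (phi w) * polyOp k n p := by
  have : emb ∘ₗ polyMap k w = LinearMap.mulLeft k (op k (phi w)) ∘ₗ polyOp k n := by
    refine mvPolynomial_hom_ext fun e => ?_
    rw [LinearMap.comp_apply, LinearMap.comp_apply, polyMap_monomial, polyOp_monomial,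
      LinearMap.mulLeft_apply, ← op_comp]
    rfl
  exact LinearMap.congr_fun this p

theorem polyOp_X_mul (j : Fin n) (p : MvPolynomial (Fin n) k) :
    polyOp k n (MvPolynomial.X j * p) = F k [] j [] * polyOp k n p := by
  have : polyOp k n ∘ₗ LinearMap.mulLeft k (MvPolynomial.X j) =
      LinearMap.mulLeft k (F k [] j []) ∘ₗ polyOp k n := by
    refine mvPolynomial_hom_ext fun e => ?_
    simp only [LinearMap.comp_apply, LinearMap.mulLeft_apply]
    rw [MvPolynomial.X, MvPolynomial.monomial_mul, one_mul, add_comm, polyOp_monomial,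
      op_doubleDots_add, polyOp_monomial]
  exact LinearMap.congr_fun this p

theorem polyOp_one : polyOp k n 1 = E k [] := by
  rw [← op_doubleDots_zero, ← polyOp_monomial]; rfl

theorem polyOp_X (j : Fin n) : polyOp k n (MvPolynomial.X j) = F k [] j [] := by
  rw [← mul_one (MvPolynomial.X j), polyOp_X_mul, polyOp_one, F, mul_assoc, G_mul_E (by simp)]

theorem polyMap_eq_zero_iff (w : Word n) (p : MvPolynomial (Fin n) k) :
    polyMap k w p = 0 ↔ op k (phi w) * polyOp k n p = 0 := by
  rw [← emb_polyMap, ← emb_inj (k := k), map_zero]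

theorem phi_mul_F (w : Word n) (j : Fin n) :
    op k (phi w) * F k [] j [] = F k [] j w * op k (phi w) := by
  have := T_comm (k := k) [] [] [] (doubleDot j) (phi w)
  simpa [T_doubleDot, ← op_eq_T] using this

/-- The polynomials `p` with `p · phi w = 0`. -/
noncomputable def annIdeal (k : Type*) [Field k] {n : ℕ} (w : Word n) :
    Ideal (MvPolynomial (Fin n) k) where
  carrier := {p | polyMap k w p = 0}
  add_mem' := by
    intro p q hp hq
    rw [Set.mem_ofPred_eq] at hp hq ⊢
    rw [map_add, hp, hq, add_zero]
  zero_mem' := map_zero _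
  smul_mem' := by
    intro q p hp
    rw [Set.mem_ofPred_eq] at hp ⊢
    rw [smul_eq_mul]
    induction q using MvPolynomial.induction_on with
    | C c => rw [MvPolynomial.C_mul', map_smul, hp, smul_zero]
    | add q q' hq hq' => rw [add_mul, map_add, hq, hq', add_zero]
    | mul_X q j hq =>
      rw [polyMap_eq_zero_iff] at hq ⊢
      rw [mul_comm q, mul_assoc, polyOp_X_mul, ← mul_assoc, phi_mul_F, mul_assoc, hq, mul_zero]

theorem mem_annIdeal {w : Word n} {p : MvPolynomial (Fin n) k} :
    p ∈ annIdeal k w ↔ polyMap k w p = 0 := Iff.rfl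

theorem mem_annIdeal_iff {w : Word n} {p : MvPolynomial (Fin n) k} :
    p ∈ annIdeal k w ↔ op k (phi w) * polyOp k n p = 0 := polyMap_eq_zero_iff w p

theorem op_phi_insert (l r : Word n) (j : Fin n) :
    op k (phi (l ++ j :: r)) = G k l (.startDot j) r * op k (phi (l ++ r)) := by
  induction l with
  | nil => rw [List.nil_append, phi, op_comp]; rfl
  | cons i l ih =>
    have e := G_comm (k := k) [] l r (.startDot i) (.startDot j)
    simp only [List.nil_append, List.cons_append] at e
    rw [List.cons_append, List.cons_append, phi, phi, op_comp, op_comp, ih]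
    change G k [] _ _ * _ = _ * (G k [] _ _ * _)
    rw [← mul_assoc, ← e, mul_assoc]

/-- Inserting a letter puts one more dot on top of `phi`, which preserves vanishing. -/
theorem annIdeal_le_insert (l r : Word n) (j : Fin n) :
    annIdeal k (l ++ r) ≤ annIdeal k (l ++ j :: r) := by
  intro p hp
  rw [mem_annIdeal_iff] at hp ⊢
  rw [op_phi_insert, mul_assoc, hp, mul_zero]

/-- The strands of `phi` end in dots, so a double dot passes beneath them and no dot-forcing
relation is needed. -/
theorem F_mul_phi (l r : Word n) (j : Fin n) :
    F k l j r * op k (phi (l ++ r)) = op k (phi (l ++ r)) * F k [] j [] := by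
  induction l with
  | nil => exact (phi_mul_F r j).symm
  | cons i l ih =>
    have e := G_comm_F (k := k) [] l r j (.startDot i)
    simp only [List.nil_append, List.cons_append] at e
    rw [List.cons_append, phi, op_comp]
    change _ * (G k [] _ _ * _) = G k [] _ _ * _ * _
    rw [← mul_assoc, e, mul_assoc, mul_assoc, ih]

/-- Ending the strand `j` turns its dot into a double dot, which moves to the outer region and acts
as `f_j`. -/
theorem X_mul_mem_annIdeal {l r : Word n} {j : Fin n} {p : MvPolynomial (Fin n) k}
    (hp : p ∈ annIdeal k (l ++ j :: r)) : MvPolynomial.X j * p ∈ annIdeal k (l ++ r) := by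
  rw [mem_annIdeal_iff] at hp ⊢
  rw [polyOp_X_mul, ← mul_assoc, ← F_mul_phi, F, mul_assoc, mul_assoc,
    ← mul_assoc _ _ (polyOp k n p), ← op_phi_insert, hp, mul_zero]

theorem annIdeal_le_of_sublist {w w' : Word n} (h : w.Sublist w') (l : Word n) :
    annIdeal k (l ++ w) ≤ annIdeal k (l ++ w') := by
  induction h generalizing l with
  | slnil => exact le_rfl
  | cons a h ih => exact (ih l).trans (annIdeal_le_insert _ _ _)
  | cons_cons a h ih => simpa using ih (l ++ [a])

/-! ### Relations between two colours -/

/-- A linear combination of double dots. -/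
noncomputable def Flin (k : Type*) [Field k] {n : ℕ} (l r : Word n) : (Fin n → k) →ₗ[k] Alg k n :=
  ∑ c, (LinearMap.toSpanSingleton k _ (F k l c r)) ∘ₗ LinearMap.proj c

theorem Flin_apply (l r : Word n) (a : Fin n → k) : Flin k l r a = ∑ c, a c • F k l c r := by
  simp [Flin]

theorem Flin_single (l r : Word n) (c : Fin n) : Flin k l r (Pi.single c 1) = F k l c r := by
  rw [Flin_apply, Finset.sum_eq_single c]
  · simp
  · intro b _ hb; simp [hb]
  · simp

theorem G_mul_Flin (l m r : Word n) (a : Fin n → k) {x y : Word n} (g : Gen n x y) :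
    Flin k (l ++ (y ++ m)) r a * G k l g (m ++ r) =
      G k l g (m ++ r) * Flin k (l ++ (x ++ m)) r a := by
  simp only [Flin_apply, Finset.mul_sum, Finset.sum_mul, mul_smul_comm, smul_mul_assoc, G_comm_F]

theorem Flin_far (l r : Word n) {i : Fin n} {a : Fin n → k} (h : ∀ c, a c ≠ 0 → Distant i c) :
    Flin k l (i :: r) a = Flin k (l ++ [i]) r a := by
  simp only [Flin_apply]
  refine Finset.sum_congr rfl fun c _ => ?_
  by_cases hc : a c = 0
  · simp [hc]
  · rw [F_far l r (h c hc)]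

/-- The coefficients of `f_i + 2 f_{i+1} + ⋯ + 2 f_{j-1} + f_j`. -/
def yCoeff (k : Type*) [Field k] {n : ℕ} (i j c : Fin n) : k :=
  if c = i ∨ c = j then 1 else if i < c ∧ c < j then 2 else 0

theorem yCoeff_adjacent {i j : Fin n} (h : i.val + 1 = j.val) :
    yCoeff k i j = Pi.single i 1 + Pi.single j 1 := by
  funext c
  simp only [yCoeff, Pi.add_apply, Pi.single_apply, Fin.ext_iff, Fin.lt_def]
  split_ifs <;> first | omega | simp

theorem yCoeff_succ {i c j : Fin n} (h : i.val + 1 = c.val) (hj : c < j) :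
    yCoeff k i j = Pi.single i 1 + Pi.single c 1 + yCoeff k c j := by
  funext b
  rw [Fin.lt_def] at hj
  simp only [yCoeff, Pi.add_apply, Pi.single_apply, Fin.ext_iff, Fin.lt_def]
  split_ifs <;> first | omega | norm_num

/-- Slide one `f_c` out to the right. The terms `f_c + f_i` multiply the bubble with a single `f_c`,
which is `-1`, and the broken line contributes `-f_c`. -/
theorem merge_F_F_split_of_adjacent (l r : Word n) {i c : Fin n} (h : Adjacent i c) :
    G k l (.merge i) r * (F k (l ++ [i]) c (i :: r) * (F k (l ++ [i]) c (i :: r) *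
      G k l (.split i) r)) = -(F k (l ++ [i]) i r + (2 : k) • F k (l ++ [i]) c r) := by
  have e1 := F_near (k := k) (l ++ [i]) r h
  have e2 := G_comm_F (k := k) l [] r i (.merge i)
  have e2' := G_comm_F (k := k) l [] r c (.merge i)
  have e3 := merge_dot_right (k := k) l r i
  have e4 := endDot_split_right (k := k) l r i
  have e5 := F_comm_G (k := k) (l ++ [i]) [] r c (.endDot i)
  have e6 := merge_F_split_of_adjacent (k := k) l r h
  have hE : ∀ b : Fin n, F k (l ++ [i]) b r * E k (l ++ i :: r) = F k (l ++ [i]) b r := by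
    intro b; rw [F, mul_assoc, G_mul_E (by simp)]
  have hE' : E k (l ++ i :: r) * F k (l ++ [i]) c r = F k (l ++ [i]) c r := by
    rw [F, E_mul_G_mul (by simp)]
  simp only [List.append_nil, List.nil_append, List.cons_append, List.append_assoc]
    at e1 e2 e2' e5
  conv_lhs => rw [e1, sub_mul, mul_sub, add_mul, mul_add,
    ← mul_assoc (G k l (.merge i) r) (F k _ i r), ← e2,
    ← mul_assoc (G k l (.merge i) r) (F k _ c r), ← e2', ← e1, mul_assoc, mul_assoc, e6, Br,
    mul_assoc, ← mul_assoc (G k (l ++ [i]) (.endDot i) r), e5, mul_assoc, e4,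
    ← mul_assoc, e3, mul_neg, mul_neg, hE, hE, hE']
  rw [two_smul]; abel

/-- A line of colour `i` next to a dot of colour `j` is annihilated by
`f_i + 2 f_{i+1} + ⋯ + 2 f_{j-1} + f_j`. -/
theorem dot_mul_yCoeff (l r : Word n) (i j : Fin n) (hij : i < j) :
    G k (l ++ [i]) (.startDot j) r * Flin k (l ++ [i]) r (yCoeff k i j) = 0 := by
  obtain ⟨d, hd⟩ : ∃ d, i.val + 1 + d = j.val := ⟨j.val - i.val - 1, by
    rw [Fin.lt_def] at hij; omega⟩
  induction d generalizing l r i with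
  | zero =>
    have hadj : Adjacent j i := Or.inr hd
    have hadj' : Adjacent i j := Or.inl hd
    -- Ending the left `j`-strand of `switch` gives, next to the dot of colour `j`, that `f_j` to
    -- the left of the `i`-line equals minus the broken `i`-line. The adjacent dot-forcing relation
    -- turns this into the vanishing of `f_i + f_j` on the right.
    have e1 := switch (k := k) l r hadj
    have e2 := F_near (k := k) l r hadj'
    have e3 := congrArg (fun X => G k l (.endDot j) (i :: j :: r) * X) e1
    have e4 := G_comm (k := k) l [i] r (.endDot j) (.startDot j)
    have e5 := G_comm (k := k) l [] (j :: r) (.endDot j) (.startDot i)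
    have e6 := endDot_cup_left (k := k) l r j
    have e7 := G_comm (k := k) l [] r (.startDot i) (.startDot j)
    simp only [List.append_nil, List.nil_append, List.cons_append] at e4 e5 e7
    simp only [mul_neg] at e3
    rw [← mul_assoc, ← e4, mul_assoc, ← mul_assoc _ _ (_ * _), ← e5, mul_assoc, ← mul_assoc _ _
      (G k l (.endDot i) r), e6, ← mul_assoc (G k l (.startDot i) _), ← e7, mul_assoc] at e3
    change _ * F k l j (i :: r) = -(_ * Br k l i r) at e3
    rw [e2, mul_sub, sub_eq_iff_eq_add, neg_add_cancel] at e3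
    rw [yCoeff_adjacent hd, map_add, Flin_single, Flin_single, add_comm, e3]
  | succ d ih =>
    have hc : i.val + 1 < n := by have := j.2; omega
    set c : Fin n := ⟨i.val + 1, hc⟩ with hcdef
    have hcj : c < j := by rw [Fin.lt_def]; simp [hcdef]; omega
    have hadj : Adjacent i c := Or.inl rfl
    -- With `c = i + 1` the combination for `(c, j)` is `f_c + b`, where the colours in `b`, like
    -- `j` itself, are distant from `i` and pass freely through `i`-lines. The induction hypothesis
    -- is used between two `i`-lines.
    set b : Fin n → k := yCoeff k c j - Pi.single c 1 with hb
    have hbfar : ∀ x, b x ≠ 0 → Distant i x := by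
      intro x hx
      simp only [hb, Pi.sub_apply, yCoeff, Pi.single_apply, Fin.ext_iff, Fin.lt_def] at hx
      have : c.val = i.val + 1 := rfl
      unfold Distant
      by_contra hcon
      apply hx
      split_ifs <;> first | omega | simp
    have hy : yCoeff k c j = Pi.single c 1 + b := by rw [hb]; abel
    have e0 := ih (l ++ [i]) (i :: r) c hcj (by simp [hcdef]; omega)
    rw [hy, map_add, Flin_single] at e0
    have e1 := Flin_far (k := k) (l ++ [i, c]) r hbfar
    have e2 := G_comm_F (k := k) (l ++ [i]) [] (i :: r) c (.startDot c)
    have e3 := G_mul_Flin (k := k) (l ++ [i]) [i] r b (.startDot c)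
    have e4 := G_comm (k := k) (l ++ [i]) [i] r (.endDot c) (.startDot j)
    have e6 := G_comm (k := k) l [] r (.merge i) (.startDot j)
    have e7 := merge_F_F_split_of_adjacent (k := k) l r hadj
    have e8 := merge_F_split_of_adjacent (k := k) l r hadj
    have e9 := G_mul_Flin (k := k) l [] r b (.split i)
    have hdist : Distant j i := by unfold Distant; omega
    have e10 := cross_dot_left (k := k) (l ++ [i, c]) r hdist
    simp only [List.append_nil, List.nil_append, List.cons_append, List.append_assoc]
      at e0 e1 e2 e3 e4 e6 e9 e10
    rw [e1] at e0
    -- Carry the dot `j` and the term `b` across the right-hand `i`-line and close the `c`-line to a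
    -- double dot: beside the dot `j`, `f_c` between the `i`-lines times `f_c + b` vanishes.
    have f1 := congrArg (fun X => G k (l ++ [i]) (.endDot c) (i :: j :: r) *
      (G k (l ++ [i, c]) (.cross j i hdist) r * (X * G k (l ++ [i]) (.startDot c) (i :: r)))) e0
    simp only [zero_mul, mul_zero] at f1
    rw [mul_assoc, ← mul_assoc (G k (l ++ [i, c]) _ _), e10, add_mul, e2, e3, ← mul_add,
      ← mul_assoc, ← e4, mul_assoc, ← mul_assoc (G k (l ++ [i]) (.endDot c) _)] at f1
    change _ * (F k _ _ _ * _) = 0 at f1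
    -- Joining the two `i`-lines to a bubble evaluates this to `-(f_i + 2 f_c + b)`, the combination
    -- for `(i, j)` up to sign.
    have f2 := congrArg (fun X => G k l (.merge i) (j :: r) * (X * G k l (.split i) r)) f1
    simp only [zero_mul, mul_zero] at f2
    rw [mul_assoc, ← mul_assoc (G k l (.merge i) _), ← e6, mul_assoc, mul_assoc, add_mul, e9,
      mul_add, mul_add, ← mul_assoc (F k _ _ _) (G k _ _ _), ← mul_assoc (G k l (.merge i) r)
      (F k _ _ _ * G k _ _ _), e8, e7, mul_add, neg_mul, mul_neg, mul_neg, ← mul_assoc _ (E k _),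
      G_mul_E (by simp), ← neg_add, neg_eq_zero, ← mul_add] at f2
    rw [yCoeff_succ (show i.val + 1 = c.val from rfl) hcj, hy, map_add, map_add, map_add,
      Flin_single, Flin_single, ← f2, two_smul]
    congr 1; abel

/-- The polynomial `f_i + 2 f_{i+1} + ⋯ + 2 f_{j-1} + f_j`. -/
noncomputable def yPoly (k : Type*) [Field k] {n : ℕ} (i j : Fin n) : MvPolynomial (Fin n) k :=
  ∑ c, yCoeff k i j c • MvPolynomial.X c

theorem yPoly_mem_annIdeal {i j : Fin n} (hij : i < j) : yPoly k i j ∈ annIdeal k [i, j] := by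
  have e1 := dot_mul_yCoeff (k := k) [] [] i j hij
  have e2 := G_mul_Flin (k := k) [] [] [] (yCoeff k i j) (.startDot i)
  have e3 := op_phi_insert (k := k) [i] [] j
  have e4 := op_phi_insert (k := k) [] [] i
  simp only [List.append_nil, List.nil_append, List.cons_append] at e1 e2 e3 e4
  have e5 : polyOp k n (yPoly k i j) = Flin k [] [] (yCoeff k i j) := by
    simp [yPoly, Flin_apply, polyOp_X]
  have e6 : op k (phi ([] : Word n)) = E k [] := rfl
  rw [mem_annIdeal_iff, e3, e4, e5, e6, G_mul_E (by simp), mul_assoc, ← e2, ← mul_assoc, e1,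
    zero_mul]

end Annihilator

end TLCat

namespace TLCat

open Diag

/-! ### Spanning monomials -/

section Spanning

variable {k : Type*} [Field k] {n : ℕ}

/-- The distance of two colours. -/
def colDist (i j : Fin n) : ℕ := (i.val - j.val) + (j.val - i.val)

theorem pair_sublist {w : Word n} (hw : w.Pairwise (· < ·)) {i j : Fin n} (hij : i < j)
    (hi : i ∈ w) (hj : j ∈ w) : [i, j].Sublist w := by
  obtain ⟨l, r, rfl⟩ := List.append_of_mem hj
  have hil : i ∈ l := by
    rw [List.pairwise_append, List.pairwise_cons] at hw
    rcases List.mem_append.1 hi with h | h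
    · exact h
    · rcases List.mem_cons.1 h with h | h
      · exact absurd h hij.ne
      · exact absurd (hw.2.1.1 i h) hij.asymm
  exact (List.singleton_sublist.2 hil).append (List.singleton_sublist.2 (by simp))

/-- The extreme colours have coefficient `1`, so either of them can be solved for without division.
-/
theorem yPoly_left (i j : Fin n) :
    yPoly k i j = MvPolynomial.X i +
      ∑ b, (yCoeff k i j - Pi.single i 1 : Fin n → k) b • MvPolynomial.X b := by
  simp [yPoly, sub_smul, Pi.single_apply]

theorem yPoly_right (i j : Fin n) :
    yPoly k i j = MvPolynomial.X j +
      ∑ b, (yCoeff k i j - Pi.single j 1 : Fin n → k) b • MvPolynomial.X b := by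
  simp [yPoly, sub_smul, Pi.single_apply]

/-- A colour can be replaced by colours closer to a colour of the word. -/
theorem exists_replacement {w : Word n} (hw : w.Pairwise (· < ·)) {i₀ : Fin n} (h₀ : i₀ ∈ w)
    {c : Fin n} (hc : c ≠ i₀) : ∃ a : Fin n → k,
      (∀ b, a b ≠ 0 → colDist b i₀ < colDist c i₀ ∧ min c i₀ ≤ b) ∧
      (c ∈ w → MvPolynomial.X c + ∑ b, a b • MvPolynomial.X b ∈ annIdeal k w) ∧
      MvPolynomial.X c * (MvPolynomial.X c + ∑ b, a b • MvPolynomial.X b) ∈ annIdeal k w := by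
  have hsub : ([i₀] : Word n).Sublist w := List.singleton_sublist.2 h₀
  rcases lt_or_gt_of_ne hc with h | h
  · refine ⟨yCoeff k c i₀ - Pi.single c 1, ?_, ?_, ?_⟩
    · intro b hb
      simp only [Pi.sub_apply, yCoeff, Pi.single_apply, Fin.ext_iff, Fin.lt_def] at hb h
      rw [min_eq_left (show c ≤ i₀ from h.le), Fin.le_def]
      unfold colDist
      by_contra hcon
      apply hb
      split_ifs <;> first | omega | simp
    · intro hcw
      rw [← yPoly_left]
      exact annIdeal_le_of_sublist (pair_sublist hw h hcw h₀) [] (yPoly_mem_annIdeal h)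
    · rw [← yPoly_left]
      exact annIdeal_le_of_sublist hsub []
        (X_mul_mem_annIdeal (l := []) (r := [i₀]) (yPoly_mem_annIdeal h))
  · refine ⟨yCoeff k i₀ c - Pi.single c 1, ?_, ?_, ?_⟩
    · intro b hb
      simp only [Pi.sub_apply, yCoeff, Pi.single_apply, Fin.ext_iff, Fin.lt_def] at hb h
      rw [min_eq_right (show i₀ ≤ c from h.le), Fin.le_def]
      unfold colDist
      by_contra hcon
      apply hb
      split_ifs <;> first | omega | simp
    · intro hcw
      rw [← yPoly_right]
      exact annIdeal_le_of_sublist (pair_sublist hw h h₀ hcw) [] (yPoly_mem_annIdeal h)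
    · rw [← yPoly_right]
      exact annIdeal_le_of_sublist hsub []
        (X_mul_mem_annIdeal (l := [i₀]) (r := []) (yPoly_mem_annIdeal h))

/-- The monomial of degree `r` with one factor for each colour in `S` and further factors of
colour `i`. -/
noncomputable def redMon (k : Type*) [Field k] {n : ℕ} (i : Fin n) (r : ℕ) (S : Finset (Fin n)) :
    MvPolynomial (Fin n) k :=
  MvPolynomial.X i ^ (r - S.card) * ∏ c ∈ S, MvPolynomial.X c

/-- Reduced monomials of degree `r` in colours outside `w` and above a bound. -/
def redSet (k : Type*) [Field k] {n : ℕ} (w : Word n) (i b₀ : Fin n) (r : ℕ) :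
    Set (MvPolynomial (Fin n) k) :=
  {p | ∃ S : Finset (Fin n), (∀ c ∈ S, c ∉ w ∧ b₀ ≤ c) ∧ S.card ≤ r ∧ p = redMon k i r S}

/-- These are the exponents to which no replacement applies: away from `i₀` there are no colours of
`w` and no repeated factors. -/
theorem monomial_mem_redSet {w : Word n} {i₀ b₀ : Fin n} {e : Fin n →₀ ℕ}
    (hb : ∀ c, e c ≠ 0 → b₀ ≤ c) (h1 : ∀ c, c ≠ i₀ → c ∈ w → e c = 0)
    (h2 : ∀ c, c ≠ i₀ → e c ≤ 1) :
    MvPolynomial.monomial e 1 ∈ redSet k w i₀ b₀ e.degree := by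
  classical
  set S := Finset.univ.filter fun c => c ≠ i₀ ∧ e c ≠ 0 with hS
  have hd : e.degree = S.card + e i₀ := by
    rw [Finsupp.degree_eq_sum, ← Finset.sum_erase_add _ _ (Finset.mem_univ i₀), hS,
      Finset.card_filter, ← Finset.sum_erase_add _ _ (Finset.mem_univ i₀)]
    simp only [ne_eq, not_true_eq_false, false_and, if_false, add_zero]
    congr 1
    refine Finset.sum_congr rfl fun c hc => ?_
    have hc' : c ≠ i₀ := Finset.ne_of_mem_erase hc
    have := h2 c hc'
    split_ifs with h
    · omega
    · tauto
  refine ⟨S, ?_, by omega, ?_⟩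
  · intro c hc
    simp only [hS, Finset.mem_filter, Finset.mem_univ, true_and] at hc
    exact ⟨fun hw => hc.2 (h1 c hc.1 hw), hb c hc.2⟩
  · rw [redMon, hd, Nat.add_sub_cancel_left, MvPolynomial.monomial_eq, Finsupp.prod_fintype _ _
      (by simp), map_one, one_mul, ← Finset.mul_prod_erase _ _ (Finset.mem_univ i₀), hS,
      Finset.prod_filter, ← Finset.mul_prod_erase _ _ (Finset.mem_univ i₀)]
    simp only [ne_eq, not_true_eq_false, false_and, if_false, one_mul]
    congr 1
    refine Finset.prod_congr rfl fun c hc => ?_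
    have hc' : c ≠ i₀ := Finset.ne_of_mem_erase hc
    have := h2 c hc'
    split_ifs with h
    · rw [show e c = 1 by omega, pow_one]
    · rw [show e c = 0 by tauto, pow_zero]

/-- A rewriting argument: a factor `f_c` with `c ≠ i₀` is replaced if `c ∈ w` or if it is repeated.
The new colours are closer to `i₀`, so the total distance to `i₀` decreases. They are not below both
`c` and `i₀`, so the lower bound `b₀` persists; it matters only for the empty word. -/
theorem monomial_mem_span_redSet {w : Word n} (hw : w.Pairwise (· < ·)) {i₀ b₀ : Fin n}
    (h₀ : i₀ ∈ w) (hb₀ : b₀ ≤ i₀) (e : Fin n →₀ ℕ) (hb : ∀ c, e c ≠ 0 → b₀ ≤ c) :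
    MvPolynomial.monomial e 1 ∈ Submodule.span k (redSet k w i₀ b₀ e.degree) ⊔
      (annIdeal k w).restrictScalars k := by
  induction hW : ∑ c, e c * colDist c i₀ using Nat.strong_induction_on generalizing e with
  | _ N ih =>
  subst hW
  have step : ∀ (c : Fin n) (e' : Fin n →₀ ℕ) (a : Fin n → k), e = e' + Finsupp.single c 1 →
      (∀ b, a b ≠ 0 → colDist b i₀ < colDist c i₀ ∧ min c i₀ ≤ b) →
      MvPolynomial.monomial e' 1 * (MvPolynomial.X c + ∑ b, a b • MvPolynomial.X b)
        ∈ annIdeal k w →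
      MvPolynomial.monomial e 1 ∈ Submodule.span k (redSet k w i₀ b₀ e.degree) ⊔
        (annIdeal k w).restrictScalars k := by
    intro c e' a he ha hmem
    have hX : ∀ b, (MvPolynomial.monomial e' 1 * MvPolynomial.X b : MvPolynomial (Fin n) k) =
        MvPolynomial.monomial (e' + Finsupp.single b 1) 1 := by
      intro b; rw [MvPolynomial.X, MvPolynomial.monomial_mul, one_mul]
    have hsum : (MvPolynomial.monomial e 1 : MvPolynomial (Fin n) k) =
        MvPolynomial.monomial e' 1 * (MvPolynomial.X c + ∑ b, a b • MvPolynomial.X b) -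
        ∑ b, a b • MvPolynomial.monomial (e' + Finsupp.single b 1) 1 := by
      rw [mul_add, Finset.mul_sum, hX, ← he]
      simp only [mul_smul_comm, hX, add_sub_cancel_right]
    rw [hsum]
    refine sub_mem (Submodule.mem_sup_right hmem) (Submodule.sum_mem _ fun b _ => ?_)
    by_cases hab : a b = 0
    · rw [hab, zero_smul]; exact zero_mem _
    refine Submodule.smul_mem _ _ ?_
    obtain ⟨hlt, hmin⟩ := ha b hab
    have hdeg : (e' + Finsupp.single b 1).degree = e.degree := by
      rw [he, map_add, map_add, Finsupp.degree_single, Finsupp.degree_single]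
    have hsplit : ∀ x : Fin n, ∑ c, (e' + Finsupp.single x 1 : Fin n →₀ ℕ) c * colDist c i₀ =
        ∑ c, e' c * colDist c i₀ + colDist x i₀ := by
      intro x
      simp [add_mul, Finset.sum_add_distrib, Finsupp.single_apply]
    rw [← hdeg]
    refine ih _ ?_ (e' + Finsupp.single b 1) ?_ rfl
    · rw [he, hsplit, hsplit]; omega
    · intro x hx
      by_cases hxb : x = b
      · subst hxb
        refine le_trans (le_min ?_ hb₀) hmin
        exact hb c (by simp [he])
      · refine hb x ?_
        have : e' x ≠ 0 := by
          simpa [Finsupp.single_apply, Ne.symm hxb] using hx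
        rw [he]; simp [this]
  by_cases hA : ∃ c, c ≠ i₀ ∧ c ∈ w ∧ e c ≠ 0
  · obtain ⟨c, hc, hcw, hec⟩ := hA
    obtain ⟨a, ha, h1, -⟩ := exists_replacement (k := k) hw h₀ hc
    refine step c (e - Finsupp.single c 1) a ?_ ha (Ideal.mul_mem_left _ _ (h1 hcw))
    rw [Finsupp.sub_add_single_one_cancel hec]
  by_cases hB : ∃ c, c ≠ i₀ ∧ 2 ≤ e c
  · obtain ⟨c, hc, hec⟩ := hB
    obtain ⟨a, ha, -, h2⟩ := exists_replacement (k := k) hw h₀ hc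
    refine step c (e - Finsupp.single c 1) a ?_ ha ?_
    · rw [Finsupp.sub_add_single_one_cancel (by omega)]
    · have h3 : e - Finsupp.single c 1 = (e - Finsupp.single c 1 - Finsupp.single c 1) +
          Finsupp.single c 1 := by
        rw [Finsupp.sub_add_single_one_cancel]
        simp; omega
      have h4 : (MvPolynomial.monomial (e - Finsupp.single c 1) 1 : MvPolynomial (Fin n) k) =
          MvPolynomial.monomial (e - Finsupp.single c 1 - Finsupp.single c 1) 1 *
            MvPolynomial.X c := by
        rw [MvPolynomial.X, MvPolynomial.monomial_mul, one_mul, ← h3]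
      rw [h4, mul_assoc]
      exact Ideal.mul_mem_left _ _ h2
  · push Not at hA hB
    refine Submodule.mem_sup_left (Submodule.subset_span ?_)
    refine monomial_mem_redSet hb (fun c hc hcw => hA c hc hcw) fun c hc => ?_
    have := hB c hc
    omega

/-- For a word containing `i`, the degree `r` part of its morphism space is spanned by reduced
monomials. -/
theorem polyMap_monomial_mem_span {w : Word n} (hw : w.Pairwise (· < ·)) {i : Fin n} (hi : i ∈ w)
    (e : Fin n →₀ ℕ) :
    polyMap k w (MvPolynomial.monomial e 1) ∈ Submodule.span k
      {x | ∃ S : Finset (Fin n), (∀ c ∈ S, c ∉ w) ∧ S.card ≤ e.degree ∧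
        x = polyMap k w (redMon k i e.degree S)} := by
  have h := monomial_mem_span_redSet (k := k) hw (b₀ := ⟨0, i.pos⟩) hi (Nat.zero_le _) e
    (fun _ _ => Nat.zero_le _)
  obtain ⟨p, hp, q, hq, hpq⟩ := Submodule.mem_sup.1 h
  rw [← hpq, map_add, mem_annIdeal.1 hq, add_zero]
  have := Submodule.mem_map_of_mem (f := polyMap k w) hp
  rw [Submodule.map_span] at this
  refine Submodule.span_mono ?_ this
  rintro _ ⟨_, ⟨S, hS, hr, rfl⟩, rfl⟩
  exact ⟨S, fun c hc => (hS c hc).1, hr, rfl⟩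

/-- The endomorphisms of the empty word of positive degree are spanned by reduced monomials. -/
theorem polyMap_nil_monomial_mem_span (e : Fin n →₀ ℕ) (he : e ≠ 0) :
    polyMap k [] (MvPolynomial.monomial e 1) ∈ Submodule.span k
      {x | ∃ (S : Finset (Fin n)) (hS : S.Nonempty), S.card ≤ e.degree ∧
        x = polyMap k [] (redMon k (S.min' hS) e.degree S)} := by
  classical
  have hne : e.support.Nonempty := Finsupp.support_nonempty_iff.2 he
  -- After splitting off one factor of the smallest colour `i`, relations for the word `[i]` may be
  -- used on the rest, since multiplication by `f_i` carries them to the empty word. Keeping `i`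
  -- minimal ensures that each set of colours contributes a single monomial.
  set i := e.support.min' hne with hi
  have hei : e i ≠ 0 := Finsupp.mem_support_iff.1 (Finset.min'_mem _ hne)
  have hmin : ∀ c, e c ≠ 0 → i ≤ c := fun c hc =>
    Finset.min'_le _ _ (Finsupp.mem_support_iff.2 hc)
  set e' := e - Finsupp.single i 1 with he'
  have hee : e = e' + Finsupp.single i 1 := (Finsupp.sub_add_single_one_cancel hei).symm
  have hdeg : e.degree = e'.degree + 1 := by rw [hee, map_add, Finsupp.degree_single]
  have h := monomial_mem_span_redSet (k := k) (w := [i]) (i₀ := i) (by simp) (by simp) le_rfl e' (by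
    intro c hc
    refine hmin c ?_
    rw [hee, Finsupp.add_apply]; omega)
  obtain ⟨p, hp, q, hq, hpq⟩ := Submodule.mem_sup.1 h
  have hmon : (MvPolynomial.monomial e 1 : MvPolynomial (Fin n) k) =
      MvPolynomial.X i * MvPolynomial.monomial e' 1 := by
    rw [MvPolynomial.X, MvPolynomial.monomial_mul, one_mul, add_comm, ← hee]
  have hq' : polyMap k [] (MvPolynomial.X i * q) = 0 :=
    mem_annIdeal.1 (X_mul_mem_annIdeal (l := []) (r := []) hq)
  rw [hmon, ← hpq, mul_add, map_add, hq', add_zero]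
  have := Submodule.mem_map_of_mem (f := polyMap k [] ∘ₗ LinearMap.mulLeft k (MvPolynomial.X i)) hp
  rw [Submodule.map_span] at this
  refine Submodule.span_mono ?_ this
  rintro _ ⟨_, ⟨S, hS, hr, rfl⟩, rfl⟩
  have hiS : i ∉ S := fun h => (hS i h).1 (by simp)
  refine ⟨insert i S, Finset.insert_nonempty _ _, ?_, ?_⟩
  · rw [Finset.card_insert_of_notMem hiS]; omega
  · have hmin' : (insert i S).min' (Finset.insert_nonempty _ _) = i := by
      refine le_antisymm (Finset.min'_le _ _ (Finset.mem_insert_self _ _)) ?_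
      refine Finset.le_min' _ _ _ fun c hc => ?_
      rcases Finset.mem_insert.1 hc with rfl | hc
      · exact le_rfl
      · exact (hS c hc).2
    rw [LinearMap.comp_apply, LinearMap.mulLeft_apply, hmin', redMon, redMon,
      Finset.card_insert_of_notMem hiS, Finset.prod_insert hiS, hdeg, Nat.add_sub_add_right]
    congr 1; ring

end Spanning

end TLCat

namespace TLCat

open Diag

/-! ### A state sum

Regions of a diagram are labelled by binary sequences.  A strand of colour `i` may have the same
label on both sides, or labels that differ by exchanging the entries `i` and `i + 1`, provided that
these entries are different. -/

section StateSum

variable {k : Type*} [Field k] {n : ℕ}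

/-- Labels of regions. -/
abbrev Label (n : ℕ) : Type := Fin (n + 1) → Bool

/-- The value of a double dot of colour `i` in a region. -/
def dotVal (k : Type*) [Field k] {n : ℕ} (i : Fin n) (x : Label n) : k :=
  (if x i.castSucc then 1 else 0) - (if x i.succ then 1 else 0)

/-- The label on the other side of a strand of colour `i`. -/
def flip (i : Fin n) (b : Bool) (x : Label n) : Label n :=
  if b then x ∘ Equiv.swap i.castSucc i.succ else x

@[simp] theorem flip_false (i : Fin n) (x : Label n) : flip i false x = x := rfl

theorem flip_flip (i : Fin n) (b c : Bool) (x : Label n) :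
    flip i b (flip i c x) = flip i (xor b c) x := by
  cases b <;> cases c <;> simp [flip, Function.comp_assoc]
  funext y; simp

theorem Distant.swap_commute {i j : Fin n} (h : Distant i j) (y : Fin (n + 1)) :
    Equiv.swap i.castSucc i.succ (Equiv.swap j.castSucc j.succ y) =
      Equiv.swap j.castSucc j.succ (Equiv.swap i.castSucc i.succ y) := by
  unfold Distant at h
  have hd : [i.castSucc, i.succ, j.castSucc, j.succ].Nodup := by
    simp [Fin.ext_iff]; omega
  exact Equiv.congr_fun (Equiv.Perm.disjoint_swap_swap hd).commute.eq y

theorem flip_comm {i j : Fin n} (h : Distant i j) (b c : Bool) (x : Label n) :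
    flip i b (flip j c x) = flip j c (flip i b x) := by
  cases b <;> cases c <;> simp only [flip, if_true, if_false, Bool.false_eq_true]
  funext y
  simp [h.swap_commute]

@[simp] theorem dotVal_flip (i : Fin n) (b : Bool) (x : Label n) :
    dotVal k i (flip i b x) = if b then -dotVal k i x else dotVal k i x := by
  cases b <;> simp [dotVal, flip]

theorem dotVal_flip_far {i j : Fin n} (h : Distant i j) (b : Bool) (x : Label n) :
    dotVal k i (flip j b x) = dotVal k i x := by
  unfold Distant at h
  cases b
  · rfl
  · have h1 : Equiv.swap j.castSucc j.succ i.castSucc = i.castSucc :=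
      Equiv.swap_apply_of_ne_of_ne (by simp [Fin.ext_iff]; omega) (by simp [Fin.ext_iff]; omega)
    have h2 : Equiv.swap j.castSucc j.succ i.succ = i.succ :=
      Equiv.swap_apply_of_ne_of_ne (by simp [Fin.ext_iff]; omega) (by simp [Fin.ext_iff]; omega)
    simp [dotVal, flip, h1, h2]

/-- Under a flip the values transform like simple roots under a simple reflection, matching the
dot-forcing relations. -/
theorem dotVal_flip_near {i j : Fin n} (h : Adjacent i j) (x : Label n) :
    dotVal k j (flip i true x) = dotVal k j x + dotVal k i x := by
  rcases h with h | h
  · have h1 : j.castSucc = i.succ := by simp [Fin.ext_iff]; omega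
    have h2 : Equiv.swap i.castSucc i.succ j.succ = j.succ :=
      Equiv.swap_apply_of_ne_of_ne (by simp [Fin.ext_iff]; omega) (by simp [Fin.ext_iff]; omega)
    simp [dotVal, flip, h1, h2]
  · have h1 : j.succ = i.castSucc := by simp [Fin.ext_iff]; omega
    have h2 : Equiv.swap i.castSucc i.succ j.castSucc = j.castSucc :=
      Equiv.swap_apply_of_ne_of_ne (by simp [Fin.ext_iff]; omega) (by simp [Fin.ext_iff]; omega)
    simp [dotVal, flip, h1, h2]

theorem dotVal_sq {i : Fin n} {x : Label n} (h : dotVal k i x ≠ 0) :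
    dotVal k i x * dotVal k i x = 1 := by
  revert h; unfold dotVal; split_ifs <;> simp

theorem dotVal_cube (i : Fin n) (x : Label n) :
    dotVal k i x * dotVal k i x * dotVal k i x = dotVal k i x := by
  unfold dotVal; split_ifs <;> simp

/-- Consecutive nonzero differences of a binary sequence alternate in sign; this is the source of
the sign in `switch`. -/
theorem dotVal_near {i j : Fin n} (h : Adjacent i j) {x : Label n} (hi : dotVal k i x ≠ 0)
    (hj : dotVal k j x ≠ 0) : dotVal k j x = -dotVal k i x := by
  revert hi hj
  rcases h with h | h
  · have h1 : j.castSucc = i.succ := by simp [Fin.ext_iff]; omega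
    simp only [dotVal, h1]
    split_ifs <;> simp
  · have h1 : j.succ = i.castSucc := by simp [Fin.ext_iff]; omega
    simp only [dotVal, h1]
    split_ifs <;> simp

/-- Functions of the strands of a word, evaluated on each side. -/
abbrev St (k : Type*) : Type _ := List Bool → k

/-- Operators depending on the label of the leftmost region. -/
abbrev StOp (k : Type*) [Field k] (n : ℕ) : Type _ := Label n → Module.End k (St k)

/-- The value of an elementary piece. -/
def genVal (k : Type*) [Field k] {n : ℕ} (x : Label n) :
    {a b : Word n} → Gen n a b → St k → St k
  -- Each bit of a state tells whether the label changes across the corresponding strand. Both sides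
  -- of a dot lie in one region, so its bit is `false`. The value `0` on lists that are too short is
  -- a default that admissible states never meet.
  | _, _, .startDot i, f => fun bs => match bs with
    | b :: bs => if b then 0 else dotVal k i x * f bs
    | [] => 0
  | _, _, .endDot i, f => fun bs => dotVal k i x * dotVal k i x * f (false :: bs)
  -- For `merge` and `cap` one sums over the two labels of the region closed off, `x` and its flip,
  -- weighted by the value of a double dot there; this value changes sign under the flip.
  | _, _, .merge i, f => fun bs => match bs with
    | b :: bs => dotVal k i x * (f (false :: b :: bs) - f (true :: (!b) :: bs))
    | [] => 0
  | _, _, .split _, f => fun bs => match bs with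
    | b :: c :: bs => f (xor b c :: bs)
    | _ => 0
  | _, _, .cup i, f => fun bs => match bs with
    | b :: c :: bs => if xor b c then 0 else dotVal k i x * f bs
    | _ => 0
  | _, _, .cap i, f => fun bs =>
      dotVal k i x * (f (false :: false :: bs) - f (true :: true :: bs))
  | _, _, .cross _ _ _, f => fun bs => match bs with
    | b :: c :: bs => f (c :: b :: bs)
    | _ => 0

/-- The operator of an elementary piece. -/
def genOp (k : Type*) [Field k] {n : ℕ} {a b : Word n} (g : Gen n a b) : StOp k n := fun x =>
  { toFun := genVal k x g
    map_add' := by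
      intro f f'
      funext bs
      cases g <;> rcases bs with _ | ⟨b, _ | ⟨c, bs⟩⟩ <;> simp [genVal] <;> (try split_ifs) <;>
        (try simp) <;> ring
    map_smul' := by
      intro r f
      funext bs
      cases g <;> rcases bs with _ | ⟨b, _ | ⟨c, bs⟩⟩ <;> simp [genVal] <;> (try split_ifs) <;>
        (try simp) <;> ring }

theorem genOp_apply {a b : Word n} (g : Gen n a b) (x : Label n) (f : St k) (bs : List Bool) :
    genOp k g x f bs = genVal k x g f bs := rfl

/-- A strand to the left of an operator. -/
def strandOp (i : Fin n) (A : StOp k n) : StOp k n := fun x =>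
  { toFun := fun f bs => match bs with
      | b :: bs => A (flip i b x) (fun cs => f (b :: cs)) bs
      | [] => f []
    map_add' := by
      intro f f'
      funext bs
      rcases bs with _ | ⟨b, bs⟩
      · simp
      · exact congrFun (map_add (A (flip i b x)) (fun cs => f (b :: cs)) fun cs => f' (b :: cs)) bs
    map_smul' := by
      intro r f
      funext bs
      rcases bs with _ | ⟨b, bs⟩
      · simp
      · exact congrFun (map_smul (A (flip i b x)) r fun cs => f (b :: cs)) bs }

@[simp] theorem strandOp_cons (i : Fin n) (A : StOp k n) (x : Label n) (f : St k) (b : Bool)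
    (bs : List Bool) :
    strandOp i A x f (b :: bs) = A (flip i b x) (fun cs => f (b :: cs)) bs := rfl

/-- Strands to the left of an operator. -/
def wordOp : Word n → StOp k n → StOp k n
  | [], A => A
  | i :: l, A => strandOp i (wordOp l A)

@[simp] theorem wordOp_nil (A : StOp k n) : wordOp [] A = A := rfl

@[simp] theorem wordOp_cons (i : Fin n) (l : Word n) (A : StOp k n) :
    wordOp (i :: l) A = strandOp i (wordOp l A) := rfl

theorem wordOp_append (l m : Word n) (A : StOp k n) :
    wordOp (l ++ m) A = wordOp l (wordOp m A) := by
  induction l with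
  | nil => rfl
  | cons i l ih => simp [ih]

/-- The operator of a diagram. -/
def diagOp (k : Type*) [Field k] {n : ℕ} {s t : Word n} : Diag s t → StOp k n
  | .nil _ => 1
  | .cons L D => diagOp k D * wordOp L.left (genOp k L.gen)

theorem diagOp_comp {s t u : Word n} (D : Diag s t) (D' : Diag t u) :
    diagOp k (D.comp D') = diagOp k D' * diagOp k D := by
  induction D with
  | nil w => simp [Diag.comp, diagOp]
  | cons L D ih => simp [Diag.comp, diagOp, ih, mul_assoc]

@[simp] theorem diagOp_nil (w : Word n) : diagOp k (.nil w) = 1 := rfl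

theorem diagOp_one (l r : Word n) {a b : Word n} (g : Gen n a b) :
    diagOp k (one l g r) = wordOp l (genOp k g) := by
  simp [one, diagOp]

theorem diagOp_step (l r : Word n) {s t a b : Word n} (g : Gen n a b) (hs : s = l ++ a ++ r)
    (ht : t = l ++ b ++ r) : diagOp k (Diag.step l g r hs ht) = wordOp l (genOp k g) := by
  simp [Diag.step, diagOp]

/-- The admissible states of the strands of a word. -/
def Adm (k : Type*) [Field k] {n : ℕ} : Word n → Label n → List Bool → Prop
  | [], _, bs => bs = []
  | _ :: _, _, [] => False
  | i :: w, x, b :: bs => dotVal k i x ≠ 0 ∧ Adm k w (flip i b x) bs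

theorem adm_cons {i : Fin n} {w : Word n} {x : Label n} {bs : List Bool} :
    Adm k (i :: w) x bs ↔ ∃ b cs, bs = b :: cs ∧ dotVal k i x ≠ 0 ∧ Adm k w (flip i b x) cs := by
  rcases bs with _ | ⟨b, cs⟩
  · simp [Adm]
  · simp [Adm]

/-- Operators that agree on the admissible states of a word. -/
def AgreeOn (t : Word n) (A B : StOp k n) : Prop :=
  ∀ (x : Label n) (f : St k) (bs : List Bool), Adm k t x bs → A x f bs = B x f bs

theorem AgreeOn.wordOp {t : Word n} {A B : StOp k n} (h : AgreeOn t A B) (l : Word n) :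
    AgreeOn (l ++ t) (wordOp l A) (wordOp l B) := by
  induction l with
  | nil => exact h
  | cons i l ih =>
    intro x f bs hbs
    obtain ⟨b, cs, rfl, -, hcs⟩ := adm_cons.1 hbs
    exact ih _ _ _ hcs

/-- Operators whose values on admissible states depend on admissible states only. -/
def IsLocal (s t : Word n) (A : StOp k n) : Prop :=
  ∀ (x : Label n) (f f' : St k), (∀ bs, Adm k s x bs → f bs = f' bs) →
    ∀ bs, Adm k t x bs → A x f bs = A x f' bs

theorem IsLocal.wordOp {s t : Word n} {A : StOp k n} (h : IsLocal s t A) (l : Word n) :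
    IsLocal (l ++ s) (l ++ t) (wordOp l A) := by
  induction l with
  | nil => exact h
  | cons i l ih =>
    intro x f f' hf bs hbs
    obtain ⟨b, cs, rfl, h0, hcs⟩ := adm_cons.1 hbs
    refine ih _ _ _ (fun ds hds => hf _ ?_) _ hcs
    exact ⟨h0, hds⟩

/-- The relations hold on admissible states only, so pieces stacked above must not see other states.
For an end dot or a cap an inadmissible input can lie below an admissible output, but then the
factor `dotVal` is zero. -/
theorem isLocal_genOp {a b : Word n} (g : Gen n a b) (r : Word n) :
    IsLocal (a ++ r) (b ++ r) (genOp k g) := by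
  intro x f f' hf bs hbs
  rw [genOp_apply, genOp_apply]
  cases g with
  | startDot i =>
    obtain ⟨b, cs, rfl, h0, hcs⟩ := adm_cons.1 hbs
    cases b
    · simp [genVal, hf cs hcs]
    · rfl
  | endDot i =>
    by_cases h0 : dotVal k i x = 0
    · simp [genVal, h0]
    · simp [genVal, hf (false :: bs) ⟨h0, hbs⟩]
  | merge i =>
    obtain ⟨b, cs, rfl, h0, hcs⟩ := adm_cons.1 hbs
    have h1 := hf (false :: b :: cs) ⟨h0, h0, hcs⟩
    have h2 := hf (true :: (!b) :: cs) ⟨h0, by simpa using h0, by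
      rw [flip_flip]; simpa using hcs⟩
    simp [genVal, h1, h2]
  | split i =>
    obtain ⟨b, cs, rfl, h0, hcs⟩ := adm_cons.1 hbs
    obtain ⟨c, ds, rfl, h1, hds⟩ := adm_cons.1 hcs
    rw [flip_flip, Bool.xor_comm] at hds
    exact hf (xor b c :: ds) ⟨h0, hds⟩
  | cup i =>
    obtain ⟨b, cs, rfl, h0, hcs⟩ := adm_cons.1 hbs
    obtain ⟨c, ds, rfl, h1, hds⟩ := adm_cons.1 hcs
    rw [flip_flip] at hds
    cases b <;> cases c <;> simp [genVal] <;> left <;> exact hf ds hds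
  | cap i =>
    by_cases h0 : dotVal k i x = 0
    · simp [genVal, h0]
    · have h1 := hf (false :: false :: bs) ⟨h0, h0, hbs⟩
      have h2 := hf (true :: true :: bs) ⟨h0, by simpa using h0, by
        rw [flip_flip]; simpa using hbs⟩
      simp [genVal, h1, h2]
  | cross i j h =>
    obtain ⟨b, cs, rfl, h0, hcs⟩ := adm_cons.1 hbs
    obtain ⟨c, ds, rfl, h1, hds⟩ := adm_cons.1 hcs
    rw [dotVal_flip_far h] at h1
    rw [flip_comm h] at hds
    exact hf (c :: b :: ds) ⟨h1, by rwa [dotVal_flip_far h.symm], hds⟩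

theorem isLocal_diagOp {s t : Word n} (D : Diag s t) : IsLocal s t (diagOp k D) := by
  induction D with
  | nil w => intro x f f' hf bs hbs; exact hf bs hbs
  | cons L D ih =>
    obtain ⟨l, r, a, b, g, rfl, rfl⟩ := L
    intro x f f' hf bs hbs
    refine ih x _ _ (fun cs hcs => ?_) bs hbs
    have := (isLocal_genOp (k := k) g r).wordOp l
    simp only [List.append_assoc] at hf hcs
    exact this x f f' hf cs hcs

theorem wordOp_mul (l : Word n) (A B : StOp k n) : wordOp l (A * B) = wordOp l A * wordOp l B := by
  induction l with
  | nil => rfl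
  | cons i l ih =>
    rw [wordOp_cons, ih]
    funext x
    refine LinearMap.ext fun f => funext fun bs => ?_
    rcases bs with _ | ⟨b, bs⟩ <;> rfl

theorem wordOp_one (l : Word n) : wordOp l (1 : StOp k n) = 1 := by
  induction l with
  | nil => rfl
  | cons i l ih =>
    rw [wordOp_cons, ih]
    funext x
    refine LinearMap.ext fun f => funext fun bs => ?_
    rcases bs with _ | ⟨b, bs⟩ <;> rfl

theorem diagOp_whisker (l r : Word n) {s t : Word n} (D : Diag s t) :
    diagOp k (D.whisker l r) = wordOp l (diagOp k D) := by
  induction D with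
  | nil w => simp [whisker, wordOp_one]
  | cons L D ih => simp [whisker, diagOp, ih, wordOp_mul, Layer.whisker, wordOp_append]

end StateSum

end TLCat

/-! ### Invariance of the state sum and evaluation of morphisms. -/

namespace TLCat

open Diag

section StateSumRelations

variable {k : Type*} [Field k] {n : ℕ}

theorem genOp_interchange {a b c d : Word n} (g : Gen n a b) (h : Gen n c d) (m r : Word n) :
    AgreeOn (b ++ m ++ d ++ r) (wordOp (b ++ m) (genOp k h) * genOp k g)
      (genOp k g * wordOp (a ++ m) (genOp k h)) := by
  intro x f bs hbs
  simp only [List.append_assoc] at hbs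
  simp only [wordOp_append, Pi.mul_apply, Module.End.mul_apply]
  -- The piece `g` does not change the label of the region to its right, so of the other operator
  -- only linearity is used.
  set B := wordOp m (genOp k h) with hB
  have hsmul : ∀ (y : Label n) (c : k) (u : St k) (bs : List Bool),
      B y (fun cs => c * u cs) bs = c * B y u bs := fun y c u bs =>
    congrFun (map_smul (B y) c u) bs
  have hsub : ∀ (y : Label n) (u v : St k) (bs : List Bool),
      B y (fun cs => u cs - v cs) bs = B y u bs - B y v bs := fun y u v bs =>
    congrFun (map_sub (B y) u v) bs
  have hzero : ∀ (y : Label n) (bs : List Bool), B y (fun _ => 0) bs = 0 := fun y bs =>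
    congrFun (map_zero (B y)) bs
  clear_value B
  cases g with
  | startDot i =>
    obtain ⟨b, cs, rfl, h0, hcs⟩ := adm_cons.1 hbs
    cases b <;> simp [genOp_apply, genVal, hsmul, hzero]
  | endDot i =>
    have e : genOp k (.endDot i) x f =
      fun bs => dotVal k i x * dotVal k i x * f (false :: bs) := rfl
    simp [genOp_apply, genVal, e, hsmul]
  | merge i =>
    obtain ⟨b, cs, rfl, h0, hcs⟩ := adm_cons.1 hbs
    simp [genOp_apply, genVal, hsmul, hsub, flip_flip]
  | split i =>
    obtain ⟨b, cs, rfl, h0, hcs⟩ := adm_cons.1 hbs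
    obtain ⟨c, ds, rfl, h1, hds⟩ := adm_cons.1 hcs
    simp [genOp_apply, genVal, flip_flip, Bool.xor_comm]
  | cup i =>
    obtain ⟨b, cs, rfl, h0, hcs⟩ := adm_cons.1 hbs
    obtain ⟨c, ds, rfl, h1, hds⟩ := adm_cons.1 hcs
    cases b <;> cases c <;> simp [genOp_apply, genVal, flip_flip, hsmul, hzero]
  | cap i =>
    have e : genOp k (.cap i) x f =
      fun bs => dotVal k i x * (f (false :: false :: bs) - f (true :: true :: bs)) := rfl
    simp [genOp_apply, genVal, e, hsmul, hsub, flip_flip]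
  | cross i j h =>
    obtain ⟨b, cs, rfl, h0, hcs⟩ := adm_cons.1 hbs
    obtain ⟨c, ds, rfl, h1, hds⟩ := adm_cons.1 hcs
    simp [genOp_apply, genVal, flip_comm h]

theorem Isotopy.agreeOn {a b : Word n} {D D' : Diag a b} (h : Isotopy a b D D') (r : Word n) :
    AgreeOn (b ++ r) (diagOp k D) (diagOp k D') := by
  cases h with
  | interchange g h m =>
    have := genOp_interchange (k := k) g h m r
    simpa [diagOp_comp, diagOp_step] using this
  | zigzag_left i =>
    intro x f bs hbs
    obtain ⟨b, cs, rfl, h0, hcs⟩ := adm_cons.1 hbs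
    have := dotVal_sq h0
    cases b <;> simp [diagOp_comp, diagOp_one, genOp_apply, genVal, ← mul_assoc, this]
  | zigzag_right i =>
    intro x f bs hbs
    obtain ⟨b, cs, rfl, h0, hcs⟩ := adm_cons.1 hbs
    have := dotVal_sq h0
    cases b <;> simp [diagOp_comp, diagOp_one, genOp_apply, genVal, ← mul_assoc, this]
  | dot_left i =>
    intro x f bs hbs
    simp [diagOp_comp, diagOp_one, genOp_apply, genVal, ← mul_assoc]
  | dot_right i =>
    intro x f bs hbs
    simp [diagOp_comp, diagOp_one, genOp_apply, genVal, ← mul_assoc]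
  | trivalent_left i =>
    intro x f bs hbs
    obtain ⟨b, cs, rfl, h0, hcs⟩ := adm_cons.1 hbs
    obtain ⟨c, ds, rfl, h1, hds⟩ := adm_cons.1 hcs
    have := dotVal_sq h0
    cases b <;> cases c <;>
      simp [diagOp_comp, diagOp_one, genOp_apply, genVal, ← mul_assoc, this]
  | trivalent_right i =>
    intro x f bs hbs
    obtain ⟨b, cs, rfl, h0, hcs⟩ := adm_cons.1 hbs
    obtain ⟨c, ds, rfl, h1, hds⟩ := adm_cons.1 hcs
    have := dotVal_sq h0
    cases b <;> cases c <;>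
      simp [diagOp_comp, diagOp_one, genOp_apply, genVal, ← mul_assoc, this]
  | cross_rotate i j h h' =>
    intro x f bs hbs
    obtain ⟨b, cs, rfl, h0, hcs⟩ := adm_cons.1 hbs
    obtain ⟨c, ds, rfl, h1, hds⟩ := adm_cons.1 hcs
    have := dotVal_sq h0
    cases b <;> cases c <;>
      simp [diagOp_comp, diagOp_one, genOp_apply, genVal, ← mul_assoc, this, dotVal_flip_far h]
  | cross_cross i j h h' =>
    intro x f bs hbs
    obtain ⟨b, cs, rfl, h0, hcs⟩ := adm_cons.1 hbs
    obtain ⟨c, ds, rfl, h1, hds⟩ := adm_cons.1 hcs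
    simp [diagOp_comp, diagOp_one, genOp_apply, genVal]
  | cross_dot i j h =>
    intro x f bs hbs
    obtain ⟨b, cs, rfl, h0, hcs⟩ := adm_cons.1 hbs
    obtain ⟨c, ds, rfl, h1, hds⟩ := adm_cons.1 hcs
    cases c <;> simp [diagOp_comp, diagOp_one, genOp_apply, genVal, dotVal_flip_far h]
  | cross_trivalent i j h =>
    intro x f bs hbs
    obtain ⟨b, cs, rfl, h0, hcs⟩ := adm_cons.1 hbs
    obtain ⟨c, ds, rfl, h1, hds⟩ := adm_cons.1 hcs
    simp [diagOp_comp, diagOp_one, genOp_apply, genVal, dotVal_flip_far h]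
  | cross_cross_cross i j l hij hil hjl =>
    intro x f bs hbs
    obtain ⟨b, cs, rfl, h0, hcs⟩ := adm_cons.1 hbs
    obtain ⟨c, ds, rfl, h1, hds⟩ := adm_cons.1 hcs
    obtain ⟨d, es, rfl, h2, hes⟩ := adm_cons.1 hds
    simp [diagOp_comp, diagOp_one, genOp_apply, genVal]

/-- The operator of a combination of diagrams. -/
noncomputable def linOp (k : Type*) [Field k] {n : ℕ} {s t : Word n} :
    (Diag s t →₀ k) →ₗ[k] StOp k n :=
  Finsupp.lift _ k _ (diagOp k)

@[simp] theorem linOp_pic {s t : Word n} (D : Diag s t) : linOp k (pic k D) = diagOp k D := by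
  simp [linOp, pic]

theorem GraphRel.agreeOn {a b : Word n} {y : Diag a b →₀ k} (h : GraphRel k a b y) (r : Word n) :
    AgreeOn (b ++ r) (linOp k y) 0 := by
  cases h with
  | assoc i =>
    intro x f bs hbs
    obtain ⟨b, cs, rfl, h0, hcs⟩ := adm_cons.1 hbs
    obtain ⟨c, ds, rfl, h1, hds⟩ := adm_cons.1 hcs
    rw [map_sub, linOp_pic, linOp_pic]
    cases b <;> cases c <;>
      simp [diagOp_comp, diagOp_one, genOp_apply, genVal] <;> ring
  | unit i =>
    intro x f bs hbs
    obtain ⟨b, cs, rfl, h0, hcs⟩ := adm_cons.1 hbs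
    have := dotVal_sq h0
    rw [map_sub, linOp_pic, linOp_pic]
    simp [diagOp_comp, diagOp_one, genOp_apply, genVal, ← mul_assoc, this]
  | needle i =>
    intro x f bs hbs
    rw [linOp_pic]
    simp [diagOp_comp, diagOp_one, genOp_apply, genVal]
  | dot_same i =>
    intro x f bs hbs
    obtain ⟨b, cs, rfl, h0, hcs⟩ := adm_cons.1 hbs
    have := dotVal_sq h0
    rw [map_sub, map_add, map_smul, linOp_pic, linOp_pic, linOp_pic]
    cases b <;> simp [dotLeft, dotRight, brokenLine, diagOp_comp, diagOp_one, genOp_apply, genVal,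
      ← mul_assoc, this]
    ring
  | dot_near i j h =>
    intro x f bs hbs
    obtain ⟨b, cs, rfl, h0, hcs⟩ := adm_cons.1 hbs
    have h1 := dotVal_sq h0
    rw [map_sub, map_sub, map_add, linOp_pic, linOp_pic, linOp_pic, linOp_pic]
    cases b
    · simp [dotLeft, dotRight, brokenLine, diagOp_comp, diagOp_one, genOp_apply, genVal,
        ← mul_assoc, h1]
    · have h2 := dotVal_cube (k := k) j x
      have h3 := dotVal_cube (k := k) j (flip i true x)
      simp [dotLeft, dotRight, brokenLine, diagOp_comp, diagOp_one, genOp_apply, genVal,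
        ← mul_assoc, h1, h2, h3]
      rw [dotVal_flip_near h]
      ring
  | switch i j h =>
    intro x f bs hbs
    obtain ⟨b, cs, rfl, h0, hcs⟩ := adm_cons.1 hbs
    obtain ⟨c, ds, rfl, h1, hds⟩ := adm_cons.1 hcs
    obtain ⟨d, es, rfl, h2, hes⟩ := adm_cons.1 hds
    rw [map_add, linOp_pic, linOp_pic]
    simp only [diagOp_comp, diagOp_one]
    cases b
    · cases c
      · cases d
        · simp only [flip_false] at h1
          have h3 := dotVal_near h h0 h1
          have h4 := dotVal_sq h0
          simp [genOp_apply, genVal, h3]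
          linear_combination (-(dotVal k i x * dotVal k i x * f (false :: es))) * h4
        · simp [genOp_apply, genVal]
      -- If `f_i` and `f_j` are both nonzero they have opposite values. Flipping at the `j`-strand
      -- would then make `f_i` zero before the last `i`-strand, so this state is not admissible.
      · exfalso
        simp only [flip_false] at h1 h2
        have hji : Adjacent j i := Or.symm h
        rw [dotVal_flip_near hji, dotVal_near h h0 h1] at h2
        simp at h2
    · have h3 : dotVal k j x = 0 := by
        by_contra hne
        rw [dotVal_flip_near h, dotVal_near h h0 hne, neg_add_cancel] at h1
        exact h1 rfl
      cases c <;> cases d <;> simp [genOp_apply, genVal, h3]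

theorem diagOp_insert {s t a b : Word n} (l r : Word n) (p : Diag s (l ++ a ++ r))
    (q : Diag (l ++ b ++ r) t) (D : Diag a b) :
    diagOp k (Diag.insert l r p q D) = diagOp k q * (wordOp l (diagOp k D) * diagOp k p) := by
  rw [Diag.insert, diagOp_comp, diagOp_comp, diagOp_whisker, mul_assoc]

/-- Strands on the left only fix a prefix of the state and carry the label to the region where the
operator acts. A relation in context is thus reduced to the local one. -/
theorem Adm.wordOp_eval {l t : Word n} {x : Label n} {cs : List Bool} (h : Adm k (l ++ t) x cs) :
    ∃ (y : Label n) (us ds : List Bool), Adm k t y ds ∧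
      ∀ (A : StOp k n) (f : St k), wordOp l A x f cs = A y (fun es => f (us ++ es)) ds := by
  induction l generalizing x cs with
  | nil => exact ⟨x, [], cs, h, fun A f => rfl⟩
  | cons i l ih =>
    obtain ⟨b, cs, rfl, -, hcs⟩ := adm_cons.1 h
    obtain ⟨y, us, ds, hds, he⟩ := ih hcs
    exact ⟨y, b :: us, ds, hds, fun A f => by simp [he]⟩

/-- The value of morphisms at an admissible state. -/
noncomputable def homEval {s w : Word n} (x : Label n) (f : St k) (bs : List Bool)
    (hbs : Adm k w x bs) : HOM k s w →ₗ[k] k :=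
  (relations k s w).liftQ (Finsupp.lift k k _ fun D => diagOp k D x f bs) (by
    refine relations_le_ker _ ?_ ?_
    · intro a b l r p q D D' h
      simp only [pic, Finsupp.lift_apply, zero_smul, Finsupp.sum_single_index, one_smul,
        diagOp_insert]
      refine isLocal_diagOp q x _ _ (fun cs hcs => ?_) bs hbs
      rw [List.append_assoc] at hcs
      exact (h.agreeOn r).wordOp l x _ cs hcs
    · intro a b l r p q y h
      set g : (Diag a b →₀ k) →ₗ[k] St k :=
        Finsupp.lift _ k _ fun D => wordOp l (diagOp k D) x (diagOp k p x f) with hg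
      have h1 : ∀ y : Diag a b →₀ k, Finsupp.lift k k _ (fun D => diagOp k D x f bs)
          (Finsupp.mapDomain (Diag.insert l r p q) y) = diagOp k q x (g y) bs := by
        intro y
        induction y using Finsupp.induction_linear with
        | zero => simp
        | add u v hu hv => rw [Finsupp.mapDomain_add, map_add, hu, hv, map_add, map_add]; rfl
        | single D c => simp [hg, diagOp_insert]
      rw [h1]
      have h2 : ∀ cs, Adm k (l ++ b ++ r) x cs → g y cs = (0 : St k) cs := by
        intro cs hcs
        rw [List.append_assoc] at hcs
        obtain ⟨z, us, ds, hds, he⟩ := hcs.wordOp_eval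
        have h3 : ∀ y : Diag a b →₀ k, g y cs =
            linOp k y z (fun es => diagOp k p x f (us ++ es)) ds := by
          intro y
          induction y using Finsupp.induction_linear with
          | zero => simp
          | add u v hu hv => rw [map_add, map_add, Pi.add_apply, hu, hv]; rfl
          | single D c => simp [hg, linOp, he]
        rw [h3, h.agreeOn r z _ ds hds]
        rfl
      rw [isLocal_diagOp q x _ _ h2 bs hbs, map_zero]
      rfl)

theorem homEval_cls {s w : Word n} (x : Label n) (f : St k) (bs : List Bool)
    (hbs : Adm k w x bs) (D : Diag s w) : homEval x f bs hbs (cls k D) = diagOp k D x f bs := by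
  rw [homEval, cls, Submodule.mkQ_apply, Submodule.liftQ_apply]
  simp [pic]

theorem diagOp_doubleDot (i : Fin n) (x : Label n) (f : St k) :
    diagOp k (doubleDot i) x f = dotVal k i x • f := by
  funext bs
  simp [doubleDot, diagOp_comp, diagOp_one, genOp_apply, genVal, ← mul_assoc, dotVal_cube]

theorem diagOp_dotsOn (L : List (Fin n)) (e : Fin n →₀ ℕ) (x : Label n) (f : St k) :
    diagOp k (dotsOn L e) x f = (L.map fun i => dotVal k i x ^ e i).prod • f := by
  induction L generalizing f with
  | nil => simp [dotsOn]
  | cons i L ih =>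
    have h : ∀ (m : ℕ) (D : Diag ([] : Word n) []) (f : St k),
        diagOp k ((fun X => (doubleDot i).comp X)^[m] D) x f =
          dotVal k i x ^ m • diagOp k D x f := by
      intro m D
      induction m with
      | zero => simp
      | succ m ihm =>
        intro f
        rw [Function.iterate_succ_apply', diagOp_comp, Pi.mul_apply, Module.End.mul_apply,
          diagOp_doubleDot, map_smul, ihm, smul_smul, pow_succ']
    change diagOp k ((fun X => (doubleDot i).comp X)^[e i] (dotsOn L e)) x f = _
    rw [h, ih, smul_smul, List.map_cons, List.prod_cons]

theorem diagOp_phi (w : Word n) (x : Label n) (f : St k) :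
    diagOp k (phi w) x f (w.map fun _ => false) = (w.map fun i => dotVal k i x).prod * f [] := by
  induction w with
  | nil => simp [phi]
  | cons i w ih =>
    rw [List.map_const'] at ih
    simp [phi, diagOp_comp, diagOp_one, genOp_apply, genVal, ih, mul_assoc]

theorem adm_map_false {w : Word n} {x : Label n} (h : ∀ i ∈ w, dotVal k i x ≠ 0) :
    Adm k w x (w.map fun _ => false) := by
  induction w with
  | nil => rfl
  | cons i w ih => exact ⟨h i (by simp), ih fun j hj => h j (by simp [hj])⟩

/-- Evaluation of polynomial multiples of `phi w` at a label. -/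
theorem exists_eval (w : Word n) (x : Label n) : ∃ ev : HOM k [] w →ₗ[k] k,
    ∀ p, ev (polyMap k w p) =
      MvPolynomial.eval (fun i => dotVal k i x) p * (w.map fun i => dotVal k i x).prod := by
  by_cases h : ∀ i ∈ w, dotVal k i x ≠ 0
  · refine ⟨homEval x (fun _ => 1) _ (adm_map_false h), fun p => ?_⟩
    have : homEval x (fun _ => 1) _ (adm_map_false h) ∘ₗ polyMap k w =
        (w.map fun i => dotVal k i x).prod •
          (MvPolynomial.aeval (R := k) fun i => dotVal k i x).toLinearMap := by
      refine mvPolynomial_hom_ext fun e => ?_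
      have h1 := diagOp_dotsOn (k := k) (List.finRange n) e x fun _ => 1
      change diagOp k (doubleDots e) x _ = _ at h1
      rw [LinearMap.comp_apply, polyMap_monomial, homEval_cls, diagOp_comp, Pi.mul_apply,
        Module.End.mul_apply, diagOp_phi, h1]
      simp [MvPolynomial.aeval_monomial, Finsupp.prod_fintype, List.prod_ofFn, ← List.ofFn_eq_map]
    have := LinearMap.congr_fun this p
    rw [LinearMap.comp_apply] at this
    rw [this]
    simp [MvPolynomial.aeval_eq_eval, mul_comm]
  · refine ⟨0, fun p => ?_⟩
    push Not at h
    obtain ⟨i, hi, h0⟩ := h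
    rw [List.prod_eq_zero (List.mem_map.2 ⟨i, hi, h0⟩), mul_zero, LinearMap.zero_apply]

/-- There are labels with any prescribed set of non-vanishing double dots. -/
theorem exists_label (S : Finset (Fin n)) : ∃ x : Label n, ∀ i, dotVal k i x ≠ 0 ↔ i ∈ S := by
  classical
  -- The entry at `a` is the parity of the number of elements of `S` below `a`, so consecutive
  -- entries differ exactly at the elements of `S`.
  refine ⟨fun a => ((S.filter fun i => i.val < a.val).card % 2 == 1), fun i => ?_⟩
  have h : (S.filter fun j => j.val < i.succ.val) =
      (S.filter fun j => j.val < i.castSucc.val) ∪ (S.filter fun j => j = i) := by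
    ext j
    simp only [Finset.mem_filter, Finset.mem_union, Fin.val_succ, Fin.val_castSucc, Fin.ext_iff]
    constructor
    · rintro ⟨h1, h2⟩
      by_cases h3 : j.val = i.val
      · exact Or.inr ⟨h1, h3⟩
      · exact Or.inl ⟨h1, by omega⟩
    · rintro (⟨h1, h2⟩ | ⟨h1, h2⟩) <;> exact ⟨h1, by omega⟩
  have hd : Disjoint (S.filter fun j => j.val < i.castSucc.val) (S.filter fun j => j = i) := by
    rw [Finset.disjoint_filter]
    rintro j - h1 rfl
    simp at h1
  have hc : (S.filter fun j => j = i).card = if i ∈ S then 1 else 0 := by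
    rw [Finset.filter_eq']
    split_ifs <;> simp
  unfold dotVal
  beta_reduce
  rw [h, Finset.card_union_of_disjoint hd, hc]
  generalize (S.filter fun j => j.val < i.castSucc.val).card = m
  rcases Nat.mod_two_eq_zero_or_one m with hm | hm <;> by_cases hi : i ∈ S <;>
    simp [hi, hm, Nat.add_mod]

end StateSumRelations

end TLCat

namespace TLCat

open Diag

/-! ### Graded dimensions for increasing words -/

section Dimensions

variable {k : Type*} [Field k] {n : ℕ}

theorem degree_dotsOn (L : List (Fin n)) (e : Fin n →₀ ℕ) :
    (dotsOn L e).degree = 2 * ((L.map e).sum : ℕ) := by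
  induction L with
  | nil => simp [dotsOn]
  | cons i L ih =>
    have h : ∀ (m : ℕ) (D : Diag ([] : Word n) []),
        ((fun X => (doubleDot i).comp X)^[m] D).degree = 2 * (m : ℤ) + D.degree := by
      intro m D
      induction m with
      | zero => simp
      | succ m ihm =>
        rw [Function.iterate_succ_apply', degree_comp, ihm]
        simp [doubleDot, Gen.degree]
        ring
    change ((fun X => (doubleDot i).comp X)^[e i] (dotsOn L e)).degree = _
    rw [h, ih, List.map_cons, List.sum_cons]
    push_cast; ring

theorem degree_doubleDots (e : Fin n →₀ ℕ) : (doubleDots e).degree = 2 * (e.degree : ℤ) := by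
  have := degree_dotsOn (List.finRange n) e
  rw [← List.ofFn_eq_map, List.sum_ofFn, ← Finsupp.degree_eq_sum] at this
  exact this

theorem degree_phi (w : Word n) : (phi w).degree = w.length := by
  induction w with
  | nil => rfl
  | cons i w ih => simp [phi, ih, Gen.degree]

theorem homProj_polyMap (w : Word n) (r : ℕ) (p : MvPolynomial (Fin n) k) :
    homProj k [] w (2 * (r : ℤ) + w.length) (polyMap k w p) =
      polyMap k w (MvPolynomial.homogeneousComponent r p) := by
  have : homProj k [] w (2 * (r : ℤ) + w.length) ∘ₗ polyMap k w =
      polyMap k w ∘ₗ MvPolynomial.homogeneousComponent r := by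
    refine mvPolynomial_hom_ext fun e => ?_
    rw [LinearMap.comp_apply, LinearMap.comp_apply, polyMap_monomial, homProj_cls,
      MvPolynomial.homogeneousComponent_of_mem (MvPolynomial.isHomogeneous_monomial 1 rfl),
      degree_comp, degree_doubleDots, degree_phi]
    by_cases h : r = e.degree
    · subst h; simp [polyMap_monomial]
    · rw [if_neg (by omega), if_neg h, map_zero]
  exact LinearMap.congr_fun this p

theorem homProj_polyMap_eq_zero (w : Word n) {m : ℤ} (hm : ∀ r : ℕ, m ≠ 2 * (r : ℤ) + w.length)
    (p : MvPolynomial (Fin n) k) : homProj k [] w m (polyMap k w p) = 0 := by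
  have : homProj k [] w m ∘ₗ polyMap k w = 0 := by
    refine mvPolynomial_hom_ext fun e => ?_
    rw [LinearMap.comp_apply, polyMap_monomial, homProj_cls, degree_comp, degree_doubleDots,
      degree_phi, if_neg (hm e.degree).symm, LinearMap.zero_apply]
  exact LinearMap.congr_fun this p

theorem homProj_mem {s t : Word n} (m : ℤ) (x : HOM k s t) :
    homProj k s t m x ∈ homDeg k s t m := by
  induction x using hom_induction with
  | h0 => simp
  | hadd x y hx hy => rw [map_add]; exact add_mem hx hy
  | hcls c D =>
    rw [map_smul, homProj_cls]
    refine Submodule.smul_mem _ _ ?_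
    split_ifs with h
    · exact cls_mem_homDeg h
    · exact zero_mem _

theorem map_homogeneousSubmodule {w : Word n} (hw : w.Pairwise (· < ·)) (r : ℕ) :
    (MvPolynomial.homogeneousSubmodule (Fin n) k r).map (polyMap k w) =
      homDeg k [] w (2 * (r : ℤ) + w.length) := by
  apply le_antisymm
  · rintro _ ⟨p, hp, rfl⟩
    rw [← MvPolynomial.homogeneousComponent_eq_self hp, ← homProj_polyMap]
    exact homProj_mem _ _
  · intro x hx
    obtain ⟨p, rfl⟩ := polyMap_surjective (k := k) w hw x
    rw [← homProj_of_mem hx, homProj_polyMap]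
    exact ⟨_, MvPolynomial.homogeneousComponent_mem r p, rfl⟩

theorem homDeg_eq_bot {w : Word n} (hw : w.Pairwise (· < ·)) {m : ℤ}
    (hm : ∀ r : ℕ, m ≠ 2 * (r : ℤ) + w.length) : homDeg k [] w m = ⊥ := by
  rw [eq_bot_iff]
  intro x hx
  obtain ⟨p, rfl⟩ := polyMap_surjective (k := k) w hw x
  rw [← homProj_of_mem hx, homProj_polyMap_eq_zero w hm]
  exact zero_mem _

theorem homDeg_eq_span_monomials {w : Word n} (hw : w.Pairwise (· < ·)) (r : ℕ) :
    homDeg k [] w (2 * (r : ℤ) + w.length) = Submodule.span k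
      {x | ∃ e : Fin n →₀ ℕ, e.degree = r ∧ x = polyMap k w (MvPolynomial.monomial e 1)} := by
  rw [← map_homogeneousSubmodule hw]
  apply le_antisymm
  · rintro _ ⟨p, hp, rfl⟩
    have hp' : p.IsHomogeneous r := hp
    rw [MvPolynomial.as_sum p, map_sum]
    refine Submodule.sum_mem _ fun e he => ?_
    have hc : MvPolynomial.monomial e (p.coeff e) = p.coeff e • MvPolynomial.monomial e (1 : k) := by
      rw [MvPolynomial.smul_monomial, smul_eq_mul, mul_one]
    rw [hc, map_smul]
    refine Submodule.smul_mem _ _ (Submodule.subset_span ⟨e, ?_, rfl⟩)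
    have := hp' (MvPolynomial.mem_support_iff.1 he)
    rwa [Pi.one_def, ← Finsupp.degree_eq_weight_one] at this
  · refine Submodule.span_le.2 ?_
    rintro _ ⟨e, he, rfl⟩
    exact ⟨_, MvPolynomial.isHomogeneous_monomial 1 he, rfl⟩

theorem redMon_isHomogeneous (i : Fin n) {r : ℕ} {S : Finset (Fin n)} (h : S.card ≤ r) :
    (redMon k i r S).IsHomogeneous r := by
  have h1 := (MvPolynomial.isHomogeneous_X k i).pow (r - S.card)
  have h2 := MvPolynomial.IsHomogeneous.prod S (fun c => (MvPolynomial.X c : MvPolynomial (Fin n) k))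
    (fun _ => 1) fun c _ => MvPolynomial.isHomogeneous_X k c
  have := h1.mul h2
  simp only [one_mul, Finset.sum_const, smul_eq_mul, mul_one] at this
  rwa [Nat.sub_add_cancel h] at this

theorem polyMap_redMon_mem {w : Word n} (hw : w.Pairwise (· < ·)) (i : Fin n) {r : ℕ}
    {S : Finset (Fin n)} (h : S.card ≤ r) :
    polyMap k w (redMon k i r S) ∈ homDeg k [] w (2 * (r : ℤ) + w.length) := by
  rw [← map_homogeneousSubmodule hw]
  exact ⟨_, redMon_isHomogeneous i h, rfl⟩

/-- Vectors with a triangular matrix of values of functionals are linearly independent. -/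
theorem linearIndependent_of_triangular {ι M : Type*} [AddCommGroup M] [Module k M] (v : ι → M)
    (ev : ι → M →ₗ[k] k) (rk : ι → ℕ) (h₁ : ∀ a, ev a (v a) ≠ 0)
    (h₂ : ∀ a b, a ≠ b → ev a (v b) ≠ 0 → rk b < rk a) : LinearIndependent k v := by
  rw [linearIndependent_iff']
  intro s g hg a
  induction hr : rk a using Nat.strong_induction_on generalizing a with
  | _ N ih =>
  intro ha
  subst hr
  have h := congrArg (ev a) hg
  rw [map_sum, map_zero, Finset.sum_eq_single a] at h
  · simpa [h₁ a] using h
  · intro b hb hba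
    by_cases hev : ev a (v b) = 0
    · simp [hev]
    · simp [ih _ (h₂ a b hba.symm hev) b rfl hb]
  · intro h; exact absurd ha h

theorem card_filter_card_le {α : Type*} [DecidableEq α] (U : Finset α) (r : ℕ) :
    (U.powerset.filter fun S => S.card ≤ r).card = ∑ j ∈ Finset.range (r + 1), U.card.choose j := by
  rw [Finset.card_eq_sum_card_fiberwise (f := Finset.card) (t := Finset.range (r + 1))
    (fun S hS => by
      have := (Finset.mem_filter.1 hS).2
      simp; omega)]
  refine Finset.sum_congr rfl fun j hj => ?_
  rw [← Finset.card_powersetCard]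
  congr 1
  ext S
  simp only [Finset.mem_filter, Finset.mem_powerset, Finset.mem_powersetCard, Finset.mem_range] at hj ⊢
  constructor
  · rintro ⟨⟨h1, -⟩, h2⟩; exact ⟨h1, h2⟩
  · rintro ⟨h1, h2⟩; exact ⟨⟨h1, by omega⟩, h2⟩

theorem eval_redMon (i : Fin n) (r : ℕ) (S : Finset (Fin n)) (v : Fin n → k) :
    MvPolynomial.eval v (redMon k i r S) = v i ^ (r - S.card) * ∏ c ∈ S, v c := by
  simp [redMon, map_prod]

theorem card_notMem {w : Word n} (hw : w.Pairwise (· < ·)) :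
    (Finset.univ.filter fun c => c ∉ w).card = n - w.length := by
  have h1 : (Finset.univ.filter fun c => c ∉ w) = (w.toFinset)ᶜ := by ext; simp
  have hnd : w.Nodup := hw.imp fun h => h.ne
  rw [h1, Finset.card_compl, Fintype.card_fin, List.toFinset_card_of_nodup hnd]

/-- A finite set of vectors that spans a submodule and is independent is a basis of it. -/
theorem finite_and_finrank_eq_card {ι M : Type*} [AddCommGroup M] [Module k M] (s : Finset ι)
    (v : ι → M) (N : Submodule k M) (hN : N = Submodule.span k (v '' s))
    (hv : LinearIndependent k fun a : s => v a) :
    Module.Finite k N ∧ Module.finrank k N = s.card := by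
  have hr : v '' s = Set.range fun a : s => v a := by
    ext x; simp
  rw [hN, hr]
  refine ⟨Module.Finite.span_of_finite k (Set.finite_range _), ?_⟩
  rw [finrank_span_eq_card hv, Fintype.card_coe]

/-- The reduced monomials form a basis. At a label whose non-vanishing double dots are `T ∪ w`, the
power of `f_i` is nonzero because `i ∈ w`, so the monomial of `S` survives exactly when `S ⊆ T`, as
`S` avoids `w`. -/
theorem finrank_homDeg_of_ne_nil {w : Word n} (hw : w.Pairwise (· < ·)) (hne : w ≠ []) (r : ℕ) :
    Module.Finite k (homDeg k [] w (2 * (r : ℤ) + w.length)) ∧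
      Module.finrank k (homDeg k [] w (2 * (r : ℤ) + w.length)) =
        ∑ j ∈ Finset.range (r + 1), (n - w.length).choose j := by
  classical
  obtain ⟨i, hi⟩ := List.exists_mem_of_ne_nil w hne
  rw [← card_notMem hw, ← card_filter_card_le]
  refine finite_and_finrank_eq_card _ (fun S => polyMap k w (redMon k i r S)) _ ?_ ?_
  · apply le_antisymm
    · rw [homDeg_eq_span_monomials hw]
      refine Submodule.span_le.2 ?_
      rintro _ ⟨e, rfl, rfl⟩
      refine Submodule.span_mono ?_ (polyMap_monomial_mem_span hw hi e)
      rintro _ ⟨S, hS, hr, rfl⟩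
      refine ⟨S, ?_, rfl⟩
      simpa [Finset.subset_iff] using ⟨fun c hc => hS c hc, hr⟩
    · refine Submodule.span_le.2 ?_
      rintro _ ⟨S, hS, rfl⟩
      exact polyMap_redMon_mem hw i (Finset.mem_filter.1 hS).2
  · choose x hx using fun T : Finset (Fin n) => exists_label (k := k) T
    choose ev hev using fun x : Label n => exists_eval (k := k) w x
    have key : ∀ S T : Finset (Fin n),
        ev (x (T ∪ w.toFinset)) (polyMap k w (redMon k i r S)) ≠ 0 ↔ S ⊆ T ∪ w.toFinset := by
      intro S T
      have hiw : dotVal k i (x (T ∪ w.toFinset)) ≠ 0 := (hx _ i).2 (by simp [hi])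
      have hww : (w.map fun i => dotVal k i (x (T ∪ w.toFinset))).prod ≠ 0 := by
        rw [Ne, List.prod_eq_zero_iff, List.mem_map]
        rintro ⟨j, hj, h0⟩
        exact (hx _ j).2 (by simp [hj]) h0
      rw [hev, eval_redMon, mul_ne_zero_iff, mul_ne_zero_iff, Finset.prod_ne_zero_iff]
      simp only [hx]
      exact ⟨fun h => h.1.2, fun h => ⟨⟨pow_ne_zero _ hiw, h⟩, hww⟩⟩
    refine linearIndependent_of_triangular _ (fun S => ev (x (S.1 ∪ w.toFinset)))
      (fun S => S.1.card) ?_ ?_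
    · intro S
      exact (key _ _).2 Finset.subset_union_left
    · intro S S' hne h
      have hsub := (key _ _).1 h
      refine Finset.card_lt_card (Finset.ssubset_iff_subset_ne.2 ⟨fun c hc => ?_, fun h =>
        hne (Subtype.ext h.symm)⟩)
      rcases Finset.mem_union.1 (hsub hc) with h | h
      · exact h
      · have := Finset.mem_powerset.1 (Finset.mem_filter.1 S'.2).1 hc
        simp only [Finset.mem_filter, Finset.mem_univ, true_and] at this
        exact absurd (List.mem_toFinset.1 h) this

theorem finrank_homDeg_nil_zero :
    Module.Finite k (homDeg k ([] : Word n) [] 0) ∧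
      Module.finrank k (homDeg k ([] : Word n) [] 0) = 1 := by
  have h0 := homDeg_eq_span_monomials (k := k) (w := ([] : Word n)) List.Pairwise.nil 0
  simp only [List.length_nil, Nat.cast_zero, mul_zero, add_zero] at h0
  have := finite_and_finrank_eq_card (k := k) {()}
    (fun _ : Unit => polyMap k ([] : Word n) 1) (homDeg k ([] : Word n) [] 0) ?_ ?_
  · simpa using this
  · rw [h0]
    congr 1
    ext x
    simp only [Finsupp.degree_eq_zero_iff]
    constructor
    · rintro ⟨e, rfl, rfl⟩; exact ⟨(), by simp, rfl⟩
    · rintro ⟨_, -, rfl⟩; exact ⟨0, rfl, rfl⟩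
  · obtain ⟨x, hx⟩ := exists_label (k := k) (∅ : Finset (Fin n))
    obtain ⟨ev, hev⟩ := exists_eval (k := k) [] x
    refine linearIndependent_of_triangular _ (fun _ => ev) (fun _ => 0) ?_ ?_
    · intro _; rw [hev]; simp
    · intro a b hab; exact absurd (Subsingleton.elim a b) hab

/-- Here the repeated colour is the minimum of `S`, so the empty set gives no monomial. The `+ 1`
counts this missing set and accounts for the term `-t²` in the prescribed value `(1, 1)`. -/
theorem finrank_homDeg_nil_succ (r : ℕ) :
    Module.Finite k (homDeg k ([] : Word n) [] (2 * ((r + 1 : ℕ) : ℤ))) ∧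
      Module.finrank k (homDeg k ([] : Word n) [] (2 * ((r + 1 : ℕ) : ℤ))) + 1 =
        ∑ j ∈ Finset.range (r + 2), n.choose j := by
  classical
  have hcard := card_filter_card_le (Finset.univ : Finset (Fin n)) (r + 1)
  rw [Finset.card_univ, Fintype.card_fin] at hcard
  set I := (Finset.univ : Finset (Fin n)).powerset.filter fun S => S.card ≤ r + 1 with hI
  have hmem : ∅ ∈ I := by simp [hI]
  -- The value at `∅` is a default; that index is erased below.
  set v : Finset (Fin n) → HOM k ([] : Word n) [] := fun S =>
    if hS : S.Nonempty then polyMap k [] (redMon k (S.min' hS) (r + 1) S) else 0 with hv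
  have h0 := homDeg_eq_span_monomials (k := k) (w := ([] : Word n)) List.Pairwise.nil (r + 1)
  simp only [List.length_nil, Nat.cast_zero, add_zero] at h0
  have := finite_and_finrank_eq_card (k := k) (I.erase ∅) v
    (homDeg k ([] : Word n) [] (2 * ((r + 1 : ℕ) : ℤ))) ?_ ?_
  · refine ⟨this.1, ?_⟩
    rw [this.2, Finset.card_erase_add_one hmem, hcard]
  · apply le_antisymm
    · rw [h0]
      refine Submodule.span_le.2 ?_
      rintro _ ⟨e, he, rfl⟩
      have hne : e ≠ 0 := by rintro rfl; simp at he
      refine Submodule.span_mono ?_ (polyMap_nil_monomial_mem_span e hne)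
      rintro _ ⟨S, hS, hr, rfl⟩
      refine ⟨S, ?_, ?_⟩
      · simp [hI, hS.ne_empty]; omega
      · simp [hv, hS, he]
    · refine Submodule.span_le.2 ?_
      rintro _ ⟨S, hS, rfl⟩
      rw [Finset.mem_coe, Finset.mem_erase, hI, Finset.mem_filter] at hS
      have hne : S.Nonempty := Finset.nonempty_iff_ne_empty.2 hS.1
      have := polyMap_redMon_mem (k := k) (w := ([] : Word n)) List.Pairwise.nil (S.min' hne)
        hS.2.2
      simpa [hv, hne] using this
  · choose x hx using fun T : Finset (Fin n) => exists_label (k := k) T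
    choose ev hev using fun x : Label n => exists_eval (k := k) [] x
    have key : ∀ S T : Finset (Fin n), S.Nonempty →
        (ev (x T) (v S) ≠ 0 ↔ S ⊆ T) := by
      intro S T hS
      simp only [hv, hS, dif_pos]
      rw [hev, eval_redMon, List.map_nil, List.prod_nil, mul_one, mul_ne_zero_iff,
        Finset.prod_ne_zero_iff]
      simp only [hx]
      constructor
      · intro h; exact fun c hc => h.2 c hc
      · intro h
        exact ⟨pow_ne_zero _ ((hx _ _).2 (h (Finset.min'_mem _ _))), fun c hc => h hc⟩
    have hne : ∀ S : (I.erase ∅), S.1.Nonempty := fun S =>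
      Finset.nonempty_iff_ne_empty.2 (Finset.mem_erase.1 S.2).1
    refine linearIndependent_of_triangular _ (fun S => ev (x S.1)) (fun S => S.1.card) ?_ ?_
    · intro S
      exact (key _ _ (hne S)).2 (Finset.Subset.refl _)
    · intro S S' hSS h
      exact Finset.card_lt_card (Finset.ssubset_iff_subset_ne.2
        ⟨(key _ _ (hne S')).1 h, fun h => hSS (Subtype.ext h.symm)⟩)

/-! ### Expansion of the prescribed values -/

theorem geom_coeff_neg {m : ℤ} (hm : m < 0) : geom.coeff m = 0 := by
  have := PowerSeries.coeff_coe (R := ℤ) (PowerSeries.invOfUnit (1 - PowerSeries.X ^ 2) 1) m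
  rw [if_pos hm] at this
  exact this

theorem tt_pow (d : ℕ) : tt ^ d = HahnSeries.single (d : ℤ) 1 := by
  simp [tt, HahnSeries.single_pow]

theorem coeff_tt_pow_mul (d : ℕ) (y : LaurentSeries ℤ) (m : ℤ) :
    (tt ^ d * y).coeff m = y.coeff (m - d) := by
  rw [tt_pow, HahnSeries.coeff_single_mul, one_mul]

theorem geom_coeff_sub (m : ℤ) :
    geom.coeff m - geom.coeff (m - 2) = if m = 0 then 1 else 0 := by
  have h := congrArg (fun y : LaurentSeries ℤ => y.coeff m) geom_mul
  have h2 := coeff_tt_pow_mul 2 geom m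
  simp only [sub_mul, one_mul, HahnSeries.coeff_sub, HahnSeries.coeff_one] at h
  rw [h2] at h
  exact_mod_cast h

theorem coeff_geom_even (r : ℕ) : geom.coeff (2 * (r : ℤ)) = 1 := by
  induction r with
  | zero =>
    have := geom_coeff_sub 0
    rw [geom_coeff_neg (m := 0 - 2) (by norm_num)] at this
    simpa using this
  | succ r ih =>
    have := geom_coeff_sub (2 * ((r + 1 : ℕ) : ℤ))
    rw [if_neg (by push_cast; omega), show 2 * ((r + 1 : ℕ) : ℤ) - 2 = 2 * (r : ℤ) by
      push_cast; ring, ih] at this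
    linarith

theorem coeff_geom_other {m : ℤ} (hm : ∀ r : ℕ, m ≠ 2 * (r : ℤ)) : geom.coeff m = 0 := by
  rcases lt_or_ge m 0 with h | h
  · exact geom_coeff_neg h
  · obtain ⟨a, rfl⟩ := Int.eq_ofNat_of_zero_le h
    induction a using Nat.strong_induction_on with
    | _ a ih =>
    have := geom_coeff_sub (a : ℤ)
    rw [if_neg (by simpa using hm 0)] at this
    have h2 : geom.coeff ((a : ℤ) - 2) = 0 := by
      rcases lt_or_ge ((a : ℤ) - 2) 0 with h' | h'
      · exact geom_coeff_neg h'
      · have e : (a : ℤ) - 2 = ((a - 2 : ℕ) : ℤ) := by omega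
        rw [e]
        refine ih (a - 2) (by omega) (fun r hr => hm (r + 1) ?_) (by omega)
        push_cast; omega
    linarith

/-- Multiplication by `geom` forms partial sums, and Pascal's rule gives the step from `N` to `N +
1`. -/
theorem coeff_pow_mul_geom (N : ℕ) :
    (∀ r : ℕ, ((1 + tt ^ 2) ^ N * geom).coeff (2 * (r : ℤ)) =
      ((∑ j ∈ Finset.range (r + 1), N.choose j : ℕ) : ℤ)) ∧
    ∀ m : ℤ, (∀ r : ℕ, m ≠ 2 * (r : ℤ)) → ((1 + tt ^ 2) ^ N * geom).coeff m = 0 := by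
  induction N with
  | zero =>
    refine ⟨fun r => ?_, fun m hm => ?_⟩
    · rw [pow_zero, one_mul, coeff_geom_even, Finset.sum_range_succ']
      simp
    · rw [pow_zero, one_mul, coeff_geom_other hm]
  | succ N ih =>
    obtain ⟨ih1, ih2⟩ := ih
    have hrec : ∀ m : ℤ, ((1 + tt ^ 2) ^ (N + 1) * geom).coeff m =
        ((1 + tt ^ 2) ^ N * geom).coeff m + ((1 + tt ^ 2) ^ N * geom).coeff (m - 2) := by
      intro m
      have := coeff_tt_pow_mul 2 ((1 + tt ^ 2) ^ N * geom) m
      rw [pow_succ', mul_assoc, add_mul, one_mul, HahnSeries.coeff_add, this]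
      rfl
    refine ⟨fun r => ?_, fun m hm => ?_⟩
    · rw [hrec, ih1]
      rcases r with _ | r
      · rw [ih2 _ (by intro r; push_cast; omega)]
        simp
      · rw [show 2 * ((r + 1 : ℕ) : ℤ) - 2 = 2 * (r : ℤ) by push_cast; ring, ih1,
          Finset.sum_range_succ' _ (r + 1), Finset.sum_range_succ' _ (r + 1)]
        simp only [Nat.choose_succ_succ, Finset.sum_add_distrib, Nat.choose_zero_right]
        push_cast; ring
    · rw [hrec, ih2 m hm, ih2 (m - 2) (fun r hr => hm (r + 1) (by push_cast; omega)), add_zero]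

theorem tt_pow_mul_qTwo_pow {d : ℕ} (h : d ≤ n) :
    tt ^ n * qTwo ^ (n - d) = tt ^ d * (1 + tt ^ 2) ^ (n - d) := by
  have h1 : tt * qTwo = 1 + tt ^ 2 := by
    rw [tt_pow, tt, qTwo, mul_add, HahnSeries.single_mul_single, HahnSeries.single_mul_single,
      add_comm]
    simp
  obtain ⟨m, rfl⟩ := Nat.exists_eq_add_of_le h
  rw [Nat.add_sub_cancel_left, pow_add, mul_assoc, ← mul_pow, h1]

end Dimensions

end TLCat

namespace TLCat

/-! ### Reduction of words -/

section Words

variable {n : ℕ}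

/-- Properties of words that are compatible with the Temperley-Lieb relations. -/
structure TLClosed (P : Word n → Prop) : Prop where
  double : ∀ (l r : Word n) (i : Fin n), P (l ++ i :: r) → P (l ++ i :: i :: r)
  sandwich : ∀ (l r : Word n) (i j : Fin n), Adjacent i j → P (l ++ i :: r) →
    P (l ++ i :: j :: i :: r)
  swap : ∀ (l r : Word n) (i j : Fin n), Distant i j → P (l ++ i :: j :: r) →
    P (l ++ j :: i :: r)

/-- `P` holds for a word with a factor `u` if it holds with the factor `v` instead. -/
def Reduces (P : Word n → Prop) (u v : Word n) : Prop :=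
  ∀ l r : Word n, P (l ++ (v ++ r)) → P (l ++ (u ++ r))

variable {P : Word n → Prop}

theorem Reduces.refl (u : Word n) : Reduces P u u := fun _ _ h => h

theorem Reduces.trans {u v w : Word n} (h₁ : Reduces P u v) (h₂ : Reduces P v w) :
    Reduces P u w := fun l r h => h₁ l r (h₂ l r h)

theorem Reduces.context {u v : Word n} (h : Reduces P u v) (a b : Word n) :
    Reduces P (a ++ (u ++ b)) (a ++ (v ++ b)) := by
  intro l r hP
  have := h (l ++ a) (b ++ r)
  simp only [List.append_assoc] at this hP ⊢
  exact this hP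

theorem TLClosed.reduces_past (hP : TLClosed P) (c : Fin n) (x : Word n)
    (hx : ∀ i ∈ x, Distant c i) : Reduces P (c :: x) (x ++ [c]) := by
  induction x with
  | nil => exact Reduces.refl _
  | cons i x ih =>
    have h1 : Reduces P (c :: i :: x) (i :: c :: x) := by
      intro l r h
      exact hP.swap l (x ++ r) i c (hx i (by simp)).symm h
    have h2 := (ih fun j hj => hx j (by simp [hj])).context [i] []
    simp only [List.append_nil, List.cons_append, List.nil_append] at h2
    exact h1.trans h2

theorem TLClosed.reduces_past' (hP : TLClosed P) (c : Fin n) (x : Word n)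
    (hx : ∀ i ∈ x, Distant c i) : Reduces P (x ++ [c]) (c :: x) := by
  induction x with
  | nil => exact Reduces.refl _
  | cons i x ih =>
    have h1 : Reduces P (i :: c :: x) (c :: i :: x) := by
      intro l r h
      exact hP.swap l (x ++ r) c i (hx i (by simp)) h
    have h2 := (ih fun j hj => hx j (by simp [hj])).context [i] []
    simp only [List.append_nil, List.cons_append, List.nil_append] at h2
    exact h2.trans h1

theorem exists_split_of_two_le_count {c : Fin n} {w : Word n} (h : 2 ≤ w.count c) :
    ∃ a x b : Word n, w = a ++ c :: (x ++ c :: b) ∧ c ∉ x := by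
  obtain ⟨a, w', rfl, ha⟩ :=
    List.eq_append_cons_of_mem (List.count_pos_iff.1 (by omega : 0 < w.count c))
  have h' : 0 < w'.count c := by
    rw [List.count_append, List.count_eq_zero.2 ha, List.count_cons_self] at h
    omega
  obtain ⟨x, b, rfl, hx⟩ := List.eq_append_cons_of_mem (List.count_pos_iff.1 h')
  exact ⟨a, x, b, rfl, hx⟩

/-- Every word reduces to a word in which the greatest colour occurs at most once. -/
theorem TLClosed.exists_reduces (hP : TLClosed P) (m : ℕ) (w : Word n)
    (hw : ∀ i ∈ w, i.val < m + 1) : ∃ v, Reduces P w v ∧ (∀ i ∈ v, i.val < m + 1) ∧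
      ∀ c : Fin n, c.val = m → v.count c ≤ 1 := by
  induction m generalizing w with
  | zero =>
    induction hN : w.length using Nat.strong_induction_on generalizing w with
    | _ N ih =>
    subst hN
    match w, hw, ih with
    | [], _, _ => exact ⟨[], Reduces.refl _, by simp, by simp⟩
    | [i], hw, _ =>
      exact ⟨[i], Reduces.refl _, hw, fun c _ => by
        have := List.count_le_length (a := c) (l := [i]); simpa using this⟩
    | i :: j :: w, hw, ih =>
      have hij : i = j := by
        have h1 := hw i (by simp)
        have h2 := hw j (by simp)
        exact Fin.ext (by omega)
      subst hij
      obtain ⟨v, h1, h2, h3⟩ := ih (i :: w).length (by simp) (i :: w)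
        (fun c hc => hw c (by simp only [List.mem_cons] at hc ⊢; tauto)) rfl
      refine ⟨v, Reduces.trans ?_ h1, h2, h3⟩
      intro l r h
      exact hP.double l (w ++ r) i h
  | succ m ih =>
    by_cases hm : m + 1 < n
    swap
    · exact ⟨w, Reduces.refl _, hw, fun c hc => absurd c.2 (by omega)⟩
    set c : Fin n := ⟨m + 1, hm⟩ with hc
    suffices h : ∀ N, ∀ w : Word n, w.count c = N → (∀ i ∈ w, i.val < m + 2) →
        ∃ v, Reduces P w v ∧ (∀ i ∈ v, i.val < m + 2) ∧ v.count c ≤ 1 by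
      obtain ⟨v, h1, h2, h3⟩ := h _ w rfl hw
      refine ⟨v, h1, h2, fun c' hc' => ?_⟩
      rwa [show c' = c from Fin.ext hc']
    intro N
    induction N using Nat.strong_induction_on with
    | _ N ihN =>
    intro w hN hw
    by_cases hN1 : N ≤ 1
    · exact ⟨w, Reduces.refl _, hw, by omega⟩
    -- Between two successive occurrences of the top colour `c = m + 1`, the word can be reduced to
    -- contain `m` at most once. If `m` is absent, one `c` commutes to the other and `cc` shortens;
    -- otherwise everything else commutes away and `c m c` becomes `c`. Either way one occurrence of
    -- `c` disappears.
    obtain ⟨a, x, b, rfl, hcx⟩ := exists_split_of_two_le_count (c := c) (w := w) (by omega)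
    have hx : ∀ i ∈ x, i.val < m + 1 := by
      intro i hi
      have h1 := hw i (by simp [hi])
      have h2 : i.val ≠ m + 1 := fun h => hcx (by rwa [show i = c from Fin.ext h] at hi)
      omega
    obtain ⟨x', hxx', hx', hcount⟩ := ih x hx
    have hred : Reduces P (a ++ c :: (x ++ c :: b)) (a ++ c :: (x' ++ c :: b)) := by
      have := hxx'.context (a ++ [c]) (c :: b)
      simpa using this
    have hfar : ∀ y : Word n, (∀ i ∈ y, i.val < m) → ∀ i ∈ y, Distant c i := by
      intro y hy i hi
      exact Or.inr (by simpa [hc] using hy i hi)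
    have hnot : ∀ y : Word n, (∀ i ∈ y, i.val < m + 1) → y.count c = 0 := by
      intro y hy
      rw [List.count_eq_zero]
      intro h
      have := hy c h
      simp [hc] at this
    have hcnt : (a ++ c :: (x ++ c :: b)).count c = a.count c + b.count c + 2 := by
      simp [List.count_append, hnot x hx]; omega
    have hwa : ∀ i ∈ a, i.val < m + 2 := fun i hi => hw i (by simp [hi])
    have hwb : ∀ i ∈ b, i.val < m + 2 := fun i hi => hw i (by simp [hi])
    have hcm : c.val < m + 2 := by simp [hc]
    obtain ⟨v, h1, h2, h3⟩ : ∃ v : Word n, Reduces P (c :: (x' ++ [c])) v ∧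
        (∀ i ∈ v, i.val < m + 2) ∧ v.count c = 1 := by
      by_cases hd : ∃ d ∈ x', d.val = m
      · obtain ⟨d, hdx, hdm⟩ := hd
        obtain ⟨y, z, rfl, hdy⟩ := List.eq_append_cons_of_mem hdx
        have hz : d ∉ z := by
          have h := hcount d hdm
          rw [List.count_append, List.count_cons_self] at h
          exact List.count_eq_zero.1 (by omega)
        have lt : ∀ u : Word n, (∀ i ∈ u, i.val < m + 1) → d ∉ u → ∀ i ∈ u, i.val < m := by
          intro u hu hdu i hi
          have h1 := hu i hi
          have h2 : i.val ≠ m := fun h => hdu (by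
            rwa [show i = d from Fin.ext (h.trans hdm.symm)] at hi)
          omega
        have hylt := lt y (fun i hi => hx' i (by simp [hi])) hdy
        have hzlt := lt z (fun i hi => hx' i (by simp [hi])) hz
        refine ⟨y ++ c :: z, ?_, ?_, ?_⟩
        · have e1 := (hP.reduces_past c y (hfar y hylt)).context [] (d :: (z ++ [c]))
          have e2 := (hP.reduces_past' c z (hfar z hzlt)).context (y ++ [c, d]) []
          have e3 : Reduces P (y ++ c :: d :: c :: z) (y ++ c :: z) := by
            intro l r h
            have := hP.sandwich (l ++ y) (z ++ r) c d (Or.inr (by simp [hc, hdm]))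
            simp only [List.append_assoc, List.cons_append] at this h ⊢
            exact this h
          simp only [List.append_nil, List.nil_append, List.append_assoc, List.cons_append]
            at e1 e2 e3 ⊢
          exact (e1.trans e2).trans e3
        · intro i hi
          rcases List.mem_append.1 hi with h | h
          · have := hylt i h; omega
          · rcases List.mem_cons.1 h with h | h
            · rw [h]; exact hcm
            · have := hzlt i h; omega
        · rw [List.count_append, List.count_cons_self, hnot y fun i hi => by
            have := hylt i hi; omega, hnot z fun i hi => by have := hzlt i hi; omega]
      · push Not at hd
        have hlt : ∀ i ∈ x', i.val < m := by
          intro i hi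
          have h1 := hx' i hi
          have h2 := hd i hi
          omega
        refine ⟨x' ++ [c], ?_, ?_, ?_⟩
        · have e1 := (hP.reduces_past c x' (hfar x' hlt)).context [] [c]
          have e2 : Reduces P (x' ++ [c, c]) (x' ++ [c]) := by
            intro l r h
            have := hP.double (l ++ x') r c
            simp only [List.append_assoc, List.cons_append, List.nil_append] at this h ⊢
            exact this h
          simp only [List.nil_append, List.append_assoc, List.cons_append]
            at e1 e2 ⊢
          exact e1.trans e2
        · intro i hi
          rcases List.mem_append.1 hi with h | h
          · have := hlt i h; omega
          · rw [List.mem_singleton.1 h]; exact hcm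
        · rw [List.count_append, hnot x' hx']; simp
    have hred2 : Reduces P (a ++ c :: (x' ++ c :: b)) (a ++ (v ++ b)) := by
      have := h1.context a b
      simpa using this
    obtain ⟨u, hu1, hu2, hu3⟩ := ihN ((a ++ (v ++ b)).count c) (by
        rw [← hN, hcnt, List.count_append, List.count_append, h3]; omega) (a ++ (v ++ b)) rfl (by
        intro i hi
        simp only [List.mem_append] at hi
        rcases hi with h | h | h
        · exact hwa i h
        · exact h2 i h
        · exact hwb i h)
    exact ⟨u, (hred.trans hred2).trans hu1, hu2, hu3⟩

theorem rotate_append (hrot : ∀ (i : Fin n) (v : Word n), P (i :: v) → P (v ++ [i]))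
    (u v : Word n) (h : P (u ++ v)) : P (v ++ u) := by
  induction u generalizing v with
  | nil => simpa using h
  | cons i u ih =>
    have h1 := hrot i (u ++ v) h
    rw [List.append_assoc] at h1
    have := ih (v ++ [i]) h1
    simpa using this

/-- A property compatible with the Temperley-Lieb relations and with rotation holds for all words
if it holds for increasing words. -/
theorem TLClosed.forall_of_increasing (hP : TLClosed P)
    (hrot : ∀ (i : Fin n) (v : Word n), P (i :: v) → P (v ++ [i]))
    (hinc : ∀ w : Word n, w.Pairwise (· < ·) → P w) (w : Word n) : P w := by
  suffices h : ∀ (m : ℕ) (w t : Word n), (∀ i ∈ w, i.val < m) → (∀ i ∈ t, m ≤ i.val) →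
      t.Pairwise (· < ·) → P (w ++ t) by
    have := h n w [] (fun i _ => i.2) (by simp) List.Pairwise.nil
    simpa using this
  intro m
  induction m with
  | zero =>
    intro w t hw _ ht
    have : w = [] := List.eq_nil_iff_forall_not_mem.2 fun i hi => by simpa using hw i hi
    subst this
    exact hinc t ht
  | succ m ih =>
    intro w t hw ht htp
    obtain ⟨v, h1, h2, h3⟩ := hP.exists_reduces m w hw
    refine h1 [] t ?_
    rw [List.nil_append]
    -- Write `v = a c b` with `c` the only letter `m`. The letters of `b` are below `m`, hence
    -- distant from those of `t`. So `b` moves to the end, is rotated to the front, and `c` joins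
    -- the increasing part `t`.
    by_cases hc : ∃ c ∈ v, c.val = m
    · obtain ⟨c, hcv, hcm⟩ := hc
      obtain ⟨a, b, rfl, hca⟩ := List.eq_append_cons_of_mem hcv
      have hcb : c ∉ b := by
        have h := h3 c hcm
        rw [List.count_append, List.count_cons_self] at h
        exact List.count_eq_zero.1 (by omega)
      have lt : ∀ u : Word n, (∀ i ∈ u, i.val < m + 1) → c ∉ u → ∀ i ∈ u, i.val < m := by
        intro u hu hdu i hi
        have h1 := hu i hi
        have h2 : i.val ≠ m := fun h => hdu (by
          rwa [show i = c from Fin.ext (h.trans hcm.symm)] at hi)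
        omega
      have ha := lt a (fun i hi => h2 i (by simp [hi])) hca
      have hb := lt b (fun i hi => h2 i (by simp [hi])) hcb
      have hmove : ∀ u : Word n, (∀ i ∈ u, i.val < m) → Reduces P (u ++ t) (t ++ u) := by
        intro u hu
        induction u with
        | nil => simpa using Reduces.refl t
        | cons i u ihu =>
          have e1 := (ihu fun j hj => hu j (by simp [hj])).context [i] []
          have e2 := (hP.reduces_past i t fun j hj => by
            have h1 := hu i (by simp)
            have h2 := ht j hj
            exact Or.inl (by omega)).context [] u
          simp only [List.append_nil, List.nil_append, List.append_assoc, List.cons_append]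
            at e1 e2 ⊢
          exact e1.trans e2
      have e := (hmove b hb).context (a ++ [c]) [] [] []
      simp only [List.append_nil, List.nil_append, List.append_assoc, List.cons_append] at e ⊢
      refine e ?_
      have hP' := ih (b ++ a) (c :: t) (by
        intro i hi
        rcases List.mem_append.1 hi with h | h
        · exact hb i h
        · exact ha i h) (by
        intro i hi
        rcases List.mem_cons.1 hi with h | h
        · rw [h, hcm]
        · have := ht i h; omega) (by
        rw [List.pairwise_cons]
        refine ⟨fun i hi => ?_, htp⟩
        have := ht i hi
        rw [Fin.lt_def]; omega)
      have := rotate_append hrot b (a ++ c :: t) (by simpa using hP')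
      simpa using this
    · push Not at hc
      refine ih v t (fun i hi => ?_) (fun i hi => ?_) htp
      · have h4 := h2 i hi
        have h5 := hc i hi
        omega
      · have := ht i hi; omega

end Words

end TLCat

namespace TLCat

open scoped LaurentPolynomial

/-! ### Functionals on the Temperley-Lieb algebra -/

section TemperleyLieb

variable {n : ℕ}

/-- The quantum number `[2]` as a Laurent polynomial. -/
noncomputable def qnum : ℤ[T;T⁻¹] := LaurentPolynomial.T 1 + LaurentPolynomial.T (-1)

theorem uGen_sq (i : Fin n) : uGen i * uGen i = qnum • uGen i := by
  have := RingQuot.mkAlgHom_rel ℤ[T;T⁻¹] (TLRel.sq (n := n) i)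
  rwa [map_mul, map_smul] at this

theorem uGen_comm {i j : Fin n} (h : Distant i j) : uGen i * uGen j = uGen j * uGen i := by
  have := RingQuot.mkAlgHom_rel ℤ[T;T⁻¹] (TLRel.comm (n := n) i j h)
  rwa [map_mul, map_mul] at this

theorem uGen_braid {i j : Fin n} (h : Adjacent i j) : uGen i * uGen j * uGen i = uGen i := by
  have := RingQuot.mkAlgHom_rel ℤ[T;T⁻¹] (TLRel.braid (n := n) i j h)
  rwa [map_mul, map_mul] at this

@[simp] theorem uWord_nil : uWord ([] : Word n) = 1 := rfl

theorem uWord_cons (i : Fin n) (w : Word n) : uWord (i :: w) = uGen i * uWord w := by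
  simp [uWord]

theorem uWord_append (v w : Word n) : uWord (v ++ w) = uWord v * uWord w := by
  simp [uWord]

theorem uWord_double (l r : Word n) (i : Fin n) :
    uWord (l ++ i :: i :: r) = qnum • uWord (l ++ i :: r) := by
  simp only [uWord_append, uWord_cons]
  rw [← mul_assoc (uGen i), uGen_sq, smul_mul_assoc, mul_smul_comm]

theorem uWord_swap (l r : Word n) {i j : Fin n} (h : Distant i j) :
    uWord (l ++ i :: j :: r) = uWord (l ++ j :: i :: r) := by
  simp only [uWord_append, uWord_cons]
  rw [← mul_assoc (uGen i), uGen_comm h, mul_assoc]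

theorem uWord_sandwich (l r : Word n) {i j : Fin n} (h : Adjacent i j) :
    uWord (l ++ i :: j :: i :: r) = uWord (l ++ i :: r) := by
  simp only [uWord_append, uWord_cons]
  rw [← mul_assoc (uGen j), ← mul_assoc (uGen i), ← mul_assoc (uGen i), uGen_braid h]

/-- This makes linear maps determined by their values on words; pairings are only additive and use
`tl_additive_ext` instead. -/
theorem span_uWord : Submodule.span ℤ[T;T⁻¹] (Set.range (uWord (n := n))) = ⊤ := by
  rw [eq_top_iff]
  intro x _
  obtain ⟨y, rfl⟩ := RingQuot.mkAlgHom_surjective ℤ[T;T⁻¹] (TLRel n) x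
  have hmul : ∀ a b : TL n, a ∈ Submodule.span ℤ[T;T⁻¹] (Set.range (uWord (n := n))) →
      b ∈ Submodule.span ℤ[T;T⁻¹] (Set.range (uWord (n := n))) →
      a * b ∈ Submodule.span ℤ[T;T⁻¹] (Set.range (uWord (n := n))) := by
    intro a b ha hb
    induction ha using Submodule.span_induction with
    | mem a ha =>
      obtain ⟨v, rfl⟩ := ha
      induction hb using Submodule.span_induction with
      | mem b hb =>
        obtain ⟨w, rfl⟩ := hb
        rw [← uWord_append]
        exact Submodule.subset_span ⟨_, rfl⟩
      | zero => simp
      | add x y _ _ hx hy => rw [mul_add]; exact add_mem hx hy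
      | smul c x _ hx => rw [mul_smul_comm]; exact Submodule.smul_mem _ _ hx
    | zero => simp
    | add x y _ _ hx hy => rw [add_mul]; exact add_mem hx hy
    | smul c x _ hx => rw [smul_mul_assoc]; exact Submodule.smul_mem _ _ hx
  induction y using FreeAlgebra.induction with
  | grade0 r =>
    rw [AlgHom.commutes, Algebra.algebraMap_eq_smul_one]
    exact Submodule.smul_mem _ _ (Submodule.subset_span ⟨[], rfl⟩)
  | grade1 i => exact Submodule.subset_span ⟨[i], by simp [uWord]; rfl⟩
  | mul a b ha hb => rw [map_mul]; exact hmul _ _ (ha trivial) (hb trivial)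
  | add a b ha hb => rw [map_add]; exact add_mem (ha trivial) (hb trivial)

/-- Additive functions on the Temperley-Lieb algebra agree if they agree on multiples `t ^ a u_w`. -/
theorem tl_additive_ext {A : Type*} [AddCommGroup A] {f f' : TL n → A}
    (hf : ∀ x y, f (x + y) = f x + f y) (hf' : ∀ x y, f' (x + y) = f' x + f' y)
    (h : ∀ (a : ℤ) (w : Word n), f ((LaurentPolynomial.T a : ℤ[T;T⁻¹]) • uWord w) =
      f' ((LaurentPolynomial.T a : ℤ[T;T⁻¹]) • uWord w)) (x : TL n) : f x = f' x := by
  have h0 : ∀ e : TL n → A, (∀ x y, e (x + y) = e x + e y) → e 0 = 0 := by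
    intro e he
    simpa using he 0 0
  have hx : x ∈ Submodule.span ℤ[T;T⁻¹] (Set.range (uWord (n := n))) := by simp [span_uWord]
  suffices H : ∀ c : ℤ[T;T⁻¹], f (c • x) = f' (c • x) by simpa using H 1
  induction hx using Submodule.span_induction with
  | mem x hx =>
    obtain ⟨w, rfl⟩ := hx
    intro c
    induction c using LaurentPolynomial.induction_on' with
    | add c c' hc hc' => rw [add_smul, hf, hf', hc, hc']
    | C_mul_T a c =>
      have key : ∀ e : TL n → A, (∀ x y, e (x + y) = e x + e y) → ∀ b b' : ℤ,
          e ((LaurentPolynomial.C (b + b') * LaurentPolynomial.T a : ℤ[T;T⁻¹]) • uWord w) =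
          e ((LaurentPolynomial.C b * LaurentPolynomial.T a : ℤ[T;T⁻¹]) • uWord w) +
          e ((LaurentPolynomial.C b' * LaurentPolynomial.T a : ℤ[T;T⁻¹]) • uWord w) := by
        intro e he b b'
        rw [map_add, add_mul, add_smul, he]
      have := AddMonoidHom.ext_int
        (f := AddMonoidHom.mk' (fun b : ℤ => f ((LaurentPolynomial.C b * LaurentPolynomial.T a :
          ℤ[T;T⁻¹]) • uWord w)) (key f hf))
        (g := AddMonoidHom.mk' (fun b : ℤ => f' ((LaurentPolynomial.C b * LaurentPolynomial.T a :
          ℤ[T;T⁻¹]) • uWord w)) (key f' hf')) (by simpa using h a w)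
      exact DFunLike.congr_fun this c
  | zero => intro c; rw [smul_zero, h0 f hf, h0 f' hf']
  | add x y _ _ hx hy => intro c; rw [smul_add, hf, hf', hx, hy]
  | smul c x _ hx => intro c'; rw [smul_smul]; exact hx _

variable {M : Type*} [AddCommGroup M] [Module ℤ[T;T⁻¹] M]

/-- Functions of words that satisfy the Temperley-Lieb relations. -/
def tlFun (n : ℕ) (M : Type*) [AddCommGroup M] [Module ℤ[T;T⁻¹] M] :
    Submodule ℤ[T;T⁻¹] (Word n → M) where
  carrier := {g | (∀ (l r : Word n) (i : Fin n), g (l ++ i :: i :: r) = qnum • g (l ++ i :: r)) ∧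
    (∀ (l r : Word n) (i j : Fin n), Distant i j → g (l ++ i :: j :: r) = g (l ++ j :: i :: r)) ∧
    ∀ (l r : Word n) (i j : Fin n), Adjacent i j →
      g (l ++ i :: j :: i :: r) = g (l ++ i :: r)}
  add_mem' := by
    rintro g g' ⟨h1, h2, h3⟩ ⟨h1', h2', h3'⟩
    refine ⟨fun l r i => ?_, fun l r i j h => ?_, fun l r i j h => ?_⟩
    · simp [h1, h1']
    · simp [h2 l r i j h, h2' l r i j h]
    · simp [h3 l r i j h, h3' l r i j h]
  zero_mem' := by simp
  smul_mem' := by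
    rintro c g ⟨h1, h2, h3⟩
    refine ⟨fun l r i => ?_, fun l r i j h => ?_, fun l r i j h => ?_⟩
    · simp [h1, smul_comm c]
    · simp [h2 l r i j h]
    · simp [h3 l r i j h]

/-- Translation of functions of words by a letter on the right. -/
def tlShift (M : Type*) [AddCommGroup M] [Module ℤ[T;T⁻¹] M] (i : Fin n) :
    Module.End ℤ[T;T⁻¹] (tlFun n M) where
  toFun g := ⟨fun w => g.1 (w ++ [i]), by
    obtain ⟨g, h1, h2, h3⟩ := g
    refine ⟨fun l r c => ?_, fun l r c d h => ?_, fun l r c d h => ?_⟩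
    · simpa using h1 l (r ++ [i]) c
    · simpa using h2 l (r ++ [i]) c d h
    · simpa using h3 l (r ++ [i]) c d h⟩
  map_add' _ _ := rfl
  map_smul' _ _ := rfl

theorem tlShift_apply (i : Fin n) (g : tlFun n M) (w : Word n) :
    (tlShift M i g).1 w = g.1 (w ++ [i]) := rfl

/-- The action of the Temperley-Lieb algebra on functions of words. -/
noncomputable def tlAct (n : ℕ) (M : Type*) [AddCommGroup M] [Module ℤ[T;T⁻¹] M] :
    TL n →ₐ[ℤ[T;T⁻¹]] Module.End ℤ[T;T⁻¹] (tlFun n M) :=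
  RingQuot.liftAlgHom ℤ[T;T⁻¹] ⟨FreeAlgebra.lift ℤ[T;T⁻¹] (tlShift M), by
    intro x y h
    cases h with
    | sq i =>
      rw [map_mul, map_smul, FreeAlgebra.lift_ι_apply]
      refine LinearMap.ext fun g => Subtype.ext (funext fun w => ?_)
      have := g.2.1 w [] i
      simp only [Module.End.mul_apply, tlShift_apply, List.append_assoc]
      exact this
    | comm i j h =>
      rw [map_mul, map_mul, FreeAlgebra.lift_ι_apply, FreeAlgebra.lift_ι_apply]
      refine LinearMap.ext fun g => Subtype.ext (funext fun w => ?_)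
      have := g.2.2.1 w [] i j h
      simp only [Module.End.mul_apply, tlShift_apply, List.append_assoc]
      exact this
    | braid i j h =>
      rw [map_mul, map_mul, FreeAlgebra.lift_ι_apply, FreeAlgebra.lift_ι_apply]
      refine LinearMap.ext fun g => Subtype.ext (funext fun w => ?_)
      have := g.2.2.2 w [] i j h
      simp only [Module.End.mul_apply, tlShift_apply, List.append_assoc]
      exact this⟩

/-- At `v = []` the action returns the function itself. Compatible values on words thus define a
linear map on the algebra, and no basis of the algebra is needed. -/
theorem tlAct_uWord (w v : Word n) (g : tlFun n M) :
    (tlAct n M (uWord w) g).1 v = g.1 (v ++ w) := by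
  induction w generalizing v with
  | nil => simp
  | cons i w ih =>
    have h1 : tlAct n M (uGen i) = tlShift M i := by
      rw [tlAct, uGen, RingQuot.liftAlgHom_mkAlgHom_apply, FreeAlgebra.lift_ι_apply]
    rw [uWord_cons, map_mul, h1, Module.End.mul_apply, tlShift_apply, ih]
    simp

/-- The linear map on the Temperley-Lieb algebra with given values on words. -/
noncomputable def tlLift (g : tlFun n M) : TL n →ₗ[ℤ[T;T⁻¹]] M where
  toFun x := (tlAct n M x g).1 []
  map_add' x y := by simp
  map_smul' c x := by simp

theorem tlLift_uWord (g : tlFun n M) (w : Word n) : tlLift g (uWord w) = g.1 w :=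
  tlAct_uWord w [] g

theorem tl_hom_ext {f f' : TL n →ₗ[ℤ[T;T⁻¹]] M} (h : ∀ w, f (uWord w) = f' (uWord w)) :
    f = f' :=
  LinearMap.ext_on_range span_uWord h

/-! ### Two-sided series as a module -/

/-- Two-sided series, with `t` acting by translation of coefficients. -/
def Series : Type := ℤ → ℤ

instance : AddCommGroup Series := inferInstanceAs (AddCommGroup (ℤ → ℤ))

/-- Multiplication by `t ^ a`. -/
def shiftHom : Multiplicative ℤ →* Module.End ℤ Series where
  toFun a :=
    { toFun := fun f m => f (m - a.toAdd)
      map_add' := fun _ _ => rfl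
      map_smul' := fun _ _ => rfl }
  map_one' := LinearMap.ext fun f => funext fun m => by
    change f (m - 0) = f m
    rw [sub_zero]
  map_mul' a b := LinearMap.ext fun f => funext fun m => by
    change f (m - (a.toAdd + b.toAdd)) = f (m - a.toAdd - b.toAdd)
    rw [sub_sub]

noncomputable instance : Module ℤ[T;T⁻¹] Series :=
  Module.compHom Series (AddMonoidAlgebra.lift ℤ (Module.End ℤ Series) ℤ shiftHom).toRingHom

theorem T_smul_series (a : ℤ) (f : Series) (m : ℤ) :
    ((LaurentPolynomial.T a : ℤ[T;T⁻¹]) • f) m = f (m - a) := by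
  change (AddMonoidAlgebra.lift ℤ (Module.End ℤ Series) ℤ shiftHom) (LaurentPolynomial.T a) f m = _
  rw [LaurentPolynomial.T, AddMonoidAlgebra.lift_single, one_smul]
  rfl

theorem qnum_smul_series (f : Series) (m : ℤ) :
    (qnum • f) m = f (m - 1) + f (m + 1) := by
  rw [qnum, add_smul]
  change ((LaurentPolynomial.T 1 : ℤ[T;T⁻¹]) • f) m + ((LaurentPolynomial.T (-1) : ℤ[T;T⁻¹]) • f) m
    = _
  rw [T_smul_series, T_smul_series, sub_neg_eq_add]

/-- Linear maps to series, with `t` acting by its inverse. -/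
def Twisted (n : ℕ) : Type := TL n →ₗ[ℤ[T;T⁻¹]] Series

noncomputable instance : AddCommGroup (Twisted n) :=
  inferInstanceAs (AddCommGroup (TL n →ₗ[ℤ[T;T⁻¹]] Series))

noncomputable instance : Module ℤ[T;T⁻¹] (Twisted n) :=
  Module.compHom (TL n →ₗ[ℤ[T;T⁻¹]] Series)
    (LaurentPolynomial.invert (R := ℤ)).toAlgHom.toRingHom

/-- The linear map underlying an element of `Twisted n`. -/
def Twisted.toLin (f : Twisted n) : TL n →ₗ[ℤ[T;T⁻¹]] Series := f

theorem Twisted.toLin_smul (c : ℤ[T;T⁻¹]) (f : Twisted n) :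
    (c • f).toLin = LaurentPolynomial.invert c • f.toLin := rfl

theorem Twisted.ext_uWord {f f' : Twisted n}
    (h : ∀ w, f.toLin (uWord w) = f'.toLin (uWord w)) : f = f' :=
  tl_hom_ext h

theorem invert_qnum : LaurentPolynomial.invert qnum = qnum := by
  rw [qnum, map_add, LaurentPolynomial.invert_T, LaurentPolynomial.invert_T, neg_neg, add_comm]

/-- The pairing defined by a function of words that satisfies the Temperley-Lieb relations. -/
theorem exists_pairing (g : tlFun n Series)
    (hrot : ∀ (i : Fin n) (w : Word n), g.1 (i :: w) = g.1 (w ++ [i])) :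
    ∃ B : TL n →+ TL n →+ TwoSided, IsPairing n B ∧ ∀ w, B 1 (uWord w) = g.1 w := by
  obtain ⟨g, hd, hs, hb⟩ := g
  have hmem : ∀ v : Word n, (fun w => g (v.reverse ++ w)) ∈ tlFun n Series := by
    intro v
    refine ⟨fun l r i => ?_, fun l r i j h => ?_, fun l r i j h => ?_⟩
    · simpa using hd (v.reverse ++ l) r i
    · simpa using hs (v.reverse ++ l) r i j h
    · simpa using hb (v.reverse ++ l) r i j h
  -- Adjointness moves `u_v` across the pairing and reverses it, so `(u_v, u_w)` must be the value
  -- at `v.reverse ++ w`. The twisted target makes the first variable linear, so the lifting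
  -- construction can be applied a second time.
  set G : Word n → Twisted n := fun v => (tlLift ⟨_, hmem v⟩ : TL n →ₗ[ℤ[T;T⁻¹]] Series) with hG
  have hGw : ∀ v w : Word n, (G v).toLin (uWord w) = g (v.reverse ++ w) :=
    fun v w => tlLift_uWord _ w
  have hGmem : G ∈ tlFun n (Twisted n) := by
    refine ⟨fun l r i => ?_, fun l r i j h => ?_, fun l r i j h => ?_⟩
    · refine Twisted.ext_uWord fun w => ?_
      rw [Twisted.toLin_smul, invert_qnum, hGw, LinearMap.smul_apply, hGw]
      simpa using hd r.reverse (l.reverse ++ w) i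
    · refine Twisted.ext_uWord fun w => ?_
      rw [hGw, hGw]
      simpa using hs r.reverse (l.reverse ++ w) j i h.symm
    · refine Twisted.ext_uWord fun w => ?_
      rw [hGw, hGw]
      simpa using hb r.reverse (l.reverse ++ w) i j h
  set Φ : TL n →ₗ[ℤ[T;T⁻¹]] Twisted n := tlLift ⟨G, hGmem⟩ with hΦ
  have hΦw : ∀ v w : Word n, (Φ (uWord v)).toLin (uWord w) =
      g (v.reverse ++ w) := by
    intro v w
    rw [hΦ, tlLift_uWord]
    exact hGw v w
  let B : TL n →+ TL n →+ TwoSided :=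
    { toFun := fun x => (Φ x).toLin.toAddMonoidHom
      map_zero' := by rw [map_zero]; rfl
      map_add' := fun x y => by rw [map_add]; rfl }
  have hBw : ∀ v w : Word n, B (uWord v) (uWord w) = g (v.reverse ++ w) := hΦw
  have hr : ∀ (a : ℤ) (x y : TL n) (m : ℤ),
      B x ((LaurentPolynomial.T a : ℤ[T;T⁻¹]) • y) m = B x y (m - a) := by
    intro a x y m
    change (Φ x).toLin ((LaurentPolynomial.T a : ℤ[T;T⁻¹]) • y) m = _
    rw [map_smul, T_smul_series]
    rfl
  have hl : ∀ (a : ℤ) (x y : TL n) (m : ℤ),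
      B ((LaurentPolynomial.T a : ℤ[T;T⁻¹]) • x) y m = B x y (m + a) := by
    intro a x y m
    change (Φ ((LaurentPolynomial.T a : ℤ[T;T⁻¹]) • x)).toLin y m = _
    rw [map_smul, Twisted.toLin_smul, LaurentPolynomial.invert_T]
    change ((LaurentPolynomial.T (-a) : ℤ[T;T⁻¹]) • (Φ x).toLin y) m = _
    rw [T_smul_series, sub_neg_eq_add]
    rfl
  refine ⟨B, ⟨hl, hr, ?_, ?_⟩, fun w => hBw [] w⟩
  · intro i x y
    refine tl_additive_ext (f := fun x => B x (uGen i * y)) (f' := fun x => B (uGen i * x) y)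
      (fun x x' => by simp only [map_add, AddMonoidHom.add_apply])
      (fun x x' => by simp only [mul_add, map_add, AddMonoidHom.add_apply]) (fun a v => ?_) x
    refine tl_additive_ext (f := fun y => B _ (uGen i * y)) (f' := fun y => B _ y)
      (fun y y' => by simp only [mul_add, map_add]) (fun y y' => by rw [map_add]) (fun b w => ?_) y
    · funext m
      rw [mul_smul_comm, mul_smul_comm, hr, hl, hr, hl, ← uWord_cons, ← uWord_cons, hBw, hBw]
      simp
  · intro i x y
    refine tl_additive_ext (f := fun x => B x (y * uGen i)) (f' := fun x => B (x * uGen i) y)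
      (fun x x' => by simp only [map_add, AddMonoidHom.add_apply])
      (fun x x' => by simp only [add_mul, map_add, AddMonoidHom.add_apply]) (fun a v => ?_) x
    refine tl_additive_ext (f := fun y => B _ (y * uGen i)) (f' := fun y => B _ y)
      (fun y y' => by simp only [add_mul, map_add]) (fun y y' => by rw [map_add]) (fun b w => ?_) y
    · funext m
      have h1 : ∀ u : Word n, uWord u * uGen i = uWord (u ++ [i]) := by
        intro u; rw [uWord_append, uWord_cons, uWord_nil, mul_one]
      rw [smul_mul_assoc, smul_mul_assoc, hr, hl, hr, hl, h1, h1, hBw, hBw]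
      -- Self-adjointness for right multiplication is rotation invariance of the values on words.
      have := hrot i (v.reverse ++ w)
      simp only [List.reverse_append, List.reverse_cons, List.reverse_nil, List.nil_append,
        List.cons_append, List.append_assoc] at this ⊢
      rw [this]

/-- A pairing is determined by its values on pairs `(1, u_w)`. -/
theorem IsPairing.apply_uWord {B : TL n →+ TL n →+ TwoSided} (hB : IsPairing n B) (v w : Word n) :
    B (uWord v) (uWord w) = B 1 (uWord (v.reverse ++ w)) := by
  induction v generalizing w with
  | nil => simp
  | cons i v ih =>
    rw [uWord_cons, ← hB.adjoint_left, ← uWord_cons, ih]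
    simp

theorem IsPairing.rotate {B : TL n →+ TL n →+ TwoSided} (hB : IsPairing n B) (i : Fin n)
    (w : Word n) : B 1 (uWord (i :: w)) = B 1 (uWord (w ++ [i])) := by
  rw [uWord_cons, hB.adjoint_left, uWord_append, uWord_cons, uWord_nil, mul_one,
    hB.adjoint_right, one_mul]

theorem IsPairing.double {B : TL n →+ TL n →+ TwoSided} (hB : IsPairing n B) (x y : TL n) (m : ℤ) :
    B x (qnum • y) m = B x y (m + 1) + B x y (m - 1) := by
  rw [qnum, add_smul, map_add]
  change B x _ m + B x _ m = _
  rw [hB.linear_right, hB.linear_right, sub_neg_eq_add, add_comm]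

theorem IsPairing.ext {B B' : TL n →+ TL n →+ TwoSided} (hB : IsPairing n B)
    (hB' : IsPairing n B') (h : ∀ w, B 1 (uWord w) = B' 1 (uWord w)) : B = B' := by
  refine AddMonoidHom.ext fun x => AddMonoidHom.ext fun y => ?_
  refine tl_additive_ext (f := fun x => B x y) (f' := fun x => B' x y)
    (fun x x' => by rw [map_add, AddMonoidHom.add_apply])
    (fun x x' => by rw [map_add, AddMonoidHom.add_apply]) (fun a v => ?_) x
  refine tl_additive_ext (map_add (B _)) (map_add (B' _)) (fun b w => ?_) y
  funext m
  rw [hB.semilinear_left, hB'.semilinear_left, hB.linear_right, hB'.linear_right,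
    hB.apply_uWord, hB'.apply_uWord, h]

end TemperleyLieb

end TLCat

namespace TLCat

/-! ### Graded dimensions and the pairing -/

section GradedDimension

variable {k : Type*} [Field k] {n : ℕ}

theorem gradedDim_of_ne_nil {w : Word n} (hw : w.Pairwise (· < ·)) (hne : w ≠ []) (m : ℤ) :
    Module.Finite k (homDeg k [] w m) ∧ (Module.finrank k (homDeg k [] w m) : ℤ) =
      (tt ^ n * qTwo ^ (n - w.length) * geom).coeff m := by
  have hlen : w.length ≤ n := by
    have hnd : w.Nodup := hw.imp fun h => ne_of_lt h
    simpa using hnd.length_le_card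
  rw [tt_pow_mul_qTwo_pow hlen, mul_assoc, coeff_tt_pow_mul]
  obtain ⟨h1, h2⟩ := coeff_pow_mul_geom (n - w.length)
  by_cases hm : ∃ r : ℕ, m = 2 * (r : ℤ) + w.length
  · obtain ⟨r, rfl⟩ := hm
    obtain ⟨hfin, hrank⟩ := finrank_homDeg_of_ne_nil (k := k) hw hne r
    exact ⟨hfin, by rw [hrank, add_sub_cancel_right, h1]⟩
  · push Not at hm
    rw [homDeg_eq_bot hw hm, h2 _ fun r hr => hm r (by lia)]
    exact ⟨inferInstance, by simp⟩

theorem gradedDim_nil (m : ℤ) :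
    Module.Finite k (homDeg k ([] : Word n) [] m) ∧
      (Module.finrank k (homDeg k ([] : Word n) [] m) : ℤ) =
        ((tt ^ n * qTwo ^ n - tt ^ 2) * geom).coeff m := by
  have hval : ((tt ^ n * qTwo ^ n - tt ^ 2) * geom).coeff m =
      ((1 + tt ^ 2) ^ n * geom).coeff m - geom.coeff (m - 2) := by
    have h := tt_pow_mul_qTwo_pow (Nat.zero_le n)
    rw [Nat.sub_zero, pow_zero, one_mul] at h
    rw [sub_mul, h, HahnSeries.coeff_sub, coeff_tt_pow_mul]
    rfl
  rw [hval]
  obtain ⟨h1, h2⟩ := coeff_pow_mul_geom n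
  by_cases hm : ∃ r : ℕ, m = 2 * (r : ℤ)
  · obtain ⟨r, rfl⟩ := hm
    rw [h1]
    cases r with
    | zero =>
      obtain ⟨hfin, hrank⟩ := finrank_homDeg_nil_zero (k := k) (n := n)
      rw [coeff_geom_other (m := 2 * ((0 : ℕ) : ℤ) - 2) fun r hr => by lia]
      rw [show 2 * ((0 : ℕ) : ℤ) = 0 from rfl]
      exact ⟨hfin, by simp [hrank]⟩
    | succ r =>
      obtain ⟨hfin, hrank⟩ := finrank_homDeg_nil_succ (k := k) (n := n) r
      have h3 : (2 * ((r + 1 : ℕ) : ℤ) - 2) = 2 * (r : ℤ) := by push_cast; ring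
      rw [h3, coeff_geom_even, ← hrank]
      exact ⟨hfin, by push_cast; ring⟩
  · push Not at hm
    rw [homDeg_eq_bot (List.Pairwise.nil) (fun r => by simpa using hm r), h2 _ hm,
      coeff_geom_other fun r hr => hm (r + 1) (by push_cast; lia)]
    exact ⟨inferInstance, by simp⟩

/-- Finiteness comes before dimension counts, because `finrank` is additive on products only for
finite-dimensional factors. -/
theorem finite_homDeg_nil (h2 : (2 : k) ≠ 0) (w : Word n) (m : ℤ) :
    Module.Finite k (homDeg k [] w m) := by
  have hP : TLClosed (fun w : Word n => ∀ m, Module.Finite k (homDeg k [] w m)) := by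
    refine ⟨fun l r i h m => ?_, fun l r i j hij h m => ?_, fun l r i j hij h m => ?_⟩
    · obtain ⟨e⟩ := nonempty_equiv_double (k := k) l r h2 i [] m
      have := h (m + 1)
      have := h (m - 1)
      exact Module.Finite.equiv e.symm
    · obtain ⟨e⟩ := nonempty_equiv_sandwich (k := k) l r hij [] m
      have := h m
      exact Module.Finite.equiv e.symm
    · obtain ⟨e⟩ := nonempty_equiv_swap (k := k) l r hij [] m
      have := h m
      exact Module.Finite.equiv e
  refine hP.forall_of_increasing (fun i v h m => ?_) (fun w hw m => ?_) w m
  · obtain ⟨e⟩ := nonempty_equiv_rotate (k := k) i v m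
    have := h m
    exact Module.Finite.equiv e
  · rcases eq_or_ne w [] with rfl | hne
    · exact (gradedDim_nil m).1
    · exact (gradedDim_of_ne_nil hw hne m).1

/-- The graded dimension of `HOM(∅, w)`. -/
noncomputable def gdim (k : Type*) [Field k] {n : ℕ} (w : Word n) : Series :=
  fun m => (Module.finrank k (homDeg k [] w m) : ℤ)

/-- The three isomorphisms of objects give the three Temperley-Lieb relations for dimensions; the
two degree shifts of `ii` become `[2]`. -/
theorem gdim_mem_tlFun (h2 : (2 : k) ≠ 0) : gdim k ∈ tlFun n Series := by
  refine ⟨fun l r i => funext fun m => ?_, fun l r i j h => funext fun m => ?_,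
    fun l r i j h => funext fun m => ?_⟩
  · obtain ⟨e⟩ := nonempty_equiv_double (k := k) l r h2 i [] m
    have := finite_homDeg_nil h2 (l ++ i :: r) (m + 1)
    have := finite_homDeg_nil h2 (l ++ i :: r) (m - 1)
    rw [qnum_smul_series]
    change (Module.finrank k _ : ℤ) = (Module.finrank k _ : ℤ) + (Module.finrank k _ : ℤ)
    rw [e.finrank_eq, Module.finrank_prod, add_comm]
    push_cast
    rfl
  · obtain ⟨e⟩ := nonempty_equiv_swap (k := k) l r h [] m
    exact congrArg Nat.cast e.finrank_eq
  · obtain ⟨e⟩ := nonempty_equiv_sandwich (k := k) l r h [] m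
    exact congrArg Nat.cast e.finrank_eq

theorem gdim_rotate (i : Fin n) (w : Word n) : gdim k (i :: w) = gdim k (w ++ [i]) := by
  funext m
  obtain ⟨e⟩ := nonempty_equiv_rotate (k := k) i w m
  exact congrArg Nat.cast e.finrank_eq

/-- Equality of the values `(1, u_w)` is compatible with the word relations and with rotation, so it
spreads from increasing words to all words. -/
theorem IsPsiZero.unique {B B' : TL n →+ TL n →+ TwoSided} (hB : IsPsiZero n B)
    (hB' : IsPsiZero n B') : B = B' := by
  refine hB.pairing.ext hB'.pairing fun w => ?_
  have hP : TLClosed (fun w : Word n => B 1 (uWord w) = B' 1 (uWord w)) := by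
    refine ⟨fun l r i h => ?_, fun l r i j hij h => ?_, fun l r i j hij h => ?_⟩
    · funext m
      rw [uWord_double, hB.pairing.double, hB'.pairing.double, h]
    · rwa [uWord_sandwich l r hij]
    · rwa [← uWord_swap l r hij]
  refine hP.forall_of_increasing (fun i v h => ?_) (fun w hw => funext fun m => ?_) w
  · rwa [← hB.pairing.rotate, ← hB'.pairing.rotate]
  · rcases eq_or_ne w [] with rfl | hne
    · rw [uWord_nil, hB.one_one, hB'.one_one]
    · rw [hB.one_word w hw hne, hB'.one_word w hw hne]

theorem exists_isPsiZero (h2 : (2 : k) ≠ 0) :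
    ∃ B, IsPsiZero n B ∧ ∀ w, B 1 (uWord w) = gdim k w := by
  obtain ⟨B, hB, hw⟩ := exists_pairing ⟨gdim k, gdim_mem_tlFun h2⟩ gdim_rotate
  refine ⟨B, ⟨hB, fun m => ?_, fun w hinc hne m => ?_⟩, hw⟩
  · have := congrFun (hw []) m
    rw [uWord_nil] at this
    rw [this]
    exact (gradedDim_nil (k := k) m).2
  · rw [hw]
    exact (gradedDim_of_ne_nil (k := k) hinc hne m).2

/-- By uniqueness the given pairing is the one built from dimensions. Bending the source strands
upwards reverses `v`, just as adjointness does. -/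
theorem IsPsiZero.gradedDim {B : TL n →+ TL n →+ TwoSided} (hB : IsPsiZero n B)
    (h2 : (2 : k) ≠ 0) (v w : Word n) (m : ℤ) :
    Module.Finite k (homDeg k v w m) ∧
      (Module.finrank k (homDeg k v w m) : ℤ) = B (uWord v) (uWord w) m := by
  obtain ⟨B', hB', hval⟩ := exists_isPsiZero (n := n) h2
  obtain rfl := hB.unique hB'
  obtain ⟨e⟩ := nonempty_equiv_reverse (k := k) v w m
  have := finite_homDeg_nil h2 (v.reverse ++ w) m
  refine ⟨Module.Finite.equiv e.symm, ?_⟩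
  rw [hB.pairing.apply_uWord, hval, e.finrank_eq]
  rfl

/-- `R / I_w` is isomorphic to `HOM(∅, w)`. -/
noncomputable def quotientEquiv (k : Type*) [Field k] {w : Word n} (hw : w.Pairwise (· < ·)) :
    (MvPolynomial (Fin n) k ⧸ annIdeal k w) ≃ₗ[k] HOM k [] w :=
  LinearEquiv.ofBijective
    ((((annIdeal k w).restrictScalars k).liftQ (polyMap k w) fun _ hp => hp) ∘ₗ
      (Submodule.Quotient.restrictScalarsEquiv k (annIdeal k w)).symm.toLinearMap) <| by
    constructor
    · rw [injective_iff_map_eq_zero]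
      intro x hx
      obtain ⟨p, rfl⟩ := Ideal.Quotient.mk_surjective x
      exact Ideal.Quotient.eq_zero_iff_mem.2 hx
    · intro y
      obtain ⟨p, rfl⟩ := polyMap_surjective (k := k) w hw y
      exact ⟨Ideal.Quotient.mk _ p, rfl⟩

theorem quotientEquiv_mk {w : Word n} (hw : w.Pairwise (· < ·)) (p : MvPolynomial (Fin n) k) :
    quotientEquiv k hw (Ideal.Quotient.mk _ p) = polyMap k w p := rfl

end GradedDimension

end TLCat

/-! ### Assembling the three statements. -/

theorem lemma3p2 {k : Type*} [Field k] (n : ℕ) (hk : ((2 * (n + 1) : ℕ) : k) ≠ 0) :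
    -- there is exactly one pairing `ψ₀` on the Temperley-Lieb algebra with the prescribed values
    (∃! ψ : TLCat.TL n →+ TLCat.TL n →+ TLCat.TwoSided, TLCat.IsPsiZero n ψ) ∧
    -- it is the pairing given by the graded dimensions of all morphism spaces
    (∀ ψ : TLCat.TL n →+ TLCat.TL n →+ TLCat.TwoSided, TLCat.IsPsiZero n ψ →
      ∀ v w : TLCat.Word n,
        DirectSum.IsInternal (TLCat.homDeg k v w) ∧
        ∀ m : ℤ, Module.Finite k (TLCat.homDeg k v w m) ∧
          (Module.finrank k (TLCat.homDeg k v w m) : ℤ)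
            = ψ (TLCat.uWord v) (TLCat.uWord w) m) ∧
    -- for increasing `w` of length `d`, `p ↦ p · φ_w` induces `R / I_w ≅ HOM(∅, w)`, where degree
    -- `r` in the `f_i` (degree `2r` in `R`) corresponds to degree `2r + d`
    (∀ w : TLCat.Word n, w.Pairwise (· < ·) →
      ∃ (I : Ideal (MvPolynomial (Fin n) k))
        (e : (MvPolynomial (Fin n) k ⧸ I) ≃ₗ[k] TLCat.HOM k [] w),
        (∀ p : MvPolynomial (Fin n) k, e (Ideal.Quotient.mk I p) = TLCat.polyMap k w p) ∧
        ∀ r : ℕ,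
          ((MvPolynomial.homogeneousSubmodule (Fin n) k r).map
              (Ideal.Quotient.mkₐ k I).toLinearMap).map e.toLinearMap
            = TLCat.homDeg k [] w (2 * (r : ℤ) + w.length)) := by
  -- Invertibility of 2 is what splits `ii` into two shifted copies of `i`.
  have h2 : (2 : k) ≠ 0 := by
    intro h
    apply hk
    push_cast
    rw [h, zero_mul]
  refine ⟨?_, fun ψ hψ v w => ⟨TLCat.isInternal_homDeg v w, hψ.gradedDim h2 v w⟩, fun w hw =>
    ⟨TLCat.annIdeal k w, TLCat.quotientEquiv k hw, TLCat.quotientEquiv_mk hw, fun r => ?_⟩⟩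
  · obtain ⟨ψ, hψ, -⟩ := TLCat.exists_isPsiZero (n := n) h2
    exact ⟨ψ, hψ, fun ψ' hψ' => hψ'.unique hψ⟩
  · rw [← Submodule.map_comp, ← TLCat.map_homogeneousSubmodule hw]
    rfl
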